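/- Let $K$ be a field of characteristic $0$, let $k\supseteq K$ be an algebraically closed field, and let $$F=ax^3+by^3+cz^3+a_2x^2y+a_3x^2z+b_1xy^2+b_3y^2z+c_1xz^2+c_2yz^2+mxyz\in K[x,y,z]$$ be a non-singular ternary cubic with $c\neq 0$. Let $A_F=K\{x,y\}/I$, where $I$ is generated by the coefficients of $\alpha^3,\alpha^2\beta,\alpha\beta^2,\beta^3$ in $F(\alpha,\beta,\alpha x+\beta y)$ ($\alpha,\beta$ commuting with $x,y$ and with each other). Put $$\xi=c^2(xy)^2-(cy^2+c_2y+b_3)(cx^2+c_1x+a_3)+(cm-c_1c_2)xy+a_3b_3,$$ and, with $r=y(cx^2+c_1x+a_3)$, $s=-(cy^2+c_2y+b_3)$, $t=cx$, $$\eta=rst+str+trs+a_2(st+ts)+b_3(tr+rt)+c_1(rs+sr)+(b_3c_1-b_1c)r+(c_1a_2-c_2a)s+(a_2b_3-a_3b)t-6abc+a_2b_3c_1.$$ Let $E$ be the Weierstrass curve $\eta^2+A_1\xi\eta+A_3\eta=\xi^3+A_2\xi^2+A_4\xi+A_6$, where $A_1=m$, $A_2=-(a_2c_2+a_3b_3+b_1c_1)$,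 $$A_3=9abc-(ab_3c_2+ba_3c_1+ca_2b_1)-(a_2b_3c_1+a_3b_1c_2),$$ $$A_4=-3(abc_1c_2+acb_1b_3+bca_2a_3)+a(b_1c_2^2+b_3^2c_1)+b(a_2c_1^2+a_3^2c_2)+c(a_2^2b_3+a_3b_1^2)+a_2c_2a_3b_3+b_1c_1a_2c_2+a_3b_3b_1c_1,$$ $$\begin{gathered}A_6=-27a^2 b^2 c^2 +9a^2 b c b_3 c_2 -a^2 b c_2^3 -a^2 c b_3^3 +9a b^2 c a_3 c_1 -a b^2 c_1^3\\ +9a b c^2 a_2 b_1 +3a b c a_2 b_3 c_1 -3a b c a_2 c_2 m +3a b c a_3 b_1 c_2 -3a b c a_3\\ b_3 m -3a b c b_1 c_1 m +a b c m^3 +2a b a_2 c_1 c_2^2 -a b a_3 b_3 c_1 c_2 +a b a_3 c_2^2\\ m +2a b b_1 c_1^2 c_2 +a b b_3 c_1^2 m -a b c_1 c_2 m^2 -a c^2 b_1^3 -a c a_2 b_1 b_3 c_2\\ +a c a_2 b_3^2 m +2a c a_3 b_1 b_3^2 +2a c b_1^2 b_3 c_1 +a c b_1^2 c_2 m -a c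 b_1 b_3 m^2\\ -a a_2 b_3^2 c_1 c_2 -a a_3 b_1 b_3 c_2^2 -a b_1^2 c_1 c_2^2 -a b_1 b_3^2 c_1^2 +a b_1 b_3\\ c_1 c_2 m -b^2 c a_3^3 -b c^2 a_2^3 +2b c a_2^2 a_3 c_2 +b c a_2^2 c_1 m +2b c a_2 a_3^2\\ b_3 -b c a_2 a_3 b_1 c_1 -b c a_2 a_3 m^2 +b c a_3^2 b_1 m -b a_2^2 c_1^2 c_2 -b a_2 a_3^2\\ c_2^2 -b a_2 a_3 b_3 c_1^2 +b a_2 a_3 c_1 c_2 m -b a_3^2 b_1 c_1 c_2 -c a_2^2 a_3 b_3^2 -c\\ a_2^2 b_1 b_3 c_1 -c a_2 a_3 b_1^2 c_2 +c a_2 a_3 b_1 b_3 m -c a_3^2 b_1^2 b_3 -a_2 a_3\\ b_1 b_3 c_1 c_2\end{gathered}$$ (this is the Jacobian of $\{F=0\}$). For $P=(x_P,y_P)\in E(K)$, $P\ne 0_E$, let $A_{F,P}$ be the quotient of $A_F$ by the relations $\xi=x_P$, $\eta=y_P$. Then $E$ is an elliptic curve, and there is an isomorphism of curves $\varphi:\{F=0\}\to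 E$ over $k$, normalised by $$\varphi^*\!\left(\frac{d\xi}{2\eta+A_1\xi+A_3}\right)=\frac{x\,dy-y\,dx}{\partial F/\partial z},$$ such that, writing $\operatorname{sum}(\sum n_QQ)=\sum n_Q\,\varphi(Q)\in E(k)$ for divisors of degree $0$ (the isomorphism $\operatorname{Pic}^0(\{F=0\})\cong E$; it does not depend on the choice of $\varphi$), the following holds for every $0_E\neq P\in E(K)$ and every $K$-algebra isomorphism $\theta:A_{F,P}\to\operatorname{Mat}_3(K)$. Put $M_1=\theta(x)$, $M_2=\theta(y)$, $M_3=-I_3$; these are the slices of a $3\times3\times3$ cube. Let $\mathcal C\subset\mathbb P^2\times\mathbb P^2$ be defined by the three bilinear forms $\sum_{j,l}u_j(M_j)_{il}v_l$, $i=1,2,3$, in $(u;v)$. Then: 1. $F=\lambda\det(xM_1+yM_2+zM_3)$ for some $\lambda\in K^\times$; 2. $\mathcal C$ is a genus one curve (smooth of dimension one, and isomorphic over $k$ to an elliptic curve); 3. the first projection is an isomorphism from $\mathcal C$ onto the plane cubic $\{F=0\}$, and the second projection is an isomorphism from $\mathcal C$ onto the plane cubic defined by the non-singular ternary cubic $F'(v)=\det\big(\sum_l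 (M_j)_{il}v_l\big)_{i,j}$; 4. if $H$ and $H'$ are the pull-backs to $\mathcal C$ of the sections of these two plane cubics by arbitrary lines over $k$, then $H$ and $H'$ have degree $3$ and, identifying $\mathcal C$ with $\{F=0\}$ by the first projection, $\operatorname{sum}(H-H')=P$. -/

import Mathlib

open scoped Matrix LinearAlgebra.Projectivization

/-! ### Ternary cubics, the algebra `A_F` and the Jacobian -/

/-- The ternary cubic
`a x³ + b y³ + c z³ + a2 x²y + a3 x²z + b1 xy² + b3 y²z + c1 xz² + c2 yz² + m xyz`. -/
structure TernaryCubic (K : Type*) where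
  a : K
  b : K
  c : K
  a2 : K
  a3 : K
  b1 : K
  b3 : K
  c1 : K
  c2 : K
  m : K

namespace TernaryCubic

section
variable {K : Type*} [Field K] (F : TernaryCubic K)

/-- The homogeneous polynomial of a ternary cubic, in `x = X 0`, `y = X 1`, `z = X 2`. -/
noncomputable def poly : MvPolynomial (Fin 3) K :=
  let x : MvPolynomial (Fin 3) K := MvPolynomial.X 0
  let y : MvPolynomial (Fin 3) K := MvPolynomial.X 1
  let z : MvPolynomial (Fin 3) K := MvPolynomial.X 2
  F.a • x^3 + F.b • y^3 + F.c • z^3 + F.a2 • (x^2 * y) + F.a3 • (x^2 * z) + F.b1 • (x * y^2)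
    + F.b3 • (y^2 * z) + F.c1 • (x * z^2) + F.c2 • (y * z^2) + F.m • (x * y * z)

/-- The Weierstrass equation `Y² + A₁XY + A₃Y = X³ + A₂X² + A₄X + A₆` of the Jacobian of
`{F = 0}`, with the coefficients of Artin, Rodriguez-Villegas and Tate. -/
def jacobian : WeierstrassCurve K where
  a₁ := F.m
  a₂ := -(F.a2 * F.c2 + F.a3 * F.b3 + F.b1 * F.c1)
  a₃ := 9 * F.a * F.b * F.c - (F.a * F.b3 * F.c2 + F.b * F.a3 * F.c1 + F.c * F.a2 * F.b1)
      - (F.a2 * F.b3 * F.c1 + F.a3 * F.b1 * F.c2)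
  a₄ := -3 * (F.a * F.b * F.c1 * F.c2 + F.a * F.c * F.b1 * F.b3 + F.b * F.c * F.a2 * F.a3)
      + F.a * (F.b1 * F.c2^2 + F.b3^2 * F.c1)
      + F.b * (F.a2 * F.c1^2 + F.a3^2 * F.c2)
      + F.c * (F.a2^2 * F.b3 + F.a3 * F.b1^2)
      + F.a2 * F.c2 * F.a3 * F.b3 + F.b1 * F.c1 * F.a2 * F.c2 + F.a3 * F.b3 * F.b1 * F.c1
  a₆ := -27 * F.a^2 * F.b^2 * F.c^2 + 9 * F.a^2 * F.b * F.c * F.b3 * F.c2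
      - F.a^2 * F.b * F.c2^3 - F.a^2 * F.c * F.b3^3 + 9 * F.a * F.b^2 * F.c * F.a3 * F.c1
      - F.a * F.b^2 * F.c1^3 + 9 * F.a * F.b * F.c^2 * F.a2 * F.b1
      + 3 * F.a * F.b * F.c * F.a2 * F.b3 * F.c1 - 3 * F.a * F.b * F.c * F.a2 * F.c2 * F.m
      + 3 * F.a * F.b * F.c * F.a3 * F.b1 * F.c2 - 3 * F.a * F.b * F.c * F.a3 * F.b3 * F.m
      - 3 * F.a * F.b * F.c * F.b1 * F.c1 * F.m + F.a * F.b * F.c * F.m^3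
      + 2 * F.a * F.b * F.a2 * F.c1 * F.c2^2 - F.a * F.b * F.a3 * F.b3 * F.c1 * F.c2
      + F.a * F.b * F.a3 * F.c2^2 * F.m + 2 * F.a * F.b * F.b1 * F.c1^2 * F.c2
      + F.a * F.b * F.b3 * F.c1^2 * F.m - F.a * F.b * F.c1 * F.c2 * F.m^2
      - F.a * F.c^2 * F.b1^3 - F.a * F.c * F.a2 * F.b1 * F.b3 * F.c2
      + F.a * F.c * F.a2 * F.b3^2 * F.m + 2 * F.a * F.c * F.a3 * F.b1 * F.b3^2
      + 2 * F.a * F.c * F.b1^2 * F.b3 * F.c1 + F.a * F.c * F.b1^2 * F.c2 * F.m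
      - F.a * F.c * F.b1 * F.b3 * F.m^2 - F.a * F.a2 * F.b3^2 * F.c1 * F.c2
      - F.a * F.a3 * F.b1 * F.b3 * F.c2^2 - F.a * F.b1^2 * F.c1 * F.c2^2
      - F.a * F.b1 * F.b3^2 * F.c1^2 + F.a * F.b1 * F.b3 * F.c1 * F.c2 * F.m
      - F.b^2 * F.c * F.a3^3 - F.b * F.c^2 * F.a2^3 + 2 * F.b * F.c * F.a2^2 * F.a3 * F.c2
      + F.b * F.c * F.a2^2 * F.c1 * F.m + 2 * F.b * F.c * F.a2 * F.a3^2 * F.b3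
      - F.b * F.c * F.a2 * F.a3 * F.b1 * F.c1 - F.b * F.c * F.a2 * F.a3 * F.m^2
      + F.b * F.c * F.a3^2 * F.b1 * F.m - F.b * F.a2^2 * F.c1^2 * F.c2
      - F.b * F.a2 * F.a3^2 * F.c2^2 - F.b * F.a2 * F.a3 * F.b3 * F.c1^2
      + F.b * F.a2 * F.a3 * F.c1 * F.c2 * F.m - F.b * F.a3^2 * F.b1 * F.c1 * F.c2
      - F.c * F.a2^2 * F.a3 * F.b3^2 - F.c * F.a2^2 * F.b1 * F.b3 * F.c1
      - F.c * F.a2 * F.a3 * F.b1^2 * F.c2 + F.c * F.a2 * F.a3 * F.b1 * F.b3 * F.m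
      - F.c * F.a3^2 * F.b1^2 * F.b3 - F.a2 * F.a3 * F.b1 * F.b3 * F.c1 * F.c2

section
variable {A : Type*} [Ring A] [Algebra K A]

/-- The four elements, evaluated at elements `x, y` of a `K`-algebra, whose vanishing is the
formal identity `F(α, β, αx + βy) = 0` (coefficients of `α³, α²β, αβ², β³`). -/
def relator (x y : A) : Fin 4 → A :=
  ![F.c • x^3 + F.c1 • x^2 + F.a3 • x + algebraMap K A F.a,
    F.c • (x^2 * y + x * y * x + y * x^2) + F.c1 • (x * y + y * x) + F.c2 • x^2 + F.m • x
      + F.a3 • y + algebraMap K A F.a2,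
    F.c • (x * y^2 + y * x * y + y^2 * x) + F.c2 • (x * y + y * x) + F.c1 • y^2 + F.m • y
      + F.b3 • x + algebraMap K A F.b1,
    F.c • y^3 + F.c2 • y^2 + F.b3 • y + algebraMap K A F.b]

/-- The expression `ξ` in `x, y`. -/
def xi (x y : A) : A :=
  F.c^2 • (x * y)^2
    - (F.c • y^2 + F.c2 • y + algebraMap K A F.b3) * (F.c • x^2 + F.c1 • x + algebraMap K A F.a3)
    + (F.c * F.m - F.c1 * F.c2) • (x * y) + algebraMap K A (F.a3 * F.b3)

/-- The expression `η` in `x, y`. -/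
def eta (x y : A) : A :=
  let r := y * (F.c • x^2 + F.c1 • x + algebraMap K A F.a3)
  let s := -(F.c • y^2 + F.c2 • y + algebraMap K A F.b3)
  let t := F.c • x
  r * s * t + s * t * r + t * r * s
    + F.a2 • (s * t + t * s) + F.b3 • (t * r + r * t) + F.c1 • (r * s + s * r)
    + (F.b3 * F.c1 - F.b1 * F.c) • r + (F.c1 * F.a2 - F.c2 * F.a) • s
    + (F.a2 * F.b3 - F.a3 * F.b) • t
    + algebraMap K A (-6 * F.a * F.b * F.c + F.a2 * F.b3 * F.c1)

end

/-- The defining relations of `A_F` in the free algebra `K{x, y}`. -/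
inductive Rel : FreeAlgebra K (Fin 2) → FreeAlgebra K (Fin 2) → Prop
  | mk (i : Fin 4) : Rel (F.relator (FreeAlgebra.ι K 0) (FreeAlgebra.ι K 1) i) 0

/-- The algebra `A_F`. -/
abbrev Alg := RingQuot F.Rel

/-- The generator `x` of `A_F`. -/
noncomputable def genX : F.Alg := RingQuot.mkAlgHom K F.Rel (FreeAlgebra.ι K 0)

/-- The generator `y` of `A_F`. -/
noncomputable def genY : F.Alg := RingQuot.mkAlgHom K F.Rel (FreeAlgebra.ι K 1)

/-- The extra relations `ξ = x_P`, `η = y_P`. -/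
inductive SpecRel (xP yP : K) : F.Alg → F.Alg → Prop
  | xi : SpecRel xP yP (F.xi F.genX F.genY) (algebraMap K F.Alg xP)
  | eta : SpecRel xP yP (F.eta F.genX F.genY) (algebraMap K F.Alg yP)

/-- The specialisation `A_{F,P}` of `A_F` at `P = (xP, yP)`. -/
abbrev SpecAlg (xP yP : K) := RingQuot (F.SpecRel xP yP)

/-- The `3 × 3 × 3` cube given by an isomorphism `θ : A_{F,P} ≅ Mat₃(K)`: its three slices are the
matrices `θ(x)`, `θ(y)` and `-1`. -/
noncomputable def cube {xP yP : K} (θ : F.SpecAlg xP yP ≃ₐ[K] Matrix (Fin 3) (Fin 3) K) :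
    Fin 3 → Matrix (Fin 3) (Fin 3) K :=
  ![θ (RingQuot.mkAlgHom K (F.SpecRel xP yP) F.genX),
    θ (RingQuot.mkAlgHom K (F.SpecRel xP yP) F.genY), -1]

end

end TernaryCubic

namespace PlaneCubic

section
variable {k : Type*} [Field k]

variable (k) in
/-- The points of the projective plane over `k` (below, `k` is algebraically closed). -/
abbrev Plane := ℙ k (Fin 3 → k)

/-! ### Plane curves and regular maps -/

/-- The plane curve `{G = 0}`. -/
def curve (G : MvPolynomial (Fin 3) k) : Set (Plane k) :=
  {Q | MvPolynomial.eval Q.rep G = 0}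

/-- The gradient of `G` at a vector. -/
noncomputable def grad (G : MvPolynomial (Fin 3) k) (q : Fin 3 → k) : Fin 3 → k :=
  fun i => MvPolynomial.eval q (MvPolynomial.pderiv i G)

/-- `G` is a ternary cubic form whose zero locus is smooth (over an algebraically closed `k`). -/
def IsNonsingularCubic (G : MvPolynomial (Fin 3) k) : Prop :=
  G.IsHomogeneous 3 ∧
    ∀ q : Fin 3 → k, MvPolynomial.eval q G = 0 → grad G q = 0 → q = 0

/-- The value of a triple of polynomials at a vector. -/
noncomputable def evalTriple {σ : Type*} (f : Fin 3 → MvPolynomial σ k) (q : σ → k) : Fin 3 → k :=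
  fun i => MvPolynomial.eval q (f i)

/-- The derivative at `q` of the polynomial map `f`, applied to the vector `v`. -/
noncomputable def derivTriple (f : Fin 3 → MvPolynomial (Fin 3) k) (q v : Fin 3 → k) : Fin 3 → k :=
  fun i => ∑ j, MvPolynomial.eval q (MvPolynomial.pderiv j (f i)) * v j

/-- The triple `f` of forms of one degree describes the map `ψ : S → ℙ²` wherever `f` does not
vanish. -/
def Represents {S : Set (Plane k)} (f : Fin 3 → MvPolynomial (Fin 3) k) (ψ : S → Plane k) : Prop :=
  (∃ d : ℕ, ∀ i, (f i).IsHomogeneous d) ∧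
    ∀ R : S, ∀ h : evalTriple f R.1.rep ≠ 0, ψ R = Projectivization.mk k (evalTriple f R.1.rep) h

/-- Regular maps from a subset of `ℙ²` to `ℙ²`: near each point given by forms of one degree. -/
def IsRegular {S : Set (Plane k)} (ψ : S → Plane k) : Prop :=
  ∀ Q : S, ∃ f, Represents f ψ ∧ evalTriple f Q.1.rep ≠ 0

/-- Regular maps from a subset of `ℙ² × ℙ²` to `ℙ²`: near each point given by bihomogeneous forms
of one bidegree. -/
def IsRegularBi {S : Set (Plane k × Plane k)} (ψ : S → Plane k) : Prop :=
  ∀ Q : S, ∃ f : Fin 3 → MvPolynomial (Fin 3 ⊕ Fin 3) k,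
    (∃ d e : ℕ, ∀ i,
      (f i).IsWeightedHomogeneous (Sum.elim (fun _ => 1) (fun _ => 0) : Fin 3 ⊕ Fin 3 → ℕ) d ∧
      (f i).IsWeightedHomogeneous (Sum.elim (fun _ => 0) (fun _ => 1) : Fin 3 ⊕ Fin 3 → ℕ) e) ∧
    (∀ R : S, ∀ h : evalTriple f (Sum.elim R.1.1.rep R.1.2.rep) ≠ 0,
      ψ R = Projectivization.mk k (evalTriple f (Sum.elim R.1.1.rep R.1.2.rep)) h) ∧
    evalTriple f (Sum.elim Q.1.1.rep Q.1.2.rep) ≠ 0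

/-- `φ` is an isomorphism of plane cubics `{F = 0} → {G = 0}` with `φ^* ω_G = ω_F`, where
`ω_F = (x dy - y dx) / (∂F/∂z)` is the invariant differential attached to the equation `F`.
On a vector `v` tangent to the cone `{F = 0}` at `q`, the value of `ω_F` is the scalar `t` with
`q × v = t ∇F(q)`. -/
structure IsNormalizedIso (F G : MvPolynomial (Fin 3) k) (φ : curve F ≃ curve G) : Prop where
  regular : ∀ Q : curve F, ∃ f, Represents f (fun R => (φ R : Plane k)) ∧
    evalTriple f Q.1.rep ≠ 0 ∧
    ∀ (v : Fin 3 → k) (t : k), Q.1.rep ⨯₃ v = t • grad F Q.1.rep →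
      evalTriple f Q.1.rep ⨯₃ derivTriple f Q.1.rep v = t • grad G (evalTriple f Q.1.rep)
  regular_symm : IsRegular (fun R => (φ.symm R : Plane k))

/-! ### Cubes and curves in `ℙ² × ℙ²` -/

/-- The value at `(u, v)` of the `i`-th bilinear form of the cube `N`: its coefficients are the
`i`-th rows of the slices `N 0, N 1, N 2`. -/
def form (N : Fin 3 → Matrix (Fin 3) (Fin 3) k) (i : Fin 3) (u v : Fin 3 → k) : k :=
  ∑ j, ∑ l, u j * N j i l * v l

/-- The locus in `ℙ² × ℙ²` defined by the three bilinear forms of a cube. -/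
def cubeCurve (N : Fin 3 → Matrix (Fin 3) (Fin 3) k) : Set (Plane k × Plane k) :=
  {Q | ∀ i, form N i Q.1.rep Q.2.rep = 0}

/-- The ternary cubic `det(x N₀ + y N₁ + z N₂)` of the first slicing of a cube. -/
noncomputable def slice₁ (N : Fin 3 → Matrix (Fin 3) (Fin 3) k) : MvPolynomial (Fin 3) k :=
  Matrix.det (Matrix.of fun i l => ∑ j, MvPolynomial.C (N j i l) * MvPolynomial.X j)

/-- The ternary cubic of the slicing of a cube that belongs to the second factor of `ℙ² × ℙ²`. -/
noncomputable def slice₂ (N : Fin 3 → Matrix (Fin 3) (Fin 3) k) : MvPolynomial (Fin 3) k :=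
  Matrix.det (Matrix.of fun i j => ∑ l, MvPolynomial.C (N j i l) * MvPolynomial.X l)

/-- The cube `N` defines a genus one curve in `ℙ² × ℙ²`: the three forms meet transversally at
every common zero (so the scheme they define is smooth of dimension one), and their zero locus is
isomorphic to an elliptic curve over (the algebraically closed field) `k`. -/
def DefinesGenusOneCurve (N : Fin 3 → Matrix (Fin 3) (Fin 3) k) : Prop :=
  (∀ Q ∈ cubeCurve N, ∀ w : Fin 3 → k, ∃ u v : Fin 3 → k,
    ∀ i, form N i u Q.2.rep + form N i Q.1.rep v = w i) ∧
  ∃ W : WeierstrassCurve k, W.IsElliptic ∧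
    ∃ e : cubeCurve N ≃ curve W.toProjective.polynomial,
      IsRegularBi (fun Q => (e Q : Plane k)) ∧
      IsRegular (fun R => (e.symm R).1.1) ∧ IsRegular (fun R => (e.symm R).1.2)

/-- The first projection is an isomorphism from `S` onto `C`. -/
def FstIsIso (S : Set (Plane k × Plane k)) (C : Set (Plane k)) : Prop :=
  Set.BijOn Prod.fst S C ∧ ∃ ψ : C → Plane k, IsRegular ψ ∧ ∀ p : C, (p.1, ψ p) ∈ S

/-- The second projection is an isomorphism from `S` onto `C`. -/
def SndIsIso (S : Set (Plane k × Plane k)) (C : Set (Plane k)) : Prop :=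
  Set.BijOn Prod.snd S C ∧ ∃ ψ : C → Plane k, IsRegular ψ ∧ ∀ p : C, (ψ p, p.1) ∈ S

/-! ### Hyperplane sections and the sum of a divisor -/

/-- The intersection multiplicity at `p` of the plane curve `{G = 0}` with the line
`{L · q = 0}`: if `p` lies on the line, it is the order of vanishing at `T = 0` of `G(p + T r)`
for any other point `r` of the line. -/
noncomputable def lineMult (G : MvPolynomial (Fin 3) k) (L : Fin 3 → k) (p : Plane k) : ℕ :=
  sInf {n | L ⬝ᵥ p.rep = 0 ∧ ∃ r : Fin 3 → k, L ⬝ᵥ r = 0 ∧ LinearIndependent k ![p.rep, r] ∧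
    n = (MvPolynomial.aeval (fun i => Polynomial.C (p.rep i) + Polynomial.X * Polynomial.C (r i))
      G : Polynomial k).rootMultiplicity 0}

open Classical in
/-- The pull-back, under a map `π` from `S` onto the plane cubic `{G = 0}`, of the hyperplane
section cut out by the line `{L · q = 0}`, as a divisor on `S`; the support is finite when the line
is not contained in the cubic. -/
noncomputable def hyperplaneSection {S : Type*} (π : S → Plane k) (G : MvPolynomial (Fin 3) k)
    (L : Fin 3 → k) : S →₀ ℤ :=
  if h : (Function.support fun Q => (lineMult G L (π Q) : ℤ)).Finite
  then Finsupp.ofSupportFinite (fun Q => (lineMult G L (π Q) : ℤ)) h else 0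

/-- The point of the group `W(k)` with given projective coordinates. -/
noncomputable def toPoint (W : WeierstrassCurve k) (Q : Plane k) : W.toAffine.Point :=
  WeierstrassCurve.Projective.Point.toAffine W Q.rep

/-- The sum `∑ n_Q • φ(Q)` in `W(k)` of a divisor `∑ n_Q Q`. On divisors of degree zero, and for an
isomorphism `φ` from a curve to the elliptic curve `W`, this is the map that induces the isomorphism
`Pic⁰ ≅ W(k)`; it is unchanged when `φ` is followed by a translation. -/
noncomputable def divisorSum [DecidableEq k] {S : Type*} {W : WeierstrassCurve k}
    (φ : S → W.toAffine.Point) (D : S →₀ ℤ) : W.toAffine.Point :=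
  D.sum fun Q n => n • φ Q

end

end PlaneCubic

/-! Let X, Y be the images of x, y in Mat₃(k), and write N_u for the matrix `pencil N u` of the cube
(X, Y, -1). The relations of `A_F` say that X + tY is a root of the monic cubic F(1, t, Z)/c over
k[t]. This cubic is irreducible: a root in k[t] would have degree at most one and give a line on a
smooth cubic. It is therefore the characteristic polynomial of X + tY, so F = -c det(xX + yY - z)
(`eq_scale_ofSlices`).

By Jacobi's formula the gradient of the determinant is read off from the adjugate of N_u. Smoothness
forces corank one on the curve; the adjugate is then v κᵀ with N_u v = 0 and κ N_u = 0, and the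
gradient is r ↦ κ N_r v. From this come the transversality of the three bilinear forms, the
regularity of the kernel maps and the smoothness of the second cubic.

For the isomorphism with the Jacobian, a flex puts F into Weierstrass form. The covariants c₄ and c₆
(`jacobian_comp`) show that this form and E differ by a change of Weierstrass coordinates. The
result is a linear map g with F ∘ g = det(g) E, and the factor det(g) is what preserves the
invariant differential.

Collinear points sum to zero on E, so H has sum zero. For H', let v lie on the second cubic, choose
w with w N_u v = 0 for all u, and then R and T with N_R v = 0 and w N_T = 0. A line through v cuts
the second cubic in two further points, which lie over points u₁, u₂ of the first cubic collinear
with T (`exists_isLineSection_swap`). So H' has sum φ(R) - φ(T), and H - H' has sum φ(T) - φ(R).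

It remains to see that this difference is P. The translation-invariant coordinates 12x + b₂ and 2y +
a₁x + a₃ of a difference of two points of a cubic are explicit covariants (`diffX`, `diffY`), which
need only be verified on Weierstrass curves (`IsDiff.ofVec_sub_ofVec`). If w is a left eigenvector
of X, the pair (X, Y) has a normal form in which one entry of the scalar matrices ξ and η gives the
same values for T and R. -/

namespace TernaryCubic

/-! ### Ternary cubics by their coefficients: values, gradients, linear substitutions -/

section Basic
variable {K : Type*} [Field K] (F G : TernaryCubic K)

/-- The value of a ternary cubic at a vector. -/
def ev (v : Fin 3 → K) : K :=
  F.a * v 0^3 + F.b * v 1^3 + F.c * v 2^3 + F.a2 * (v 0^2 * v 1) + F.a3 * (v 0^2 * v 2)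
    + F.b1 * (v 0 * v 1^2) + F.b3 * (v 1^2 * v 2) + F.c1 * (v 0 * v 2^2) + F.c2 * (v 1 * v 2^2)
    + F.m * (v 0 * v 1 * v 2)

/-- The gradient of a ternary cubic at a vector. -/
def gradient (v : Fin 3 → K) : Fin 3 → K :=
  ![3 * F.a * v 0^2 + 2 * F.a2 * v 0 * v 1 + 2 * F.a3 * v 0 * v 2 + F.b1 * v 1^2 + F.c1 * v 2^2
      + F.m * v 1 * v 2,
    3 * F.b * v 1^2 + F.a2 * v 0^2 + 2 * F.b1 * v 0 * v 1 + 2 * F.b3 * v 1 * v 2 + F.c2 * v 2^2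
      + F.m * v 0 * v 2,
    3 * F.c * v 2^2 + F.a3 * v 0^2 + F.b3 * v 1^2 + 2 * F.c1 * v 0 * v 2 + 2 * F.c2 * v 1 * v 2
      + F.m * v 0 * v 1]

/-- The Hessian matrix of a ternary cubic at a vector. -/
def hessian (v : Fin 3 → K) : Matrix (Fin 3) (Fin 3) K :=
  !![6 * F.a * v 0 + 2 * F.a2 * v 1 + 2 * F.a3 * v 2,
      2 * F.a2 * v 0 + 2 * F.b1 * v 1 + F.m * v 2, 2 * F.a3 * v 0 + 2 * F.c1 * v 2 + F.m * v 1;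
    2 * F.a2 * v 0 + 2 * F.b1 * v 1 + F.m * v 2,
      6 * F.b * v 1 + 2 * F.b1 * v 0 + 2 * F.b3 * v 2, 2 * F.b3 * v 1 + 2 * F.c2 * v 2 + F.m * v 0;
    2 * F.a3 * v 0 + 2 * F.c1 * v 2 + F.m * v 1, 2 * F.b3 * v 1 + 2 * F.c2 * v 2 + F.m * v 0,
      6 * F.c * v 2 + 2 * F.c1 * v 0 + 2 * F.c2 * v 1]

/-- The ternary cubic `F(x p + y q + z r)`. -/
def subst (p q r : Fin 3 → K) : TernaryCubic K where
  a := F.ev p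
  b := F.ev q
  c := F.ev r
  a2 := F.gradient p ⬝ᵥ q
  a3 := F.gradient p ⬝ᵥ r
  b1 := F.gradient q ⬝ᵥ p
  b3 := F.gradient q ⬝ᵥ r
  c1 := F.gradient r ⬝ᵥ p
  c2 := F.gradient r ⬝ᵥ q
  m := F.hessian p *ᵥ q ⬝ᵥ r

/-- The ternary cubic `κ F`. -/
def scale (κ : K) : TernaryCubic K where
  a := κ * F.a
  b := κ * F.b
  c := κ * F.c
  a2 := κ * F.a2
  a3 := κ * F.a3
  b1 := κ * F.b1
  b3 := κ * F.b3
  c1 := κ * F.c1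
  c2 := κ * F.c2
  m := κ * F.m

/-- The image of a ternary cubic under a homomorphism of fields. -/
def map {k : Type*} [Field k] (f : K →+* k) : TernaryCubic k where
  a := f F.a
  b := f F.b
  c := f F.c
  a2 := f F.a2
  a3 := f F.a3
  b1 := f F.b1
  b3 := f F.b3
  c1 := f F.c1
  c2 := f F.c2
  m := f F.m

/-- The ternary cubic is non-singular: only the zero vector is a common zero of the cubic and its
partial derivatives. -/
def Nonsingular : Prop := ∀ v : Fin 3 → K, F.ev v = 0 → F.gradient v = 0 → v = 0

variable {F G}

lemma ev_scale (κ : K) (v : Fin 3 → K) : (F.scale κ).ev v = κ * F.ev v := by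
  simp only [ev, scale]; ring

lemma gradient_scale (κ : K) (v : Fin 3 → K) : (F.scale κ).gradient v = κ • F.gradient v := by
  ext i; fin_cases i <;> simp [gradient, scale] <;> ring

lemma ev_subst (p q r : Fin 3 → K) (v : Fin 3 → K) :
    (F.subst p q r).ev v = F.ev (v 0 • p + v 1 • q + v 2 • r) := by
  simp [ev, subst, gradient, hessian, Matrix.mulVec, dotProduct, Fin.sum_univ_three]; ring

lemma ev_smul (t : K) (v : Fin 3 → K) : F.ev (t • v) = t^3 * F.ev v := by
  simp [ev]; ring

lemma ev_line (s t : K) (p q : Fin 3 → K) : F.ev (s • p + t • q) =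
    s^3 * F.ev p + s^2 * t * (F.gradient p ⬝ᵥ q) + s * t^2 * (F.gradient q ⬝ᵥ p)
      + t^3 * F.ev q := by
  simp [ev, gradient, dotProduct, Fin.sum_univ_three]; ring

lemma gradient_dotProduct_self (p : Fin 3 → K) : F.gradient p ⬝ᵥ p = 3 * F.ev p := by
  simp [ev, gradient, dotProduct, Fin.sum_univ_three]; ring

lemma gradient_line (s t : K) (p q r : Fin 3 → K) : F.gradient (s • p + t • q) ⬝ᵥ r =
    s^2 * (F.gradient p ⬝ᵥ r) + s * t * (F.hessian p *ᵥ q ⬝ᵥ r) + t^2 * (F.gradient q ⬝ᵥ r) := by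
  simp [gradient, hessian, Matrix.mulVec, dotProduct, Fin.sum_univ_three]; ring

lemma hessian_mulVec_dotProduct (p q : Fin 3 → K) :
    F.hessian p *ᵥ q ⬝ᵥ p = 2 * (F.gradient p ⬝ᵥ q) := by
  simp [gradient, hessian, Matrix.mulVec, dotProduct, Fin.sum_univ_three]; ring

lemma hessian_mulVec_dotProduct_self (p q : Fin 3 → K) :
    F.hessian p *ᵥ q ⬝ᵥ q = 2 * (F.gradient q ⬝ᵥ p) := by
  simp [gradient, hessian, Matrix.mulVec, dotProduct, Fin.sum_univ_three]; ring

lemma eval_poly (v : Fin 3 → K) : MvPolynomial.eval v F.poly = F.ev v := by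
  simp [poly, ev]

lemma grad_poly (v : Fin 3 → K) : PlaneCubic.grad F.poly v = F.gradient v := by
  ext i
  fin_cases i <;>
    simp [PlaneCubic.grad, poly, gradient, MvPolynomial.pderiv_X, MvPolynomial.smul_eq_C_mul] <;> ring

lemma isHomogeneous_poly : F.poly.IsHomogeneous 3 := by
  have hX : ∀ i : Fin 3, (MvPolynomial.X i : MvPolynomial (Fin 3) K).IsHomogeneous 1 :=
    fun i => MvPolynomial.isHomogeneous_X K i
  have h3 : ∀ i : Fin 3, (MvPolynomial.X i ^ 3 : MvPolynomial (Fin 3) K).IsHomogeneous 3 :=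
    fun i => (hX i).pow 3
  have h21 : ∀ i j : Fin 3,
      (MvPolynomial.X i ^ 2 * MvPolynomial.X j : MvPolynomial (Fin 3) K).IsHomogeneous 3 :=
    fun i j => ((hX i).pow 2).mul (hX j)
  have h12 : ∀ i j : Fin 3,
      (MvPolynomial.X i * MvPolynomial.X j ^ 2 : MvPolynomial (Fin 3) K).IsHomogeneous 3 :=
    fun i j => (hX i).mul ((hX j).pow 2)
  have h111 := ((hX 0).mul (hX 1)).mul (hX 2)
  have hs : ∀ (κ : K) {p : MvPolynomial (Fin 3) K}, p.IsHomogeneous 3 →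
      (κ • p).IsHomogeneous 3 := fun κ p hp => by
    rw [MvPolynomial.smul_eq_C_mul]; simpa using (MvPolynomial.isHomogeneous_C (Fin 3) κ).mul hp
  unfold poly
  exact (((((((((hs _ (h3 0)).add (hs _ (h3 1))).add (hs _ (h3 2))).add (hs _ (h21 0 1))).add
    (hs _ (h21 0 2))).add (hs _ (h12 0 1))).add (hs _ (h21 1 2))).add (hs _ (h12 0 2))).add
    (hs _ (h12 1 2))).add (hs _ h111)

lemma isNonsingularCubic_poly : PlaneCubic.IsNonsingularCubic F.poly ↔ F.Nonsingular := by
  simp only [PlaneCubic.IsNonsingularCubic, eval_poly, grad_poly, isHomogeneous_poly, true_and,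
    Nonsingular]

lemma poly_map {k : Type*} [Field k] (f : K →+* k) : F.poly.map f = (F.map f).poly := by
  simp [poly, map, MvPolynomial.smul_eq_C_mul]

lemma jacobian_map {k : Type*} [Field k] (f : K →+* k) :
    F.jacobian.map f = (F.map f).jacobian := by
  ext <;> simp [jacobian, map, map_ofNat f]

lemma poly_scale (κ : K) : (F.scale κ).poly = κ • F.poly := by
  simp [poly, scale, smul_smul]

/-- A ternary cubic over a field of characteristic zero is determined by its values. -/
lemma ext_of_ev [CharZero K] (h : ∀ v, F.ev v = G.ev v) : F = G := by
  have h1 := h ![1, 0, 0]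
  have h2 := h ![0, 1, 0]
  have h3 := h ![0, 0, 1]
  have h4 := h ![1, 1, 0]
  have h5 := h ![1, -1, 0]
  have h6 := h ![1, 0, 1]
  have h7 := h ![1, 0, -1]
  have h8 := h ![0, 1, 1]
  have h9 := h ![0, 1, -1]
  have h10 := h ![1, 1, 1]
  simp [ev] at h1 h2 h3 h4 h5 h6 h7 h8 h9 h10
  have two : (2 : K) ≠ 0 := two_ne_zero
  have e1 : F.a2 = G.a2 := mul_left_cancel₀ two (by linear_combination h4 - h5 - 2 * h2)
  have e2 : F.b1 = G.b1 := mul_left_cancel₀ two (by linear_combination h4 + h5 - 2 * h1)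
  have e3 : F.a3 = G.a3 := mul_left_cancel₀ two (by linear_combination h6 - h7 - 2 * h3)
  have e4 : F.c1 = G.c1 := mul_left_cancel₀ two (by linear_combination h6 + h7 - 2 * h1)
  have e5 : F.b3 = G.b3 := mul_left_cancel₀ two (by linear_combination h8 - h9 - 2 * h3)
  have e6 : F.c2 = G.c2 := mul_left_cancel₀ two (by linear_combination h8 + h9 - 2 * h2)
  have e7 : F.m = G.m := by
    linear_combination h10 - h1 - h2 - h3 - e1 - e2 - e3 - e4 - e5 - e6
  cases F; cases G; simp_all

end Basic
end TernaryCubic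

/-! ### Covariance of c₄ and c₆ under linear substitutions -/

namespace TernaryCubic

section Covariance
variable {K : Type*} [Field K] (F : TernaryCubic K)

/-- The ternary cubic `F ∘ g`. -/
def comp (g : Matrix (Fin 3) (Fin 3) K) : TernaryCubic K :=
  F.subst (fun i => g i 0) (fun i => g i 1) (fun i => g i 2)

variable {F}

lemma ev_comp (g : Matrix (Fin 3) (Fin 3) K) (v : Fin 3 → K) :
    (F.comp g).ev v = F.ev (g *ᵥ v) := by
  rw [comp, ev_subst]
  congr 1
  ext i
  simp [Matrix.mulVec, dotProduct, Fin.sum_univ_three, mul_comm]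

lemma gradient_comp (g : Matrix (Fin 3) (Fin 3) K) (v : Fin 3 → K) :
    (F.comp g).gradient v = gᵀ *ᵥ F.gradient (g *ᵥ v) := by
  ext i
  fin_cases i <;>
    simp [comp, subst, gradient, hessian, ev, Matrix.mulVec, dotProduct, Fin.sum_univ_three] <;>
    ring

lemma comp_comp [CharZero K] (g h : Matrix (Fin 3) (Fin 3) K) :
    (F.comp g).comp h = F.comp (g * h) :=
  ext_of_ev fun v => by simp only [ev_comp, Matrix.mulVec_mulVec]

lemma scale_comp [CharZero K] (κ : K) (g : Matrix (Fin 3) (Fin 3) K) :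
    (F.scale κ).comp g = (F.comp g).scale κ :=
  ext_of_ev fun v => by simp only [ev_comp, ev_scale]

lemma Nonsingular.comp [CharZero K] (hF : F.Nonsingular) {g : Matrix (Fin 3) (Fin 3) K}
    (hg : g.det ≠ 0) : (F.comp g).Nonsingular := by
  intro v h0 h1
  rw [ev_comp] at h0
  rw [gradient_comp] at h1
  have h2 := Matrix.eq_zero_of_mulVec_eq_zero (by rwa [Matrix.det_transpose]) h1
  exact Matrix.eq_zero_of_mulVec_eq_zero hg (hF _ h0 h2)

/-- The ternary cubic `F(z, x, y)`. -/
def rotate (F : TernaryCubic K) : TernaryCubic K where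
  a := F.b
  b := F.c
  c := F.a
  a2 := F.b3
  a3 := F.b1
  b1 := F.c2
  b3 := F.c1
  c1 := F.a2
  c2 := F.a3
  m := F.m

lemma ev_rotate (v : Fin 3 → K) : F.rotate.ev v = F.ev (fun i => v (i + 2)) := by
  simp [ev, rotate]
  ring

/-- The formulas are symmetric under cyclic permutation of the variables, in each coefficient and
not only in c₄ and c₆. This reduces all transvections to those that change the first coordinate. -/
lemma jacobian_rotate (F : TernaryCubic K) : F.rotate.jacobian = F.jacobian := by
  ext <;> simp only [jacobian, rotate] <;> ring

lemma transvection_mulVec (i j l : Fin 3) (t : K) (v : Fin 3 → K) :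
    (Matrix.transvection i j t *ᵥ v) l = v l + if i = l then t * v j else 0 := by
  rw [Matrix.transvection, Matrix.add_mulVec, Matrix.one_mulVec, Pi.add_apply]
  congr 1
  simp [Matrix.mulVec, dotProduct, Matrix.single_apply, ite_and]

lemma rotate_comp_transvection [CharZero K] (i j : Fin 3) (t : K) :
    (F.comp (Matrix.transvection i j t)).rotate =
      F.rotate.comp (Matrix.transvection (i + 2) (j + 2) t) :=
  ext_of_ev fun v => by
    rw [ev_rotate, ev_comp, ev_comp, ev_rotate]
    congr 1
    ext l
    simp only [transvection_mulVec, add_left_inj]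

lemma c₄_comp_transvection_zero (j : Fin 3) (hj : 0 ≠ j) (t : K) :
    (F.comp (Matrix.transvection 0 j t)).jacobian.c₄ = F.jacobian.c₄ := by
  fin_cases j
  · exact absurd rfl hj
  all_goals
    simp [WeierstrassCurve.c₄, WeierstrassCurve.b₂, WeierstrassCurve.b₄, jacobian, comp, subst,
      ev, gradient, hessian, Matrix.mulVec, dotProduct, Fin.sum_univ_three, Matrix.transvection,
      Matrix.single, Matrix.one_apply]
    ring

set_option maxHeartbeats 1000000 in
lemma c₆_comp_transvection_zero (j : Fin 3) (hj : 0 ≠ j) (t : K) :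
    (F.comp (Matrix.transvection 0 j t)).jacobian.c₆ = F.jacobian.c₆ := by
  fin_cases j
  · exact absurd rfl hj
  all_goals
    simp [WeierstrassCurve.c₆, WeierstrassCurve.b₂, WeierstrassCurve.b₄, WeierstrassCurve.b₆,
      jacobian, comp, subst,
      ev, gradient, hessian, Matrix.mulVec, dotProduct, Fin.sum_univ_three, Matrix.transvection,
      Matrix.single, Matrix.one_apply]
    ring

lemma jacobian_comp_transvection [CharZero K] (F : TernaryCubic K) (i j : Fin 3) (hij : i ≠ j)
    (t : K) : (F.comp (Matrix.transvection i j t)).jacobian.c₄ = F.jacobian.c₄ ∧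
      (F.comp (Matrix.transvection i j t)).jacobian.c₆ = F.jacobian.c₆ := by
  -- The rotation shifts both indices by 2 modulo 3: one rotation brings target index 1 to 0, two
  -- bring 2 to 0.
  have hrot (F : TernaryCubic K) (i j : Fin 3) :
      (F.comp (Matrix.transvection i j t)).jacobian =
        (F.rotate.comp (Matrix.transvection (i + 2) (j + 2) t)).jacobian := by
    rw [← rotate_comp_transvection, jacobian_rotate]
  have h0 (F : TernaryCubic K) (j : Fin 3) (hj : 0 ≠ j) :=
    And.intro (F.c₄_comp_transvection_zero j hj t) (F.c₆_comp_transvection_zero j hj t)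
  fin_cases i
  · exact h0 F j hij
  · rw [hrot, ← F.jacobian_rotate]
    exact h0 F.rotate (j + 2) (by revert j; decide)
  · rw [hrot, hrot, ← F.jacobian_rotate, ← F.rotate.jacobian_rotate]
    exact h0 F.rotate.rotate (j + 2 + 2) (by revert j; decide)

lemma c₄_comp_diagonal (d : Fin 3 → K) :
    (F.comp (Matrix.diagonal d)).jacobian.c₄ = (d 0 * d 1 * d 2) ^ 4 * F.jacobian.c₄ := by
  simp [WeierstrassCurve.c₄, WeierstrassCurve.b₂, WeierstrassCurve.b₄, jacobian, comp, subst,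
      ev, gradient, hessian, Matrix.mulVec, dotProduct, Matrix.diagonal_apply]
  ring

lemma c₆_comp_diagonal (d : Fin 3 → K) :
    (F.comp (Matrix.diagonal d)).jacobian.c₆ = (d 0 * d 1 * d 2) ^ 6 * F.jacobian.c₆ := by
  simp [WeierstrassCurve.c₆, WeierstrassCurve.b₂, WeierstrassCurve.b₄, WeierstrassCurve.b₆,
      jacobian, comp, subst,
      ev, gradient, hessian, Matrix.mulVec, dotProduct, Matrix.diagonal_apply]
  ring

/-- The coefficients `c₄` and `c₆` of the Jacobian are covariants of the ternary cubic. -/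
lemma jacobian_comp [CharZero K] (F : TernaryCubic K) {g : Matrix (Fin 3) (Fin 3) K}
    (hg : g.det ≠ 0) : (F.comp g).jacobian.c₄ = g.det ^ 4 * F.jacobian.c₄ ∧
      (F.comp g).jacobian.c₆ = g.det ^ 6 * F.jacobian.c₆ := by
  -- For a product A * B the claim for B is applied to F ∘ A, so F must vary in the induction.
  revert F
  refine Matrix.diagonal_transvection_induction_of_det_ne_zero (fun g => ∀ F : TernaryCubic K,
    (F.comp g).jacobian.c₄ = g.det ^ 4 * F.jacobian.c₄ ∧
      (F.comp g).jacobian.c₆ = g.det ^ 6 * F.jacobian.c₆) g hg ?_ ?_ ?_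
  · intro d _ F
    simp [c₄_comp_diagonal, c₆_comp_diagonal, Fin.prod_univ_three]
  · intro t F
    simp only [Matrix.TransvectionStruct.det, one_pow, one_mul]
    exact jacobian_comp_transvection F _ _ t.hij _
  · intro A B _ _ hA hB F
    rw [← comp_comp, (hB _).1, (hB _).2, (hA F).1, (hA F).2, Matrix.det_mul]
    constructor <;> ring

end Covariance
end TernaryCubic

/-! ### Common zeros of two forms, and lines on cubics -/

/-- Two ternary forms without constant term have a common non-trivial zero over an algebraically
closed field. -/
lemma MvPolynomial.exists_common_zero {k : Type*} [Field k] [IsAlgClosed k]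
    (f g : MvPolynomial (Fin 3) k) (hf : eval 0 f = 0) (hg : eval 0 g = 0) :
    ∃ v : Fin 3 → k, v ≠ 0 ∧ eval v f = 0 ∧ eval v g = 0 := by
  by_contra! hcon
  have hm : (RingHom.ker (eval (0 : Fin 3 → k))).IsPrime := RingHom.ker_isPrime _
  have hIm : Ideal.span {f, g} ≤ RingHom.ker (eval (0 : Fin 3 → k)) := by
    rw [Ideal.span_le]
    rintro x (rfl | rfl)
    exacts [hf, hg]
  -- By the Nullstellensatz the radical of (f, g) is the maximal ideal of the origin, which is thus
  -- minimal over an ideal with two generators; Krull's theorem bounds its height by 2.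
  have hrad : (Ideal.span {f, g}).radical = RingHom.ker (eval (0 : Fin 3 → k)) := by
    rw [← vanishingIdeal_zeroLocus_eq_radical (k := k) (K := k)]
    have hz : zeroLocus k (Ideal.span {f, g}) = {0} := by
      rw [zeroLocus_span]
      ext v
      simp only [Set.mem_ofPred_eq, Set.mem_singleton_iff, Set.mem_insert_iff,
        forall_eq_or_imp, forall_eq, aeval_eq_eval]
      constructor
      · rintro ⟨h1, h2⟩
        by_contra hv
        exact hcon v hv h1 h2
      · rintro rfl
        exact ⟨hf, hg⟩
    rw [hz]
    ext p
    rw [mem_vanishingIdeal_singleton_iff, RingHom.mem_ker, aeval_eq_eval]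
  have hmin : RingHom.ker (eval (0 : Fin 3 → k)) ∈ (Ideal.span {f, g}).minimalPrimes := by
    refine ⟨⟨hm, hIm⟩, fun J hJ _ => ?_⟩
    rw [← hrad]
    exact hJ.1.radical_le_iff.mpr hJ.2
  have h2 : (RingHom.ker (eval (0 : Fin 3 → k))).height ≤ 2 :=
    (Ideal.height_le_card_of_mem_minimalPrimes_span (Set.toFinite _) hmin).trans
      (by exact_mod_cast Set.ncard_insert_le f {g} |>.trans (by simp))
  -- The kernels of X₀ ↦ 0 and of X₀, X₁ ↦ 0 are primes strictly between 0 and the maximal ideal of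
  -- the origin, whose height is therefore at least 3.
  obtain ⟨φ₁, hφ₁⟩ : ∃ φ : MvPolynomial (Fin 3) k →ₐ[k] MvPolynomial (Fin 3) k,
      φ (X 0) = 0 ∧ φ (X 1) = X 1 ∧ φ (X 2) = X 2 :=
    ⟨aeval ![0, X 1, X 2], by simp⟩
  obtain ⟨φ₂, hφ₂⟩ : ∃ φ : MvPolynomial (Fin 3) k →ₐ[k] MvPolynomial (Fin 3) k,
      φ (X 0) = 0 ∧ φ (X 1) = 0 ∧ φ (X 2) = X 2 :=
    ⟨aeval ![0, 0, X 2], by simp⟩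
  have p1 : (RingHom.ker φ₁).IsPrime := RingHom.ker_isPrime _
  have p2 : (RingHom.ker φ₂).IsPrime := RingHom.ker_isPrime _
  have c21 : φ₂.comp φ₁ = φ₂ := by
    refine MvPolynomial.algHom_ext fun i => ?_
    fin_cases i <;> simp [hφ₁, hφ₂]
  have cm2 : (aeval (0 : Fin 3 → k)).comp φ₂ = aeval (0 : Fin 3 → k) := by
    refine MvPolynomial.algHom_ext fun i => ?_
    fin_cases i <;> simp [hφ₂]
  have l1 : (⊥ : Ideal (MvPolynomial (Fin 3) k)) < RingHom.ker φ₁ := by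
    refine lt_of_le_of_ne bot_le fun h => X_ne_zero (R := k) (0 : Fin 3) ?_
    rw [← Ideal.mem_bot, h]
    exact hφ₁.1
  have l2 : RingHom.ker φ₁ < RingHom.ker φ₂ := by
    refine lt_of_le_of_ne (fun x hx => ?_) fun h => X_ne_zero (R := k) (1 : Fin 3) ?_
    · rw [RingHom.mem_ker] at hx ⊢
      rw [← c21, AlgHom.comp_apply, hx, map_zero]
    · have : (X 1 : MvPolynomial (Fin 3) k) ∈ RingHom.ker φ₁ := by rw [h]; exact hφ₂.2.1
      rwa [RingHom.mem_ker, hφ₁.2.1] at this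
  have l3 : RingHom.ker φ₂ < RingHom.ker (eval (0 : Fin 3 → k)) := by
    refine lt_of_le_of_ne (fun x hx => ?_) fun h => X_ne_zero (R := k) (2 : Fin 3) ?_
    · rw [RingHom.mem_ker] at hx ⊢
      rw [← aeval_eq_eval]
      change aeval (0 : Fin 3 → k) x = 0
      rw [← cm2, AlgHom.comp_apply, hx, map_zero]
    · have : (X 2 : MvPolynomial (Fin 3) k) ∈ RingHom.ker φ₂ := by
        rw [h, RingHom.mem_ker, eval_X]; rfl
      rwa [RingHom.mem_ker, hφ₂.2.2] at this
  have e1 := Ideal.height_add_one_le_of_lt_of_isPrime l1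
  have e2 := Ideal.height_add_one_le_of_lt_of_isPrime l2
  have e3 := Ideal.height_add_one_le_of_lt_of_isPrime l3
  have : (3 : ℕ∞) ≤ 2 := calc
    (3 : ℕ∞) = 0 + 1 + 1 + 1 := by norm_num
    _ ≤ (⊥ : Ideal (MvPolynomial (Fin 3) k)).height + 1 + 1 + 1 := by gcongr; exact zero_le
    _ ≤ _ := by
        refine le_trans ?_ e3
        gcongr
        refine le_trans ?_ e2
        gcongr
    _ ≤ 2 := h2
  exact absurd this (by decide)

section
variable {k : Type*} [Field k]

/-- A binary quadratic form over an algebraically closed field has a non-trivial zero. -/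
lemma exists_binary_quadratic_zero [IsAlgClosed k] (α β γ : k) :
    ∃ s t : k, (s ≠ 0 ∨ t ≠ 0) ∧ s ^ 2 * α + s * t * β + t ^ 2 * γ = 0 := by
  by_cases hα : α = 0
  · exact ⟨1, 0, by simp, by simp [hα]⟩
  · obtain ⟨s, hs⟩ := IsAlgClosed.exists_root
      (Polynomial.C α * Polynomial.X ^ 2 + Polynomial.C β * Polynomial.X + Polynomial.C γ)
      (by rw [Polynomial.degree_quadratic hα]; decide)
    refine ⟨s, 1, by simp, ?_⟩
    simp [Polynomial.IsRoot] at hs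
    linear_combination hs

lemma exists_dotProduct_eq {w : Fin 3 → k} (hw : w ≠ 0) (t : k) :
    ∃ q : Fin 3 → k, w ⬝ᵥ q = t := by
  obtain ⟨i, hi⟩ := Function.ne_iff.mp hw
  refine ⟨Pi.single i (t / w i), ?_⟩
  rw [dotProduct_single]
  field_simp [show w i ≠ 0 from hi]

lemma eq_zero_of_dotProduct_eq_zero {p q r v : Fin 3 → k} (h : p ⬝ᵥ q ⨯₃ r ≠ 0)
    (hp : v ⬝ᵥ p = 0) (hq : v ⬝ᵥ q = 0) (hr : v ⬝ᵥ r = 0) : v = 0 := by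
  rw [triple_product_eq_det] at h
  refine Matrix.eq_zero_of_mulVec_eq_zero h ?_
  ext i
  fin_cases i
  · exact (dotProduct_comm _ _).trans hp
  · exact (dotProduct_comm _ _).trans hq
  · exact (dotProduct_comm _ _).trans hr

end

namespace TernaryCubic
variable {k : Type*} [Field k] {F : TernaryCubic k}

/-- A non-singular cubic does not contain a line. -/
lemma Nonsingular.exists_ev_line_ne_zero [IsAlgClosed k] [CharZero k] (hF : F.Nonsingular)
    {p q : Fin 3 → k} (hpq : LinearIndependent k ![p, q]) :
    ∃ s t : k, F.ev (s • p + t • q) ≠ 0 := by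
  by_contra! h
  have hp : F.ev p = 0 := by simpa using h 1 0
  have hq : F.ev q = 0 := by simpa using h 0 1
  have h1 := h 1 1
  have h2 := h 1 (-1)
  rw [ev_line] at h1 h2
  have two : (2 : k) ≠ 0 := two_ne_zero
  have e1 : F.gradient p ⬝ᵥ q = 0 := mul_left_cancel₀ two (by
    linear_combination h1 - h2 - 2 * hq)
  have e2 : F.gradient q ⬝ᵥ p = 0 := mul_left_cancel₀ two (by
    linear_combination h1 + h2 - 2 * hp)
  have hc : p ⨯₃ q ≠ 0 := crossProduct_ne_zero_iff_linearIndependent.mpr hpq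
  obtain ⟨r, hr⟩ := exists_dotProduct_eq hc 1
  -- If F vanishes on the line, so do its derivatives along the line. Only the component of the
  -- gradient in a transversal direction r is left, a binary quadratic form in (s, t); at a zero of
  -- this form the curve is singular.
  obtain ⟨s, t, hst, h0⟩ := exists_binary_quadratic_zero (F.gradient p ⬝ᵥ r)
    (F.hessian p *ᵥ q ⬝ᵥ r) (F.gradient q ⬝ᵥ r)
  rw [← gradient_line] at h0
  have hv : F.gradient (s • p + t • q) = 0 := by
    have a1 : F.gradient (s • p + t • q) ⬝ᵥ p = 0 := by
      rw [gradient_line, gradient_dotProduct_self, hessian_mulVec_dotProduct, hp, e1, e2]; ring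
    have a2 : F.gradient (s • p + t • q) ⬝ᵥ q = 0 := by
      rw [gradient_line, gradient_dotProduct_self, hessian_mulVec_dotProduct_self, hq, e1, e2]
      ring
    refine eq_zero_of_dotProduct_eq_zero (p := r) (q := p) (r := q) ?_ h0 a1 a2
    rw [dotProduct_comm, hr]
    exact one_ne_zero
  have := LinearIndependent.pair_iff.mp hpq s t (hF _ (h s t) hv)
  rcases hst with h | h
  exacts [h this.1, h this.2]

end TernaryCubic

/-! ### Flexes, Weierstrass equations and the linear isomorphism with the Jacobian -/

namespace TernaryCubic
variable {k : Type*} [Field k] {F : TernaryCubic k}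

/-- The ternary cubic of a Weierstrass equation. -/
def ofWeierstrass (W : WeierstrassCurve k) : TernaryCubic k where
  a := -1
  b := 0
  c := -W.a₆
  a2 := 0
  a3 := -W.a₂
  b1 := 0
  b3 := 1
  c1 := -W.a₄
  c2 := W.a₃
  m := W.a₁

lemma poly_ofWeierstrass (W : WeierstrassCurve k) :
    (ofWeierstrass W).poly = W.toProjective.polynomial := by
  simp [poly, ofWeierstrass, WeierstrassCurve.Projective.polynomial, MvPolynomial.smul_eq_C_mul]
  ring

/-- This fixes the normalisation: c₄ and c₆ of W are the covariants evaluated on the cubic of W, so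
they can be compared with those of F once F is brought to Weierstrass form. -/
lemma jacobian_ofWeierstrass (W : WeierstrassCurve k) : (ofWeierstrass W).jacobian = W := by
  ext <;> simp [ofWeierstrass, jacobian]

lemma c₄_jacobian_scale (κ : k) : (F.scale κ).jacobian.c₄ = κ ^ 4 * F.jacobian.c₄ := by
  simp only [WeierstrassCurve.c₄, WeierstrassCurve.b₂, WeierstrassCurve.b₄, jacobian, scale]
  ring

lemma c₆_jacobian_scale (κ : k) : (F.scale κ).jacobian.c₆ = κ ^ 6 * F.jacobian.c₆ := by
  simp only [WeierstrassCurve.c₆, WeierstrassCurve.b₂, WeierstrassCurve.b₄, WeierstrassCurve.b₆,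
    jacobian, scale]
  ring

lemma hessian_mulVec_self (p : Fin 3 → k) : F.hessian p *ᵥ p = (2 : k) • F.gradient p := by
  ext i
  fin_cases i <;> simp [gradient, hessian, Matrix.mulVec, dotProduct, Fin.sum_univ_three] <;> ring

variable (F) in
/-- The Hessian determinant vanishes at some point of the curve. -/
lemma exists_ev_eq_zero_and_det_hessian_eq_zero [IsAlgClosed k] :
    ∃ p : Fin 3 → k, p ≠ 0 ∧ F.ev p = 0 ∧ (F.hessian p).det = 0 := by
  let M : Matrix (Fin 3) (Fin 3) (MvPolynomial (Fin 3) k) := Matrix.of fun i j =>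
    ∑ l, MvPolynomial.C (F.hessian (Pi.single l 1) i j) * MvPolynomial.X l
  have hM : ∀ v, MvPolynomial.eval v M.det = (F.hessian v).det := by
    intro v
    rw [RingHom.map_det]
    congr 1
    ext i j
    simp only [M, RingHom.mapMatrix_apply, Matrix.map_apply, Matrix.of_apply, Fin.sum_univ_three]
    fin_cases i <;> fin_cases j <;> simp [hessian] <;> ring
  obtain ⟨v, hv, h1, h2⟩ := MvPolynomial.exists_common_zero F.poly M.det
    (by rw [eval_poly]; simp [ev]) (by rw [hM]; simp [hessian, Matrix.det_fin_three])
  exact ⟨v, hv, by rwa [eval_poly] at h1, by rwa [hM] at h2⟩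

/-- A non-singular ternary cubic is equivalent to a Weierstrass equation, as it has a flex. -/
lemma Nonsingular.exists_comp_eq_ofWeierstrass [IsAlgClosed k] [CharZero k] (hF : F.Nonsingular) :
    ∃ (g : Matrix (Fin 3) (Fin 3) k) (κ : k) (W : WeierstrassCurve k), g.det ≠ 0 ∧ κ ≠ 0 ∧
      F.comp g = (ofWeierstrass W).scale κ := by
  -- p is a flex, and a kernel vector r of the Hessian matrix at p gives the direction of the flex
  -- tangent.
  obtain ⟨p, hp0, hp, hdet⟩ := F.exists_ev_eq_zero_and_det_hessian_eq_zero
  obtain ⟨r, hr0, hr⟩ := Matrix.exists_mulVec_eq_zero_iff.mpr hdet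
  have two : (2 : k) ≠ 0 := two_ne_zero
  have hgr : F.gradient p ≠ 0 := fun h => hp0 (hF p hp h)
  have e1 : F.gradient p ⬝ᵥ r = 0 := mul_left_cancel₀ two (by
    rw [← hessian_mulVec_dotProduct, hr]; simp)
  have e2 : F.gradient r ⬝ᵥ p = 0 := mul_left_cancel₀ two (by
    rw [← hessian_mulVec_dotProduct_self, hr]; simp)
  have e3 : F.gradient p ⬝ᵥ p = 0 := by rw [gradient_dotProduct_self, hp, mul_zero]
  have hind : LinearIndependent k ![r, p] := by
    rw [LinearIndependent.pair_iff]
    intro s t hst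
    have hh : (t * 2) • F.gradient p = 0 := by
      rw [mul_smul, ← hessian_mulVec_self, ← Matrix.mulVec_smul]
      have : t • p = -(s • r) := by rw [← sub_eq_zero, sub_neg_eq_add, add_comm, hst]
      rw [this, Matrix.mulVec_neg, Matrix.mulVec_smul, hr]
      simp
    have ht : t = 0 := by
      rcases smul_eq_zero.mp hh with h | h
      · exact (mul_eq_zero.mp h).resolve_right two
      · exact absurd h hgr
    subst ht
    refine ⟨?_, rfl⟩
    rw [zero_smul, add_zero] at hst
    exact (smul_eq_zero.mp hst).resolve_right hr0
  -- On the line through r and p the cubic is F(r) s³, so F(r) = 0 would put the whole line on the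
  -- curve.
  have ha : F.ev r ≠ 0 := by
    intro ha
    obtain ⟨s, t, hst⟩ := hF.exists_ev_line_ne_zero hind
    rw [ev_line, ha, hp, e1, e2] at hst
    simp at hst
  -- q is scaled so that the coefficient of y²z is the opposite of the coefficient F(r) of x³, which
  -- is the Weierstrass shape with factor κ = -F(r).
  obtain ⟨q, hq⟩ := exists_dotProduct_eq hgr (-F.ev r)
  set G := F.subst r p q with hG
  have hGev : ∀ g : Matrix (Fin 3) (Fin 3) k, (∀ i, g i 0 = r i) → (∀ i, g i 1 = p i) →
      (∀ i, g i 2 = q i) → F.comp g = G := by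
    intro g h0 h1 h2
    simp only [TernaryCubic.comp, h0, h1, h2, hG]
  let g : Matrix (Fin 3) (Fin 3) k := Matrix.of fun i j => ![r i, p i, q i] j
  refine ⟨g, -F.ev r, ⟨G.m / (-F.ev r), -(G.a3 / (-F.ev r)), G.c2 / (-F.ev r),
    -(G.c1 / (-F.ev r)), -(G.c / (-F.ev r))⟩, ?_, neg_ne_zero.mpr ha, ?_⟩
  · intro hd
    obtain ⟨v, hv0, hv⟩ := Matrix.exists_mulVec_eq_zero_iff.mpr hd
    have hv' : v 0 • r + v 1 • p + v 2 • q = 0 := by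
      rw [← hv]
      ext i
      simp [g, Matrix.mulVec, dotProduct, Fin.sum_univ_three, mul_comm]
    have h2 : v 2 = 0 := by
      have := congrArg (F.gradient p ⬝ᵥ ·) hv'
      simp only [dotProduct_add, dotProduct_smul, e1, e3, hq, dotProduct_zero, smul_eq_mul,
        mul_zero, zero_add, mul_neg, neg_eq_zero] at this
      exact (mul_eq_zero.mp this).resolve_right ha
    rw [h2, zero_smul, add_zero] at hv'
    obtain ⟨h0, h1⟩ := LinearIndependent.pair_iff.mp hind _ _ hv'
    exact hv0 (by ext i; fin_cases i <;> simp [h0, h1, h2])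
  · rw [hGev g (fun _ => rfl) (fun _ => rfl) (fun _ => rfl)]
    have ha' : -F.ev r ≠ 0 := neg_ne_zero.mpr ha
    have h1 : G.a = F.ev r := rfl
    have h2 : G.b = 0 := hp
    have h3 : G.a2 = 0 := e2
    have h4 : G.b1 = 0 := e1
    have h5 : G.b3 = -F.ev r := hq
    clear_value G
    cases G
    simp only at h1 h2 h3 h4 h5
    subst h1 h2 h3 h4
    simp only [scale, ofWeierstrass, mk.injEq]
    refine ⟨?_, ?_, ?_, ?_, ?_, ?_, ?_, ?_, ?_, ?_⟩ <;> first | (field_simp; done) | simp [h5]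

/-- Weierstrass equations with proportional `c₄` and `c₆` are equivalent. -/
lemma exists_ofWeierstrass_comp_eq [CharZero k] (W J : WeierstrassCurve k) {u : k}
    (h4 : W.c₄ = u ^ 4 * J.c₄) (h6 : W.c₆ = u ^ 6 * J.c₆) :
    ∃ g : Matrix (Fin 3) (Fin 3) k, g.det = u ^ 5 ∧
      (ofWeierstrass W).comp g = (ofWeierstrass J).scale (u ^ 6) := by
  have two : (2 : k) ≠ 0 := two_ne_zero
  -- The substitution is x = u²x' + r, y = u³y' + su²x' + t. The coefficients a₁, b₂, a₃ determine
  -- s, r, t; then c₄ and c₆ force b₄ and b₆, and these give a₂, a₄, a₆.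
  obtain ⟨s, hs⟩ : ∃ s, u * J.a₁ = W.a₁ + 2 * s := ⟨(u * J.a₁ - W.a₁) / 2, by field_simp; ring⟩
  obtain ⟨r, hr⟩ : ∃ r, u ^ 2 * J.b₂ = W.b₂ + 12 * r :=
    ⟨(u ^ 2 * J.b₂ - W.b₂) / 12, by field_simp; ring⟩
  obtain ⟨t, ht⟩ : ∃ t, u ^ 3 * J.a₃ = W.a₃ + r * W.a₁ + 2 * t :=
    ⟨(u ^ 3 * J.a₃ - W.a₃ - r * W.a₁) / 2, by field_simp; ring⟩
  have hb4 : u ^ 4 * J.b₄ = W.b₄ + r * W.b₂ + 6 * r ^ 2 :=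
    mul_left_cancel₀ (show (24 : k) ≠ 0 by norm_num) (by
      simp only [WeierstrassCurve.c₄] at h4
      linear_combination (u ^ 2 * J.b₂ + W.b₂ + 12 * r) * hr + h4)
  have hb6 : u ^ 6 * J.b₆ = W.b₆ + 2 * r * W.b₄ + r ^ 2 * W.b₂ + 4 * r ^ 3 :=
    mul_left_cancel₀ (show (216 : k) ≠ 0 by norm_num) (by
      simp only [WeierstrassCurve.c₆] at h6
      linear_combination h6 + 36 * u ^ 2 * J.b₂ * hb4
        + (36 * (W.b₄ + r * W.b₂ + 6 * r ^ 2) - ((u ^ 2 * J.b₂) ^ 2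
          + (u ^ 2 * J.b₂) * (W.b₂ + 12 * r) + (W.b₂ + 12 * r) ^ 2)) * hr)
  simp only [WeierstrassCurve.b₂, WeierstrassCurve.b₄, WeierstrassCurve.b₆] at hr hb4 hb6
  have k2 : u ^ 2 * J.a₂ = W.a₂ - s * W.a₁ + 3 * r - s ^ 2 :=
    mul_left_cancel₀ (show (4 : k) ≠ 0 by norm_num) (by
      linear_combination hr - (u * J.a₁ + W.a₁ + 2 * s) * hs)
  have k4 : u ^ 4 * J.a₄ = W.a₄ - s * W.a₃ + 2 * r * W.a₂ - (t + r * s) * W.a₁ + 3 * r ^ 2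
      - 2 * s * t :=
    mul_left_cancel₀ two (by
      linear_combination hb4 - u ^ 3 * J.a₃ * hs - (W.a₁ + 2 * s) * ht)
  have k6 : u ^ 6 * J.a₆ = W.a₆ + r * W.a₄ + r ^ 2 * W.a₂ + r ^ 3 - t * W.a₃ - t ^ 2
      - r * t * W.a₁ :=
    mul_left_cancel₀ (show (4 : k) ≠ 0 by norm_num) (by
      linear_combination hb6 - (u ^ 3 * J.a₃ + W.a₃ + r * W.a₁ + 2 * t) * ht)
  refine ⟨!![u ^ 2, 0, r; s * u ^ 2, u ^ 3, t; 0, 0, 1], ?_, ext_of_ev fun v => ?_⟩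
  · simp [Matrix.det_fin_three]; ring
  · rw [ev_comp, ev_scale]
    simp [ev, ofWeierstrass, Matrix.mulVec, dotProduct, Fin.sum_univ_three]
    linear_combination (-(u ^ 5 * v 0 * v 1 * v 2)) * hs - (u ^ 3 * v 1 * v 2 ^ 2) * ht
      + (u ^ 4 * v 0 ^ 2 * v 2) * k2 + (u ^ 2 * v 0 * v 2 ^ 2) * k4 + v 2 ^ 3 * k6

/-- A non-singular ternary cubic is equivalent to the equation of its Jacobian, by a linear change
of coordinates that is compatible with the invariant differentials. -/
lemma Nonsingular.exists_comp_eq_jacobian [IsAlgClosed k] [CharZero k] (hF : F.Nonsingular) :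
    ∃ g : Matrix (Fin 3) (Fin 3) k, g.det ≠ 0 ∧
      F.comp g = (ofWeierstrass F.jacobian).scale g.det := by
  obtain ⟨g, κ, W, hg, hκ, h⟩ := hF.exists_comp_eq_ofWeierstrass
  obtain ⟨h4, h6⟩ := F.jacobian_comp hg
  rw [h, c₄_jacobian_scale, jacobian_ofWeierstrass] at h4
  rw [h, c₆_jacobian_scale, jacobian_ofWeierstrass] at h6
  have hu : g.det / κ ≠ 0 := div_ne_zero hg hκ
  obtain ⟨g', hg', h'⟩ := exists_ofWeierstrass_comp_eq W F.jacobian (u := g.det / κ)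
    (by field_simp; linear_combination h4) (by field_simp; linear_combination h6)
  -- With u = det(g)/κ, the determinant det(g) u⁵ equals κ u⁶, the factor by which the equation gets
  -- multiplied. This equality is the compatibility with the differentials.
  have hd : (g * g').det = κ * (g.det / κ) ^ 6 := by
    rw [Matrix.det_mul, hg']; field_simp
  refine ⟨g * g', by rw [hd]; exact mul_ne_zero hκ (pow_ne_zero _ hu), ?_⟩
  rw [← comp_comp, h, scale_comp, h', hd]
  exact ext_of_ev fun v => by simp only [ev_scale]; ring

/-- The Weierstrass equation of a non-singular cubic has non-zero discriminant. -/
lemma Nonsingular.isElliptic [CharZero k] {W : WeierstrassCurve k}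
    (hW : (ofWeierstrass W).Nonsingular) : W.IsElliptic := by
  rw [WeierstrassCurve.isElliptic_iff, isUnit_iff_ne_zero]
  intro hΔ
  have h1728 := W.c_relation
  rw [hΔ, mul_zero] at h1728
  -- x is to be a double root of 4x³ + b₂x² + 2b₄x + b₆. The first condition is the vanishing of the
  -- derivative; together they give the vanishing of the cubic. The solution is 12x + b₂ = -c₆/c₄,
  -- or 0 in the cuspidal case c₄ = 0.
  obtain ⟨x, hx2, hx3⟩ : ∃ x, (12 * x + W.b₂) ^ 2 = W.c₄ ∧ W.c₄ * (12 * x + W.b₂) = -W.c₆ := by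
    by_cases h4 : W.c₄ = 0
    · have h6 : W.c₆ = 0 := by
        rw [h4] at h1728
        exact pow_eq_zero_iff (two_ne_zero) |>.mp (by linear_combination h1728)
      exact ⟨-W.b₂ / 12, by rw [h4]; field_simp; ring, by rw [h4, h6]; field_simp; ring⟩
    · have : 12 * ((-W.c₆ / W.c₄ - W.b₂) / 12) + W.b₂ = -W.c₆ / W.c₄ := by field_simp; ring
      refine ⟨(-W.c₆ / W.c₄ - W.b₂) / 12, ?_, ?_⟩
      · rw [this]
        field_simp
        linear_combination h1728
      · rw [this]
        field_simp
  obtain ⟨y, hy⟩ : ∃ y, 2 * y + W.a₁ * x + W.a₃ = 0 :=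
    ⟨-(W.a₁ * x + W.a₃) / 2, by field_simp; ring⟩
  have d1 : 12 * x ^ 2 + 2 * W.b₂ * x + 2 * W.b₄ = 0 :=
    mul_left_cancel₀ (show (12 : k) ≠ 0 by norm_num) (by
      simp only [WeierstrassCurve.c₄] at hx2; linear_combination hx2)
  have d0 : 4 * x ^ 3 + W.b₂ * x ^ 2 + 2 * W.b₄ * x + W.b₆ = 0 :=
    mul_left_cancel₀ (show (432 : k) ≠ 0 by norm_num) (by
      have e : 432 * (4 * x ^ 3 + W.b₂ * x ^ 2 + 2 * W.b₄ * x + W.b₆) =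
          (12 * x + W.b₂) * ((12 * x + W.b₂) ^ 2 - W.c₄)
            - 2 * (W.c₄ * (12 * x + W.b₂) + W.c₆) := by
        simp only [WeierstrassCurve.c₄, WeierstrassCurve.c₆]; ring
      rw [e, hx2, hx3]; ring)
  simp only [WeierstrassCurve.b₂, WeierstrassCurve.b₄, WeierstrassCurve.b₆] at d0 d1
  have e0 : y ^ 2 + W.a₁ * x * y + W.a₃ * y = x ^ 3 + W.a₂ * x ^ 2 + W.a₄ * x + W.a₆ :=
    mul_left_cancel₀ (show (4 : k) ≠ 0 by norm_num) (by
      linear_combination (2 * y + W.a₁ * x + W.a₃) * hy - d0)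
  have e1 : 3 * x ^ 2 + 2 * W.a₂ * x + W.a₄ - W.a₁ * y = 0 :=
    mul_left_cancel₀ (show (4 : k) ≠ 0 by norm_num) (by linear_combination d1 - 2 * W.a₁ * hy)
  have := hW ![x, y, 1] (by simp [ev, ofWeierstrass]; linear_combination e0) (by
    ext i
    fin_cases i
    · simp [gradient, ofWeierstrass]; linear_combination -e1
    · simp [gradient, ofWeierstrass]; linear_combination hy
    · simp [gradient, ofWeierstrass]; linear_combination 3 * e0 + x * e1 - y * hy)
  exact one_ne_zero (congrFun this 2)

end TernaryCubic

/-! ### Collinear points of a Weierstrass curve sum to zero -/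

namespace WeierstrassCurve
open TernaryCubic (ofWeierstrass)

section
variable {k : Type*} [Field k]

lemma ev_ofWeierstrass (W : WeierstrassCurve k) (v : Fin 3 → k) : (ofWeierstrass W).ev v =
    v 1 ^ 2 * v 2 + W.a₁ * v 0 * v 1 * v 2 + W.a₃ * v 1 * v 2 ^ 2
      - (v 0 ^ 3 + W.a₂ * v 0 ^ 2 * v 2 + W.a₄ * v 0 * v 2 ^ 2 + W.a₆ * v 2 ^ 3) := by
  simp [TernaryCubic.ev, ofWeierstrass]; ring

lemma affine_nonsingular_of_ev_eq_zero (W : WeierstrassCurve k) [W.IsElliptic] {v : Fin 3 → k}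
    (hv : (ofWeierstrass W).ev v = 0) (hz : v 2 ≠ 0) :
    W.toAffine.Nonsingular (v 0 / v 2) (v 1 / v 2) := by
  rw [← Affine.equation_iff_nonsingular, Affine.equation_iff]
  rw [ev_ofWeierstrass] at hv
  field_simp
  linear_combination hv

/-- The point of `W(k)` with given homogeneous coordinates. -/
noncomputable def ofVec (W : WeierstrassCurve k) (v : Fin 3 → k) : W.toAffine.Point :=
  Projective.Point.toAffine W v

lemma ofVec_of_Z_eq_zero (W : WeierstrassCurve k) {v : Fin 3 → k} (hz : v 2 = 0) :
    W.ofVec v = 0 :=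
  Projective.Point.toAffine_of_Z_eq_zero hz

lemma ofVec_of_Z_ne_zero (W : WeierstrassCurve k) [W.IsElliptic] {v : Fin 3 → k}
    (hv : (ofWeierstrass W).ev v = 0) (hz : v 2 ≠ 0) :
    W.ofVec v = .some _ _ (W.affine_nonsingular_of_ev_eq_zero hv hz) :=
  Projective.Point.toAffine_of_Z_ne_zero ((Projective.nonsingular_of_Z_ne_zero hz).mpr
    (W.affine_nonsingular_of_ev_eq_zero hv hz)) hz

lemma ofVec_smul (W : WeierstrassCurve k) (v : Fin 3 → k) {t : k} (ht : t ≠ 0) :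
    W.ofVec (t • v) = W.ofVec v :=
  Projective.Point.toAffine_smul v ht.isUnit

lemma ofVec_eq_some (W : WeierstrassCurve k) [W.IsElliptic] {v : Fin 3 → k} {x y : k}
    (hv : (ofWeierstrass W).ev v = 0) (hz : v 2 ≠ 0) (hx : v 0 / v 2 = x) (hy : v 1 / v 2 = y) :
    ∃ h : W.toAffine.Nonsingular x y, W.ofVec v = .some x y h := by
  subst hx hy
  exact ⟨_, W.ofVec_of_Z_ne_zero hv hz⟩

/-- Describing the slope by an equation without division treats chords and tangents together, so
that the slope of a given line can be used in both cases. -/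
lemma some_add_some [DecidableEq k] {W : WeierstrassCurve k} {x₁ y₁ x₂ y₂ ℓ x y : k}
    {h₁ : W.toAffine.Nonsingular x₁ y₁} {h₂ : W.toAffine.Nonsingular x₂ y₂}
    (hxy : ¬(x₁ = x₂ ∧ y₁ = -y₂ - W.a₁ * x₂ - W.a₃))
    (hℓ : x₁ ≠ x₂ ∧ ℓ * (x₁ - x₂) = y₁ - y₂ ∨ x₁ = x₂ ∧ y₁ = y₂ ∧
      ℓ * (2 * y₁ + W.a₁ * x₁ + W.a₃) = 3 * x₁ ^ 2 + 2 * W.a₂ * x₁ + W.a₄ - W.a₁ * y₁)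
    (hx : x = ℓ ^ 2 + W.a₁ * ℓ - W.a₂ - x₁ - x₂)
    (hy : y = -(ℓ * (x - x₁) + y₁) - W.a₁ * x - W.a₃) :
    ∃ h : W.toAffine.Nonsingular x y,
      (.some _ _ h₁ + .some _ _ h₂ : W.toAffine.Point) = .some x y h := by
  have hs : W.toAffine.slope x₁ x₂ y₁ y₂ = ℓ := by
    rcases hℓ with ⟨h, hℓ⟩ | ⟨rfl, rfl, hℓ⟩
    · rw [Affine.slope_of_X_ne h, div_eq_iff (sub_ne_zero.mpr h), hℓ]
    · have h' : y₁ ≠ -y₁ - W.a₁ * x₁ - W.a₃ := fun h => hxy ⟨rfl, h⟩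
      have h'' : y₁ - W.toAffine.negY x₁ y₁ ≠ 0 := sub_ne_zero.mpr h'
      rw [Affine.slope_of_Y_ne rfl h', div_eq_iff h'', ← hℓ]
      simp only [Affine.negY]
      ring
  have hx' : x = W.toAffine.addX x₁ x₂ (W.toAffine.slope x₁ x₂ y₁ y₂) := by rw [hs, hx]; rfl
  have hy' : y = W.toAffine.addY x₁ x₂ y₁ (W.toAffine.slope x₁ x₂ y₁ y₂) := by
    rw [Affine.addY, Affine.negAddY, ← hx', hs, hy]; rfl
  subst hx' hy'
  exact ⟨_, Affine.Point.add_some hxy⟩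

lemma some_eq_some {W : WeierstrassCurve k} {x₁ y₁ x₂ y₂ : k}
    {h₁ : W.toAffine.Nonsingular x₁ y₁} {h₂ : W.toAffine.Nonsingular x₂ y₂} (hx : x₁ = x₂)
    (hy : y₁ = y₂) : (.some x₁ y₁ h₁ : W.toAffine.Point) = .some x₂ y₂ h₂ := by
  subst hx hy; rfl

lemma coeff_eq_zero_of_forall_cubic [CharZero k] {e₀ e₁ e₂ e₃ : k}
    (h : ∀ x : k, e₀ + e₁ * x + e₂ * x ^ 2 + e₃ * x ^ 3 = 0) :
    e₀ = 0 ∧ e₁ = 0 ∧ e₂ = 0 ∧ e₃ = 0 := by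
  have h0 : e₀ = 0 := by simpa using h 0
  have h1 := h 1
  have h2 := h (-1)
  have h3 := h 2
  have e3 : e₃ = 0 := mul_left_cancel₀ (show (6 : k) ≠ 0 by norm_num) (by
    linear_combination h3 + 3 * h0 - 3 * h1 - h2)
  have e2 : e₂ = 0 := mul_left_cancel₀ (show (2 : k) ≠ 0 by norm_num) (by
    linear_combination h1 + h2 - 2 * h0)
  exact ⟨h0, by linear_combination h1 - h0 - e2 - e3, e2, e3⟩

/-- The three affine points of a non-vertical line sum to zero. -/
lemma some_add_some_add_some [CharZero k] [DecidableEq k] {W : WeierstrassCurve k}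
    {x y : Fin 3 → k} (hxy : ∀ i, W.toAffine.Nonsingular (x i) (y i)) (ℓ μ : k)
    (hy : ∀ i, y i = ℓ * x i + μ)
    (h : ∀ X, (ℓ * X + μ) ^ 2 + W.a₁ * X * (ℓ * X + μ) + W.a₃ * (ℓ * X + μ)
      - (X ^ 3 + W.a₂ * X ^ 2 + W.a₄ * X + W.a₆) = -((X - x 0) * (X - x 1) * (X - x 2))) :
    (.some _ _ (hxy 0) + .some _ _ (hxy 1) + .some _ _ (hxy 2) : W.toAffine.Point) = 0 := by
  obtain ⟨-, e1, e2, -⟩ := coeff_eq_zero_of_forall_cubic (k := k)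
    (e₀ := μ ^ 2 + W.a₃ * μ - W.a₆ - x 0 * x 1 * x 2)
    (e₁ := 2 * ℓ * μ + W.a₁ * μ + W.a₃ * ℓ - W.a₄ + (x 0 * x 1 + x 0 * x 2 + x 1 * x 2))
    (e₂ := ℓ ^ 2 + W.a₁ * ℓ - W.a₂ - (x 0 + x 1 + x 2)) (e₃ := 0)
    fun X => by linear_combination h X
  -- If the first two roots coincide, the derivative of the restricted equation vanishes there,
  -- which says that ℓ is the slope of the tangent.
  have ht : x 0 = x 1 → ℓ * (2 * y 0 + W.a₁ * x 0 + W.a₃) =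
      3 * x 0 ^ 2 + 2 * W.a₂ * x 0 + W.a₄ - W.a₁ * y 0 := by
    intro h01
    rw [← h01] at e1 e2
    rw [hy 0]
    linear_combination e1 + 2 * x 0 * e2
  -- On a non-vertical line opposite points coincide and have 2y + a₁x + a₃ = 0; the tangent
  -- relation then kills the other partial derivative as well, contradicting smoothness.
  have hne : ¬(x 0 = x 1 ∧ y 0 = -y 1 - W.a₁ * x 1 - W.a₃) := by
    rintro ⟨h01, hy01⟩
    have h2 : y 0 = y 1 := by rw [hy, hy, h01]
    have ht' := ht h01
    rw [← h01, ← h2] at hy01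
    have hn := (Affine.nonsingular_iff _ _).mp (hxy 0)
    rcases hn.2 with h | h
    · apply h
      linear_combination ht' - ℓ * hy01
    · exact h hy01
  obtain ⟨h3, h4⟩ := some_add_some (h₁ := hxy 0) (h₂ := hxy 1) (ℓ := ℓ) (x := x 2)
    (y := -y 2 - W.a₁ * x 2 - W.a₃) hne (by
      by_cases h01 : x 0 = x 1
      · exact Or.inr ⟨h01, by rw [hy, hy, h01], ht h01⟩
      · exact Or.inl ⟨h01, by rw [hy 0, hy 1]; ring⟩)
    (by linear_combination -e2) (by rw [hy 2, hy 0]; ring)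
  rw [h4]
  exact Affine.Point.add_of_Y_eq rfl rfl

end

section
variable {k : Type*} [Field k] [CharZero k] [DecidableEq k] {W : WeierstrassCurve k} [W.IsElliptic]

/-- The third point at infinity: the other two points of a line through the point at infinity are
opposite. -/
lemma ofVec_add_ofVec_add_ofVec_of_Z_eq_zero {p q : Fin 3 → k}
    (hpq : LinearIndependent k ![p, q]) {a b : Fin 3 → k} {κ : k}
    (hab : ∀ i, a i • p + b i • q ≠ 0)
    (h : ∀ s t, (ofWeierstrass W).ev (s • p + t • q) =
      κ * ((s * b 0 - t * a 0) * (s * b 1 - t * a 1) * (s * b 2 - t * a 2)))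
    (hz : (a 2 • p + b 2 • q) 2 = 0) :
    W.ofVec (a 0 • p + b 0 • q) + W.ofVec (a 1 • p + b 1 • q) + W.ofVec (a 2 • p + b 2 • q)
      = 0 := by
  rw [W.ofVec_of_Z_eq_zero hz, add_zero]
  have hev : ∀ i, (ofWeierstrass W).ev (a i • p + b i • q) = 0 := by
    intro i; rw [h]; fin_cases i <;> simp <;> ring_nf <;> simp
  by_cases hinf : p 2 = 0 ∧ q 2 = 0
  · rw [W.ofVec_of_Z_eq_zero (by simp [hinf]), W.ofVec_of_Z_eq_zero (by simp [hinf]), add_zero]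
  have hx3 : (a 2 • p + b 2 • q) 0 = 0 := by
    have := hev 2
    rw [ev_ofWeierstrass, hz] at this
    exact pow_eq_zero_iff (three_ne_zero) |>.mp (by linear_combination -this)
  have hy3 : (a 2 • p + b 2 • q) 1 ≠ 0 := fun hy => hab 2 (by
    ext i; fin_cases i
    exacts [hx3, hy, hz])
  set c := p ⨯₃ q with hc
  have hc0 : c ≠ 0 := crossProduct_ne_zero_iff_linearIndependent.mpr hpq
  have cp : c 0 * p 0 + c 1 * p 1 + c 2 * p 2 = 0 := by simp [hc, cross_apply]; ring
  have cq : c 0 * q 0 + c 1 * q 1 + c 2 * q 2 = 0 := by simp [hc, cross_apply]; ring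
  simp only [Pi.add_apply, Pi.smul_apply, smul_eq_mul] at hx3 hy3 hz
  -- The third point is (0:1:0), so the equation of the line has no term in y: the line is x = x₀z
  -- with x₀ = -c 2 / c 0.
  have c1 : c 1 = 0 := (mul_eq_zero.mp (show (a 2 * p 1 + b 2 * q 1) * c 1 = 0 by
    linear_combination a 2 * cp + b 2 * cq - c 0 * hx3 - c 2 * hz)).resolve_left hy3
  have c0 : c 0 ≠ 0 := by
    intro c0
    have c2 : c 2 ≠ 0 := fun c2 => hc0 (by ext i; fin_cases i <;> simp [c0, c1, c2])
    exact hinf ⟨by simpa [c0, c1, c2] using cp, by simpa [c0, c1, c2] using cq⟩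
  have hc0' : c 0 = p 1 * q 2 - p 2 * q 1 := by simp [hc, cross_apply]
  set x₀ := -c 2 / c 0 with hx₀
  have xp : p 0 = x₀ * p 2 := by rw [hx₀]; field_simp; linear_combination cp - p 1 * c1
  have xq : q 0 = x₀ * q 2 := by rw [hx₀]; field_simp; linear_combination cq - q 1 * c1
  have key : ∀ Y : k, Y ^ 2 + W.a₁ * x₀ * Y + W.a₃ * Y
      - (x₀ ^ 3 + W.a₂ * x₀ ^ 2 + W.a₄ * x₀ + W.a₆) = κ / c 0 ^ 3 *
        ((Y * (a 0 * p 2 + b 0 * q 2) - (a 0 * p 1 + b 0 * q 1)) *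
        (Y * (a 1 * p 2 + b 1 * q 2) - (a 1 * p 1 + b 1 * q 1)) *
        (Y * (a 2 * p 2 + b 2 * q 2) - (a 2 * p 1 + b 2 * q 1))) := by
    intro Y
    have hv : ((Y * q 2 - q 1) / c 0) • p + ((p 1 - Y * p 2) / c 0) • q = ![x₀, Y, 1] := by
      ext i
      fin_cases i
      · simp only [Pi.add_apply, Pi.smul_apply, smul_eq_mul, Fin.zero_eta, Matrix.cons_val_zero, xp,
          xq]
        field_simp
        linear_combination (-x₀) * hc0'
      · simp
        field_simp
        linear_combination (-Y) * hc0'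
      · simp
        field_simp
        linear_combination -hc0'
    have := h ((Y * q 2 - q 1) / c 0) ((p 1 - Y * p 2) / c 0)
    rw [hv, ev_ofWeierstrass] at this
    simp only [Matrix.cons_val_zero, Matrix.cons_val_one, Matrix.cons_val] at this
    field_simp at this ⊢
    linear_combination this
  -- The third factor does not involve Y. The coefficients of Y² and Y then give the sum of the two
  -- remaining roots as -(a₁x₀ + a₃), which makes the two points opposite.
  obtain ⟨-, e1, e2, -⟩ := coeff_eq_zero_of_forall_cubic (k := k)
    (e₀ := -(x₀ ^ 3 + W.a₂ * x₀ ^ 2 + W.a₄ * x₀ + W.a₆) + κ / c 0 ^ 3 *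
      ((a 0 * p 1 + b 0 * q 1) * (a 1 * p 1 + b 1 * q 1) * (a 2 * p 1 + b 2 * q 1)))
    (e₁ := W.a₁ * x₀ + W.a₃ - κ / c 0 ^ 3 * (a 2 * p 1 + b 2 * q 1) *
      ((a 0 * p 2 + b 0 * q 2) * (a 1 * p 1 + b 1 * q 1)
        + (a 1 * p 2 + b 1 * q 2) * (a 0 * p 1 + b 0 * q 1)))
    (e₂ := 1 + κ / c 0 ^ 3 * (a 2 * p 1 + b 2 * q 1) *
      ((a 0 * p 2 + b 0 * q 2) * (a 1 * p 2 + b 1 * q 2))) (e₃ := 0)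
    fun Y => by
      have := key Y
      rw [hz] at this
      linear_combination this
  have hz0 : a 0 * p 2 + b 0 * q 2 ≠ 0 := fun h0 => by rw [h0] at e2; simp at e2
  have hz1 : a 1 * p 2 + b 1 * q 2 ≠ 0 := fun h0 => by rw [h0] at e2; simp at e2
  obtain ⟨h0, r0⟩ := W.ofVec_eq_some (v := a 0 • p + b 0 • q) (x := x₀)
    (y := (a 0 * p 1 + b 0 * q 1) / (a 0 * p 2 + b 0 * q 2)) (hev 0) (by simpa using hz0)
    (by simp only [Pi.add_apply, Pi.smul_apply, smul_eq_mul, xp, xq]; field_simp) (by simp)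
  obtain ⟨h1, r1⟩ := W.ofVec_eq_some (v := a 1 • p + b 1 • q) (x := x₀)
    (y := (a 1 * p 1 + b 1 * q 1) / (a 1 * p 2 + b 1 * q 2)) (hev 1) (by simpa using hz1)
    (by simp only [Pi.add_apply, Pi.smul_apply, smul_eq_mul, xp, xq]; field_simp) (by simp)
  rw [r0, r1]
  refine Affine.Point.add_of_Y_eq rfl ?_
  simp only [Affine.negY]
  generalize a 0 * p 2 + b 0 * q 2 = z₀ at *
  generalize a 1 * p 2 + b 1 * q 2 = z₁ at *
  field_simp
  linear_combination (z₀ * z₁) * e1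
    + (z₀ * (a 1 * p 1 + b 1 * q 1) + z₁ * (a 0 * p 1 + b 0 * q 1)) * e2

/-- The points of intersection of a Weierstrass curve with a line sum to zero. -/
lemma ofVec_add_ofVec_add_ofVec {p q : Fin 3 → k}
    (hpq : LinearIndependent k ![p, q]) {a b : Fin 3 → k} {κ : k} (hκ : κ ≠ 0)
    (hab : ∀ i, a i • p + b i • q ≠ 0)
    (h : ∀ s t, (ofWeierstrass W).ev (s • p + t • q) =
      κ * ((s * b 0 - t * a 0) * (s * b 1 - t * a 1) * (s * b 2 - t * a 2))) :
    W.ofVec (a 0 • p + b 0 • q) + W.ofVec (a 1 • p + b 1 • q) + W.ofVec (a 2 • p + b 2 • q)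
      = 0 := by
  by_cases hz2 : (a 2 • p + b 2 • q) 2 = 0
  · exact ofVec_add_ofVec_add_ofVec_of_Z_eq_zero hpq hab h hz2
  by_cases hz1 : (a 1 • p + b 1 • q) 2 = 0
  · have := ofVec_add_ofVec_add_ofVec_of_Z_eq_zero (W := W) hpq (a := ![a 0, a 2, a 1])
      (b := ![b 0, b 2, b 1]) (by intro i; fin_cases i; exacts [hab 0, hab 2, hab 1])
      (by
        intro s t
        rw [h]
        simp only [Matrix.cons_val_zero, Matrix.cons_val_one, Matrix.cons_val]
        ring) hz1
    rw [← this]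
    simp only [Matrix.cons_val_zero, Matrix.cons_val_one, Matrix.cons_val]
    abel
  by_cases hz0 : (a 0 • p + b 0 • q) 2 = 0
  · have := ofVec_add_ofVec_add_ofVec_of_Z_eq_zero (W := W) hpq (a := ![a 2, a 1, a 0])
      (b := ![b 2, b 1, b 0]) (by intro i; fin_cases i; exacts [hab 2, hab 1, hab 0])
      (by
        intro s t
        rw [h]
        simp only [Matrix.cons_val_zero, Matrix.cons_val_one, Matrix.cons_val]
        ring) hz0
    rw [← this]
    simp only [Matrix.cons_val_zero, Matrix.cons_val_one, Matrix.cons_val]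
    abel
  have hz : ∀ i, (a i • p + b i • q) 2 ≠ 0 := by
    intro i; fin_cases i; exacts [hz0, hz1, hz2]
  have hev : ∀ i, (ofWeierstrass W).ev (a i • p + b i • q) = 0 := by
    intro i; rw [h]; fin_cases i <;> simp <;> ring_nf <;> simp
  set c := p ⨯₃ q with hc
  have cp : c 0 * p 0 + c 1 * p 1 + c 2 * p 2 = 0 := by simp [hc, cross_apply]; ring
  have cq : c 0 * q 0 + c 1 * q 1 + c 2 * q 2 = 0 := by simp [hc, cross_apply]; ring
  have hc0 : c ≠ 0 := crossProduct_ne_zero_iff_linearIndependent.mpr hpq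
  have hc1' : c 1 = p 2 * q 0 - p 0 * q 2 := by simp [hc, cross_apply]
  have hc1 : c 1 ≠ 0 := by
    intro c1
    -- the line contains the point at infinity
    obtain ⟨s, t, hst⟩ : ∃ s t : k, s • p + t • q = ![0, 1, 0] := by
      by_cases c0 : c 0 = 0
      · have c2 : c 2 ≠ 0 := fun c2 => hc0 (by ext i; fin_cases i <;> simp [c0, c1, c2])
        exact absurd (show (a 0 • p + b 0 • q) 2 = 0 by
          have h1 : p 2 = 0 := by simpa [c0, c1, c2] using cp
          have h2 : q 2 = 0 := by simpa [c0, c1, c2] using cq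
          simp [h1, h2]) (hz 0)
      · have hc0' : c 0 = p 1 * q 2 - p 2 * q 1 := by simp [hc, cross_apply]
        refine ⟨q 2 / c 0, -(p 2) / c 0, ?_⟩
        ext i
        fin_cases i
        · simp
          field_simp
          linear_combination hc1' - c1
        · simp
          field_simp
          linear_combination -hc0'
        · simp
          field_simp
          ring
    have h0 := h s t
    rw [hst, ev_ofWeierstrass] at h0
    simp only [Matrix.cons_val_zero, Matrix.cons_val_one, Matrix.cons_val] at h0
    have hs2 : s * p 2 + t * q 2 = 0 := by simpa using congrFun hst 2
    have hs1 : s * p 1 + t * q 1 = 1 := by simpa using congrFun hst 1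
    -- A vanishing factor would make (s : t) equal to (a i : b i), so the point at infinity would be
    -- the i-th point; but that has non-zero last coordinate.
    have hi : ∀ i, s * b i - t * a i ≠ 0 := by
      intro i hi
      have hzi := hz i
      simp only [Pi.add_apply, Pi.smul_apply, smul_eq_mul] at hzi
      by_cases hs : s = 0
      · have ht : t ≠ 0 := fun ht => by simp [hs, ht] at hs1
        have hai : a i = 0 := by simpa [hs, ht] using hi
        have hq2 : q 2 = 0 := by simpa [hs, ht] using hs2
        exact hzi (by simp [hai, hq2])
      · exact hzi (mul_left_cancel₀ hs (by linear_combination a i * hs2 + q 2 * hi))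
    exact mul_ne_zero hκ (mul_ne_zero (mul_ne_zero (hi 0) (hi 1)) (hi 2)) (by
      rw [← h0]; ring)
  obtain ⟨ℓ, hℓ⟩ : ∃ ℓ, ℓ = -c 0 / c 1 := ⟨_, rfl⟩
  obtain ⟨μ, hμ⟩ : ∃ μ, μ = -c 2 / c 1 := ⟨_, rfl⟩
  have hp : p 1 = ℓ * p 0 + μ * p 2 := by
    rw [hℓ, hμ]; field_simp; linear_combination cp
  have hq : q 1 = ℓ * q 0 + μ * q 2 := by
    rw [hℓ, hμ]; field_simp; linear_combination cq
  have key : ∀ X, (ℓ * X + μ) ^ 2 + W.a₁ * X * (ℓ * X + μ) + W.a₃ * (ℓ * X + μ)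
      - (X ^ 3 + W.a₂ * X ^ 2 + W.a₄ * X + W.a₆) = -κ / c 1 ^ 3 *
        ((X * (a 0 • p + b 0 • q) 2 - (a 0 • p + b 0 • q) 0) *
        (X * (a 1 • p + b 1 • q) 2 - (a 1 • p + b 1 • q) 0) *
        (X * (a 2 • p + b 2 • q) 2 - (a 2 • p + b 2 • q) 0)) := by
    intro X
    have hv : ((q 0 - X * q 2) / c 1) • p + ((X * p 2 - p 0) / c 1) • q = ![X, ℓ * X + μ, 1] := by
      ext i
      fin_cases i
      · simp
        field_simp
        linear_combination (-X) * hc1'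
      · simp only [Pi.add_apply, Pi.smul_apply, smul_eq_mul, Fin.mk_one, Matrix.cons_val_one,
          Matrix.cons_val_zero, hp, hq]
        field_simp
        linear_combination (-(ℓ * X + μ)) * hc1'
      · simp
        field_simp
        linear_combination -hc1'
    have := h ((q 0 - X * q 2) / c 1) ((X * p 2 - p 0) / c 1)
    rw [hv, ev_ofWeierstrass] at this
    simp only [Matrix.cons_val_zero, Matrix.cons_val_one, Matrix.cons_val] at this
    simp only [Pi.add_apply, Pi.smul_apply, smul_eq_mul]
    field_simp at this ⊢
    linear_combination this
  -- The third difference at 0, 1, -1, 2 isolates six times the coefficient of X³, which is -1 on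
  -- the left-hand side of `key`.
  have hlead : κ / c 1 ^ 3 *
      ((a 0 • p + b 0 • q) 2 * (a 1 • p + b 1 • q) 2 * (a 2 • p + b 2 • q) 2) = 1 := by
    have h0 := key 0
    have h1 := key 1
    have h2 := key (-1)
    have h3 := key 2
    exact mul_left_cancel₀ (show (6 : k) ≠ 0 by norm_num) (by
      linear_combination h3 + 3 * h0 - 3 * h1 - h2)
  rw [W.ofVec_of_Z_ne_zero (hev 0) (hz 0), W.ofVec_of_Z_ne_zero (hev 1) (hz 1),
    W.ofVec_of_Z_ne_zero (hev 2) (hz 2)]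
  refine some_add_some_add_some
    (x := fun i => (a i • p + b i • q) 0 / (a i • p + b i • q) 2)
    (y := fun i => (a i • p + b i • q) 1 / (a i • p + b i • q) 2)
    (fun i => W.affine_nonsingular_of_ev_eq_zero (hev i) (hz i)) ℓ μ (fun i => ?_) fun X => ?_
  · have hzi := hz i
    simp only [Pi.add_apply, Pi.smul_apply, smul_eq_mul] at hzi ⊢
    field_simp
    rw [hp, hq]
    ring
  · rw [key X]
    generalize (a 0 • p + b 0 • q) 0 = x0, (a 1 • p + b 1 • q) 0 = x1,
      (a 2 • p + b 2 • q) 0 = x2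
    have z0 := hz 0
    have z1 := hz 1
    have z2 := hz 2
    generalize (a 0 • p + b 0 • q) 2 = w0, (a 1 • p + b 1 • q) 2 = w1,
      (a 2 • p + b 2 • q) 2 = w2 at z0 z1 z2 hlead ⊢
    field_simp at hlead ⊢
    linear_combination (-((X * w0 - x0) * (X * w1 - x1) * (X * w2 - x2))) * hlead

end
end WeierstrassCurve

/-! ### The difference of two points of a cubic as a covariant -/

namespace TernaryCubic
variable {k : Type*} [Field k]

/-- For a ternary cubic through `(1:0:0)` and `(0:1:0)`, twelve times the `x`-coordinate of the
difference of these points on the Jacobian, plus `b₂`. -/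
def diffX (G : TernaryCubic k) : k := 12 * (G.a3 * G.b3) + G.jacobian.b₂

/-- For a ternary cubic through `(1:0:0)` and `(0:1:0)`, the value of `2y + a₁x + a₃` at the
difference of these points on the Jacobian. -/
def diffY (G : TernaryCubic k) : k :=
  2 * (G.c * G.a2 * G.b1) + G.m * (G.a3 * G.b3) + G.jacobian.a₃

lemma diffX_scale (G : TernaryCubic k) (κ : k) : (G.scale κ).diffX = κ ^ 2 * G.diffX := by
  simp only [diffX, scale, jacobian, WeierstrassCurve.b₂]; ring

lemma diffY_scale (G : TernaryCubic k) (κ : k) : (G.scale κ).diffY = κ ^ 3 * G.diffY := by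
  simp only [diffY, scale, jacobian]; ring

/-- Rescaling the two points and changing the auxiliary third vector is a substitution of
determinant trγ, and only the square of this factor appears. Hence `diffX` over the squared
determinant depends on the two points alone; `diffY` behaves likewise with the cube. -/
lemma diffX_subst {G : TernaryCubic k} (ha : G.a = 0) (hb : G.b = 0) (t r α β γ : k) :
    (G.subst ![t, 0, 0] ![0, r, 0] ![α, β, γ]).diffX = (t * r * γ) ^ 2 * G.diffX := by
  simp [diffX, jacobian, WeierstrassCurve.b₂, subst, ev, gradient, hessian, Matrix.mulVec,
    dotProduct, Fin.sum_univ_three, ha, hb]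
  ring

lemma diffY_subst {G : TernaryCubic k} (ha : G.a = 0) (hb : G.b = 0) (t r α β γ : k) :
    (G.subst ![t, 0, 0] ![0, r, 0] ![α, β, γ]).diffY = (t * r * γ) ^ 3 * G.diffY := by
  simp [diffY, jacobian, subst, ev, gradient, hessian, Matrix.mulVec,
    dotProduct, Fin.sum_univ_three, ha, hb]
  ring

lemma subst_subst [CharZero k] (F : TernaryCubic k) (p q r p' q' r' : Fin 3 → k) :
    (F.subst p q r).subst p' q' r' = F.subst (p' 0 • p + p' 1 • q + p' 2 • r)
      (q' 0 • p + q' 1 • q + q' 2 • r) (r' 0 • p + r' 1 • q + r' 2 • r) :=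
  ext_of_ev fun v => by
    simp only [ev_subst]
    congr 1
    ext i
    simp
    ring

end TernaryCubic

namespace WeierstrassCurve
open TernaryCubic (ofWeierstrass)

variable {k : Type*} [Field k] {W : WeierstrassCurve k}

/-- `(x, y)` satisfies the formula for the difference of the points `A` and `B`, computed with the
help of the auxiliary point `C`. -/
def IsDiff (W : WeierstrassCurve k) (A B C : Fin 3 → k) (x y : k) : Prop :=
  (A ⬝ᵥ B ⨯₃ C) ^ 2 * (12 * x + W.b₂) = ((ofWeierstrass W).subst A B C).diffX ∧
    (A ⬝ᵥ B ⨯₃ C) ^ 3 * (2 * y + W.a₁ * x + W.a₃) = ((ofWeierstrass W).subst A B C).diffY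

/-- Independence of the representatives and of the auxiliary point, which allows a convenient C to
be chosen for each relative position of the points. -/
lemma IsDiff.unique [CharZero k] {A B C A' B' C' : Fin 3 → k} {x y x' y' : k}
    (hA : (ofWeierstrass W).ev A' = 0) (hB : (ofWeierstrass W).ev B' = 0)
    (h : W.IsDiff A B C x y) (h' : W.IsDiff A' B' C' x' y') (hd : A ⬝ᵥ B ⨯₃ C ≠ 0)
    {t r α β γ : k} (hAA' : A = t • A') (hBB' : B = r • B')
    (hCC' : C = α • A' + β • B' + γ • C') : x' = x ∧ y' = y := by
  have hs : (ofWeierstrass W).subst A B C =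
      ((ofWeierstrass W).subst A' B' C').subst ![t, 0, 0] ![0, r, 0] ![α, β, γ] := by
    rw [TernaryCubic.subst_subst, hAA', hBB', hCC']
    simp
  have hdd : A ⬝ᵥ B ⨯₃ C = t * r * γ * (A' ⬝ᵥ B' ⨯₃ C') := by
    rw [hAA', hBB', hCC']
    simp [cross_apply, dotProduct, Fin.sum_univ_three]
    ring
  obtain ⟨h1, h2⟩ := h
  obtain ⟨h1', h2'⟩ := h'
  rw [hs, TernaryCubic.diffX_subst hA hB, ← h1', ← mul_assoc, ← mul_pow, ← hdd] at h1
  rw [hs, TernaryCubic.diffY_subst hA hB, ← h2', ← mul_assoc, ← mul_pow, ← hdd] at h2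
  have e1 := mul_left_cancel₀ (pow_ne_zero 2 hd) h1
  have e2 := mul_left_cancel₀ (pow_ne_zero 3 hd) h2
  have hx : x' = x := mul_left_cancel₀ (show (12 : k) ≠ 0 by norm_num) (by
    linear_combination -e1)
  exact ⟨hx, mul_left_cancel₀ (show (2 : k) ≠ 0 by norm_num) (by
    rw [hx] at e2; linear_combination -e2)⟩

/-- This and the next three lemmas check the formula in representative positions: one of the points
at infinity, different abscissae, opposite points. The equation of the curve serves to eliminate a₆.
-/
lemma isDiff_zero_left {x y : k} (h : (ofWeierstrass W).ev ![x, y, 1] = 0) :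
    W.IsDiff ![0, 1, 0] ![x, y, 1] ![1, 0, 0] x (-y - W.a₁ * x - W.a₃) := by
  have ha6 : W.a₆ = y ^ 2 + W.a₁ * x * y + W.a₃ * y - x ^ 3 - W.a₂ * x ^ 2 - W.a₄ * x := by
    simp [ev_ofWeierstrass] at h; linear_combination -h
  constructor <;>
  · simp [TernaryCubic.diffX, TernaryCubic.diffY, TernaryCubic.jacobian, b₂, TernaryCubic.subst,
      TernaryCubic.ev, TernaryCubic.gradient, TernaryCubic.hessian, Matrix.mulVec, dotProduct,
      Fin.sum_univ_three, ofWeierstrass, cross_apply, ha6]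
    ring

lemma isDiff_zero_right {x y : k} (h : (ofWeierstrass W).ev ![x, y, 1] = 0) :
    W.IsDiff ![x, y, 1] ![0, 1, 0] ![1, 0, 0] x y := by
  have ha6 : W.a₆ = y ^ 2 + W.a₁ * x * y + W.a₃ * y - x ^ 3 - W.a₂ * x ^ 2 - W.a₄ * x := by
    simp [ev_ofWeierstrass] at h; linear_combination -h
  constructor <;>
  · simp [TernaryCubic.diffX, TernaryCubic.diffY, TernaryCubic.jacobian, b₂, TernaryCubic.subst,
      TernaryCubic.ev, TernaryCubic.gradient, TernaryCubic.hessian, Matrix.mulVec, dotProduct,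
      Fin.sum_univ_three, ofWeierstrass, cross_apply, ha6]
    ring

/-- ℓ is the slope of the chord from (x₁, y₁) to the opposite of (x₂, y₂). Having two points on the
curve allows a₄ to be eliminated along with a₆. -/
lemma isDiff_of_X_ne {x₁ y₁ x₂ y₂ ℓ x y : k} (h₁ : (ofWeierstrass W).ev ![x₁, y₁, 1] = 0)
    (h₂ : (ofWeierstrass W).ev ![x₂, y₂, 1] = 0) (hx : x₁ ≠ x₂)
    (hℓ : ℓ = (y₁ + y₂ + W.a₁ * x₂ + W.a₃) / (x₁ - x₂))
    (hX : x = ℓ ^ 2 + W.a₁ * ℓ - W.a₂ - x₁ - x₂)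
    (hY : y = -(ℓ * (x - x₁) + y₁) - W.a₁ * x - W.a₃) :
    W.IsDiff ![x₁, y₁, 1] ![x₂, y₂, 1] ![0, 1, 0] x y := by
  have ha6 : W.a₆ = y₁ ^ 2 + W.a₁ * x₁ * y₁ + W.a₃ * y₁ - x₁ ^ 3 - W.a₂ * x₁ ^ 2
      - W.a₄ * x₁ := by
    simp [ev_ofWeierstrass] at h₁; linear_combination -h₁
  have hd : x₁ - x₂ ≠ 0 := sub_ne_zero.mpr hx
  have ha4 : W.a₄ = (y₁ ^ 2 + W.a₁ * x₁ * y₁ + W.a₃ * y₁ - x₁ ^ 3 - W.a₂ * x₁ ^ 2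
      - (y₂ ^ 2 + W.a₁ * x₂ * y₂ + W.a₃ * y₂ - x₂ ^ 3 - W.a₂ * x₂ ^ 2)) / (x₁ - x₂) := by
    rw [eq_div_iff hd]
    simp [ev_ofWeierstrass] at h₁ h₂; linear_combination h₂ - h₁
  rw [hY, hX, hℓ]
  constructor <;>
  · simp [TernaryCubic.diffX, TernaryCubic.diffY, TernaryCubic.jacobian, b₂, TernaryCubic.subst,
      TernaryCubic.ev, TernaryCubic.gradient, TernaryCubic.hessian, Matrix.mulVec, dotProduct,
      Fin.sum_univ_three, ofWeierstrass, cross_apply, ha6, ha4]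
    field_simp
    ring

/-- The second point is the opposite of the first, so the difference is twice the first point and ℓ
is the slope of its tangent. -/
lemma isDiff_of_X_eq {x₁ y₁ ℓ x y : k} (h₁ : (ofWeierstrass W).ev ![x₁, y₁, 1] = 0)
    (hy : 2 * y₁ + W.a₁ * x₁ + W.a₃ ≠ 0)
    (hℓ : ℓ = (3 * x₁ ^ 2 + 2 * W.a₂ * x₁ + W.a₄ - W.a₁ * y₁) / (2 * y₁ + W.a₁ * x₁ + W.a₃))
    (hX : x = ℓ ^ 2 + W.a₁ * ℓ - W.a₂ - x₁ - x₁)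
    (hY : y = -(ℓ * (x - x₁) + y₁) - W.a₁ * x - W.a₃) :
    W.IsDiff ![x₁, y₁, 1] ![x₁, -y₁ - W.a₁ * x₁ - W.a₃, 1] ![1, 0, 0] x y := by
  have ha6 : W.a₆ = y₁ ^ 2 + W.a₁ * x₁ * y₁ + W.a₃ * y₁ - x₁ ^ 3 - W.a₂ * x₁ ^ 2
      - W.a₄ * x₁ := by
    simp [ev_ofWeierstrass] at h₁; linear_combination -h₁
  obtain ⟨M, hM⟩ : ∃ M, M = 2 * y₁ + W.a₁ * x₁ + W.a₃ := ⟨_, rfl⟩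
  have ha3 : W.a₃ = M - 2 * y₁ - W.a₁ * x₁ := by rw [hM]; ring
  rw [← hM] at hy hℓ
  rw [hY, hX, hℓ]
  constructor <;>
  · simp [TernaryCubic.diffX, TernaryCubic.diffY, TernaryCubic.jacobian, b₂, TernaryCubic.subst,
      TernaryCubic.ev, TernaryCubic.gradient, TernaryCubic.hessian, Matrix.mulVec, dotProduct,
      Fin.sum_univ_three, ofWeierstrass, cross_apply, ha6, ha3]
    field_simp
    ring

lemma exists_some_eq_neg_some [W.IsElliptic] {x y : k} (h : (ofWeierstrass W).ev ![x, y, 1] = 0) :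
    ∃ (h₁ : W.toAffine.Nonsingular x y)
      (h₂ : W.toAffine.Nonsingular x (-y - W.a₁ * x - W.a₃)),
      W.ofVec ![x, y, 1] = .some _ _ h₁ ∧ -W.ofVec ![x, y, 1] = .some _ _ h₂ := by
  obtain ⟨h₁, e⟩ := W.ofVec_eq_some (x := x) (y := y) h (by simp) (by simp) (by simp)
  exact ⟨h₁, _, e, by rw [e]; rfl⟩

/-- The difference of two points of a Weierstrass curve. -/
theorem IsDiff.ofVec_sub_ofVec [CharZero k] [DecidableEq k] [W.IsElliptic] {A B C : Fin 3 → k} {x y : k}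
    (hA : (ofWeierstrass W).ev A = 0) (hB : (ofWeierstrass W).ev B = 0)
    (hd : A ⬝ᵥ B ⨯₃ C ≠ 0) (h : W.IsDiff A B C x y) (hxy : W.toAffine.Nonsingular x y) :
    W.ofVec A - W.ofVec B = .some x y hxy := by
  have hA0 : A ≠ 0 := by rintro rfl; simp at hd
  have hB0 : B ≠ 0 := by rintro rfl; simp at hd
  have hX0 : ∀ v : Fin 3 → k, (ofWeierstrass W).ev v = 0 → v 2 = 0 → v 0 = 0 := by
    intro v hv hz
    rw [ev_ofWeierstrass, hz] at hv
    exact pow_eq_zero_iff three_ne_zero |>.mp (by linear_combination -hv)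
  have hinf : ∀ v : Fin 3 → k, (ofWeierstrass W).ev v = 0 → v 2 = 0 → v = v 1 • ![0, 1, 0] := by
    intro v hv hz
    ext i; fin_cases i <;> simp [hX0 v hv hz, hz]
  have haff : ∀ v : Fin 3 → k, v 2 ≠ 0 → v = v 2 • ![v 0 / v 2, v 1 / v 2, 1] := by
    intro v hz
    ext i; fin_cases i <;> simp <;> field_simp
  have haff' : ∀ v : Fin 3 → k, (ofWeierstrass W).ev v = 0 → v 2 ≠ 0 →
      (ofWeierstrass W).ev ![v 0 / v 2, v 1 / v 2, 1] = 0 := by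
    intro v hv hz
    rw [haff v hz, TernaryCubic.ev_smul] at hv
    exact (mul_eq_zero.mp hv).resolve_left (pow_ne_zero 3 hz)
  have hO : (ofWeierstrass W).ev ![0, 1, 0] = 0 := by simp [ev_ofWeierstrass]
  by_cases hAz : A 2 = 0
  · have hBz : B 2 ≠ 0 := by
      intro hBz
      apply hd
      rw [hinf A hA hAz, hinf B hB hBz]
      simp [cross_apply, dotProduct, Fin.sum_univ_three]
    have hB' := haff' B hB hBz
    obtain ⟨_, h₂, -, e₂⟩ := exists_some_eq_neg_some hB'
    -- α, β, γ are the coordinates of C in the basis formed by the two normalised points and the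
    -- auxiliary point of the case lemma; the other cases follow the same pattern.
    obtain ⟨hx, hy⟩ := IsDiff.unique hO hB' h (isDiff_zero_left hB') hd (hinf A hA hAz)
      (haff B hBz) (α := C 1 - C 2 * (B 1 / B 2)) (β := C 2) (γ := C 0 - C 2 * (B 0 / B 2))
      (by ext i; fin_cases i <;> simp)
    rw [W.ofVec_of_Z_eq_zero hAz, haff B hBz, W.ofVec_smul _ hBz, zero_sub, e₂]
    exact some_eq_some hx hy
  by_cases hBz : B 2 = 0
  · have hA' := haff' A hA hAz
    obtain ⟨h₁, _, e₁, -⟩ := exists_some_eq_neg_some hA'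
    obtain ⟨hx, hy⟩ := IsDiff.unique hA' hO h (isDiff_zero_right hA') hd (haff A hAz)
      (hinf B hB hBz) (β := C 1 - C 2 * (A 1 / A 2)) (α := C 2) (γ := C 0 - C 2 * (A 0 / A 2))
      (by ext i; fin_cases i <;> simp)
    rw [W.ofVec_of_Z_eq_zero hBz, haff A hAz, W.ofVec_smul _ hAz, sub_zero, e₁]
    exact some_eq_some hx hy
  have hA' := haff' A hA hAz
  have hB' := haff' B hB hBz
  have eA := haff A hAz
  have eB := haff B hBz
  rw [eA, eB, W.ofVec_smul _ hAz, W.ofVec_smul _ hBz]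
  generalize A 0 / A 2 = x₁ at *
  generalize A 1 / A 2 = y₁ at *
  generalize B 0 / B 2 = x₂ at *
  generalize B 1 / B 2 = y₂ at *
  obtain ⟨h₁, _, e₁, -⟩ := exists_some_eq_neg_some hA'
  obtain ⟨_, h₂, -, e₂⟩ := exists_some_eq_neg_some hB'
  rw [sub_eq_add_neg, e₁, e₂]
  by_cases h12 : x₁ = x₂
  · subst h12
    have hy12 : y₁ ≠ y₂ := by
      rintro rfl
      apply hd
      rw [eA, eB]
      simp [cross_apply, dotProduct, Fin.sum_univ_three]
      ring
    have hyy : y₂ = -y₁ - W.a₁ * x₁ - W.a₃ := by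
      rw [ev_ofWeierstrass] at hA' hB'
      simp at hA' hB'
      exact mul_left_cancel₀ (sub_ne_zero.mpr hy12) (by linear_combination hA' - hB')
    have hne : 2 * y₁ + W.a₁ * x₁ + W.a₃ ≠ 0 := fun h0 => hy12 (by
      rw [hyy]; linear_combination h0)
    subst hyy
    obtain ⟨hx, hy⟩ := IsDiff.unique hA' hB' h (isDiff_of_X_eq hA' hne rfl rfl rfl) hd eA
      eB (α := (C 1 - C 2 * (-y₁ - W.a₁ * x₁ - W.a₃)) / (2 * y₁ + W.a₁ * x₁ + W.a₃))
      (β := C 2 - (C 1 - C 2 * (-y₁ - W.a₁ * x₁ - W.a₃)) / (2 * y₁ + W.a₁ * x₁ + W.a₃))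
      (γ := C 0 - C 2 * x₁) (by
        ext i; fin_cases i
        · simp; ring
        · simp
          generalize hM : 2 * y₁ + W.a₁ * x₁ + W.a₃ = M at *
          field_simp
          linear_combination (-(C 2 * (y₁ + W.a₁ * x₁ + W.a₃) + C 1)) * hM
        · simp)
    obtain ⟨h3, e3⟩ := some_add_some (h₁ := h₁) (h₂ := h₂)
      (ℓ := (3 * x₁ ^ 2 + 2 * W.a₂ * x₁ + W.a₄ - W.a₁ * y₁) / (2 * y₁ + W.a₁ * x₁ + W.a₃))
      (fun hh => hne (by linear_combination hh.2)) (Or.inr ⟨rfl, by ring, div_mul_cancel₀ _ hne⟩) rfl rfl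
    rw [e3]
    exact some_eq_some hx hy
  · have hd' : x₁ - x₂ ≠ 0 := sub_ne_zero.mpr h12
    obtain ⟨hx, hy⟩ := IsDiff.unique hA' hB' h (isDiff_of_X_ne hA' hB' h12 rfl rfl rfl) hd eA
      eB (α := (C 0 - C 2 * x₂) / (x₁ - x₂)) (β := C 2 - (C 0 - C 2 * x₂) / (x₁ - x₂))
      (γ := C 1 - (C 0 - C 2 * x₂) / (x₁ - x₂) * y₁
        - (C 2 - (C 0 - C 2 * x₂) / (x₁ - x₂)) * y₂) (by
        ext i; fin_cases i
        · simp; field_simp; ring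
        · simp
        · simp)
    obtain ⟨h3, e3⟩ := some_add_some (h₁ := h₁) (h₂ := h₂)
      (ℓ := (y₁ + y₂ + W.a₁ * x₂ + W.a₃) / (x₁ - x₂)) (fun hh => h12 hh.1)
      (Or.inl ⟨h12, by field_simp; ring⟩) rfl rfl
    rw [e3]
    exact some_eq_some hx hy

end WeierstrassCurve

/-! ### The relations of `A_F` and the characteristic polynomial -/

namespace TernaryCubic
variable {k : Type*} [Field k]

/-- The ternary cubic `det(x N₀ + y N₁ + z N₂)`. -/
def ofSlices (N : Fin 3 → Matrix (Fin 3) (Fin 3) k) : TernaryCubic k :=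
  let D (i j l : Fin 3) : k := (Matrix.of ![N i 0, N j 1, N l 2]).det
  { a := D 0 0 0
    b := D 1 1 1
    c := D 2 2 2
    a2 := D 0 0 1 + D 0 1 0 + D 1 0 0
    a3 := D 0 0 2 + D 0 2 0 + D 2 0 0
    b1 := D 0 1 1 + D 1 0 1 + D 1 1 0
    b3 := D 1 1 2 + D 1 2 1 + D 2 1 1
    c1 := D 0 2 2 + D 2 0 2 + D 2 2 0
    c2 := D 1 2 2 + D 2 1 2 + D 2 2 1
    m := D 0 1 2 + D 0 2 1 + D 1 0 2 + D 1 2 0 + D 2 0 1 + D 2 1 0 }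

lemma ev_ofSlices (N : Fin 3 → Matrix (Fin 3) (Fin 3) k) (v : Fin 3 → k) :
    (ofSlices N).ev v = (∑ j, v j • N j).det := by
  simp [ev, ofSlices, Matrix.det_fin_three, Fin.sum_univ_three]
  ring

lemma slice₁_eq_poly [CharZero k] (N : Fin 3 → Matrix (Fin 3) (Fin 3) k) :
    PlaneCubic.slice₁ N = (ofSlices N).poly := by
  refine MvPolynomial.funext fun v => ?_
  rw [eval_poly, ev_ofSlices, PlaneCubic.slice₁, RingHom.map_det]
  congr 1
  ext i l
  simp [Fin.sum_univ_three, mul_comm]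

/-- The values of a ternary cubic on an affine chart determine it. -/
lemma ext_of_ev_one [CharZero k] {F G : TernaryCubic k}
    (h : ∀ t z, F.ev ![1, t, z] = G.ev ![1, t, z]) : F = G := by
  have h1 (t : k) := WeierstrassCurve.coeff_eq_zero_of_forall_cubic (k := k)
    (e₀ := (F.a - G.a) + (F.a2 - G.a2) * t + (F.b1 - G.b1) * t ^ 2 + (F.b - G.b) * t ^ 3)
    (e₁ := (F.a3 - G.a3) + (F.m - G.m) * t + (F.b3 - G.b3) * t ^ 2)
    (e₂ := (F.c1 - G.c1) + (F.c2 - G.c2) * t) (e₃ := F.c - G.c) fun z => by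
      have := h t z
      simp [ev] at this
      linear_combination this
  obtain ⟨a1, a2, a3, a4⟩ := WeierstrassCurve.coeff_eq_zero_of_forall_cubic fun t => (h1 t).1
  obtain ⟨b1, b2, b3, -⟩ := WeierstrassCurve.coeff_eq_zero_of_forall_cubic (k := k) (e₃ := 0)
    fun t => by simpa using (h1 t).2.1
  obtain ⟨c1, c2, -, -⟩ := WeierstrassCurve.coeff_eq_zero_of_forall_cubic (k := k) (e₃ := 0)
    (e₂ := 0) fun t => by simpa using (h1 t).2.2.1
  have d := (h1 0).2.2.2
  rw [sub_eq_zero] at a1 a2 a3 a4 b1 b2 b3 c1 c2 d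
  cases F; cases G; simp_all

open Polynomial

/-- The monic cubic polynomial `F(1, t, Z) / c` over `k[t]`. -/
noncomputable def chart (F : TernaryCubic k) : k[X][X] :=
  X ^ 3 + C (C F.c⁻¹ * (C F.c1 + C F.c2 * X)) * X ^ 2
    + C (C F.c⁻¹ * (C F.a3 + C F.m * X + C F.b3 * X ^ 2)) * X
    + C (C F.c⁻¹ * (C F.a + C F.a2 * X + C F.b1 * X ^ 2 + C F.b * X ^ 3))

lemma chart_eq_toPoly (F : TernaryCubic k) : F.chart = Cubic.toPoly
    ⟨1, C F.c⁻¹ * (C F.c1 + C F.c2 * X), C F.c⁻¹ * (C F.a3 + C F.m * X + C F.b3 * X ^ 2),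
      C F.c⁻¹ * (C F.a + C F.a2 * X + C F.b1 * X ^ 2 + C F.b * X ^ 3)⟩ := by
  simp [chart, Cubic.toPoly]

lemma monic_chart (F : TernaryCubic k) : F.chart.Monic := by
  rw [chart_eq_toPoly]; exact Cubic.monic_of_a_eq_one'

lemma natDegree_chart (F : TernaryCubic k) : F.chart.natDegree = 3 := by
  rw [chart_eq_toPoly]; exact Cubic.natDegree_of_a_ne_zero' one_ne_zero

lemma eval_eval_chart {F : TernaryCubic k} (hc : F.c ≠ 0) (t z : k) :
    F.c * (F.chart.eval (C z)).eval t = F.ev ![1, t, z] := by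
  simp [chart, ev]
  field_simp
  ring

/-- A root in `k[t]` of the chart of a non-singular cubic would be linear, so that the cubic would
contain a line. -/
lemma Nonsingular.irreducible_chart [IsAlgClosed k] [CharZero k] {F : TernaryCubic k}
    (hF : F.Nonsingular) (hc : F.c ≠ 0) : Irreducible F.chart := by
  rw [F.monic_chart.irreducible_iff_roots_eq_zero_of_degree_le_three
    (by rw [natDegree_chart]; norm_num) (by rw [natDegree_chart]), Multiset.eq_zero_iff_forall_notMem]
  intro l hl
  rw [mem_roots F.monic_chart.ne_zero, IsRoot.def] at hl
  -- For deg l = d ≥ 2 the term l³ has degree 3d, above the bounds 1 + 2d, 2 + d and 3 for the other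
  -- terms.
  have hdeg : l.natDegree ≤ 1 := by
    by_contra! hd
    have hl0 : l ≠ 0 := by rintro rfl; simp at hd
    have e : l ^ 3 = -(C F.c⁻¹ * (C F.c1 + C F.c2 * X)) * l ^ 2
        - (C F.c⁻¹ * (C F.a3 + C F.m * X + C F.b3 * X ^ 2)) * l
        - C F.c⁻¹ * (C F.a + C F.a2 * X + C F.b1 * X ^ 2 + C F.b * X ^ 3) := by
      simp [chart] at hl
      linear_combination hl
    have h3 : (l ^ 3).natDegree = 3 * l.natDegree := natDegree_pow _ _
    have d1 : (-(C F.c⁻¹ * (C F.c1 + C F.c2 * X)) * l ^ 2).natDegree ≤ 1 + 2 * l.natDegree := by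
      refine natDegree_mul_le.trans (add_le_add ?_ natDegree_pow_le)
      rw [natDegree_neg]
      compute_degree
    have d2 : ((C F.c⁻¹ * (C F.a3 + C F.m * X + C F.b3 * X ^ 2)) * l).natDegree ≤
        2 + l.natDegree := by
      refine natDegree_mul_le.trans (add_le_add ?_ le_rfl)
      compute_degree
    have d3 : (C F.c⁻¹ * (C F.a + C F.a2 * X + C F.b1 * X ^ 2 + C F.b * X ^ 3)).natDegree
        ≤ 3 := by compute_degree
    rw [e] at h3
    have := (natDegree_sub_le_of_le (natDegree_sub_le_of_le d1 d2) d3)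
    rw [h3] at this
    omega
  obtain ⟨q, p, rfl⟩ := exists_eq_X_add_C_of_natDegree_le_one hdeg
  have hind : LinearIndependent k ![![1, 0, p], ![0, 1, q]] := by
    rw [LinearIndependent.pair_iff]
    intro s t hst
    exact ⟨by simpa using congrFun hst 0, by simpa using congrFun hst 1⟩
  -- A linear root l = qt + p makes F vanish on the line through (1, 0, p) and (0, 1, q). Taking 0
  -- as third vector expresses the restriction as a ternary cubic.
  have hG : F.subst ![1, 0, p] ![0, 1, q] 0 = (F.scale 0) := ext_of_ev_one fun t z => by
    rw [ev_subst, ev_scale, zero_mul]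
    have := congrArg (eval t) hl
    have e2 := eval_eval_chart hc t (q * t + p)
    have e3 : (F.chart.eval (C q * X + C p)).eval t = (F.chart.eval (C (q * t + p))).eval t := by
      simp [chart]
    rw [← e3, this] at e2
    simp at e2 ⊢
    rw [show p + t * q = q * t + p by ring, ← e2]
  obtain ⟨s, t, hst⟩ := hF.exists_ev_line_ne_zero hind
  have := congrArg (fun G => G.ev ![s, t, 0]) hG
  simp only [ev_subst, ev_scale] at this
  apply hst
  simpa using this

/-- The variable t is central, so c times the chart at M₁ + tM₂ expands in powers of t, and its
coefficient at tⁱ is the i-th relator. -/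
lemma aeval_chart {F : TernaryCubic k} (hc : F.c ≠ 0) {M₁ M₂ : Matrix (Fin 3) (Fin 3) k}
    (hM : ∀ i, F.relator M₁ M₂ i = 0) :
    aeval ((C : k →+* k[X]).mapMatrix M₁ + (X : k[X]) • (C : k →+* k[X]).mapMatrix M₂)
      F.chart = 0 := by
  have hs (a : k) (M : Matrix (Fin 3) (Fin 3) k) : (C : k →+* k[X]).mapMatrix (a • M) =
      C a • (C : k →+* k[X]).mapMatrix M := by ext; simp
  have ha (a : k) : (C : k →+* k[X]).mapMatrix (algebraMap k (Matrix (Fin 3) (Fin 3) k) a) =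
      C a • 1 := by rw [Algebra.algebraMap_eq_smul_one, hs, map_one]
  have hmap (i : Fin 4) := congrArg (C : k →+* k[X]).mapMatrix (hM i)
  have r0 := hmap 0
  have r1 := hmap 1
  have r2 := hmap 2
  have r3 := hmap 3
  simp only [relator, Matrix.cons_val_zero, Matrix.cons_val_one, Matrix.cons_val, map_add, hs, ha,
    map_mul, map_pow, map_zero] at r0 r1 r2 r3
  have hcc : C F.c * C F.c⁻¹ = 1 := by rw [← C_mul, mul_inv_cancel₀ hc, C_1]
  have hcc' (q : k[X]) (M : Matrix (Fin 3) (Fin 3) k[X]) : C F.c • (C F.c⁻¹ * q) • M = q • M := by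
    rw [smul_smul, ← mul_assoc, hcc, one_mul]
  suffices h : C F.c • aeval ((C : k →+* k[X]).mapMatrix M₁
      + (X : k[X]) • (C : k →+* k[X]).mapMatrix M₂) F.chart = 0 from
    (smul_eq_zero.mp h).resolve_left (C_ne_zero.mpr hc)
  have hexp (A : Matrix (Fin 3) (Fin 3) k[X]) (q₀ q₁ q₂ : k[X]) :
      aeval A (X ^ 3 + C q₂ * X ^ 2 + C q₁ * X + C q₀) =
        A ^ 3 + q₂ • A ^ 2 + q₁ • A + q₀ • 1 := by
    simp [Algebra.smul_def]
  rw [chart, hexp]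
  simp only [smul_add, hcc']
  generalize (C : k →+* k[X]).mapMatrix M₁ = α at *
  generalize (C : k →+* k[X]).mapMatrix M₂ = β at *
  refine Eq.trans ?_ (congrArg₂ (· + ·) (congrArg₂ (· + ·) r0 (congrArg ((X : k[X]) • ·) r1))
    (congrArg₂ (· + ·) (congrArg ((X ^ 2 : k[X]) • ·) r2)
      (congrArg ((X ^ 3 : k[X]) • ·) r3)) |>.trans ?_)
  · simp only [pow_succ, pow_zero, one_mul, mul_add, add_mul, smul_mul_assoc, mul_smul_comm,
      mul_assoc]
    module
  · simp

end TernaryCubic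

/-- A matrix is annihilated by an irreducible monic polynomial of the right degree only if this is
its characteristic polynomial. -/
lemma Matrix.charpoly_eq_of_irreducible {R n : Type*} [CommRing R] [IsDomain R]
    [IsIntegrallyClosed R] [Fintype n] [DecidableEq n] [Nonempty n] {A : Matrix n n R}
    {p : Polynomial R}
    (hp : p.Monic) (hirr : Irreducible p) (hdeg : p.natDegree = Fintype.card n)
    (hA : Polynomial.aeval A p = 0) : A.charpoly = p := by
  let f := algebraMap R (FractionRing R)
  -- By Gauss's lemma p stays irreducible over the fraction field, so it is the minimal polynomial
  -- of A there; it divides the characteristic polynomial, which is monic of the same degree.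
  have hirr' : Irreducible (p.map f) :=
    (hp.irreducible_iff_irreducible_map_fraction_map (K := FractionRing R)).mp hirr
  have hmin : p.map f = minpoly (FractionRing R) (A.map f) := by
    refine minpoly.eq_of_irreducible_of_monic hirr' ?_ (hp.map f)
    have h := Polynomial.map_aeval_eq_aeval_map (φ := f) (ψ := f.mapMatrix) (by
      ext r i j
      simp [Matrix.algebraMap_matrix_apply]
      split_ifs <;> simp [f]) p A
    rw [hA, map_zero] at h
    exact h.symm
  have hdvd : p.map f ∣ A.charpoly.map f := by
    rw [hmin, ← Matrix.charpoly_map]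
    exact Matrix.minpoly_dvd_charpoly _
  apply Polynomial.map_injective f (IsFractionRing.injective R (FractionRing R))
  refine Polynomial.eq_of_monic_of_dvd_of_natDegree_le (hp.map f)
    ((Matrix.charpoly_monic A).map f) hdvd ?_
  rw [(Matrix.charpoly_monic A).natDegree_map, hp.natDegree_map, hdeg,
    Matrix.charpoly_natDegree_eq_dim]

namespace TernaryCubic
open Polynomial
variable {k : Type*} [Field k]

/-- The defining relations of `A_F` say that `F / c` is the characteristic polynomial. -/
theorem Nonsingular.eq_scale_ofSlices [IsAlgClosed k] [CharZero k] {F : TernaryCubic k}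
    (hF : F.Nonsingular) (hc : F.c ≠ 0) {M₁ M₂ : Matrix (Fin 3) (Fin 3) k}
    (hM : ∀ i, F.relator M₁ M₂ i = 0) : F = (ofSlices ![M₁, M₂, -1]).scale (-F.c) := by
  have hchar := Matrix.charpoly_eq_of_irreducible F.monic_chart (hF.irreducible_chart hc)
    (by rw [natDegree_chart, Fintype.card_fin]) (aeval_chart hc hM)
  refine ext_of_ev_one fun t z => ?_
  rw [← eval_eval_chart hc, ← hchar, ev_scale, ev_ofSlices]
  -- The third slice is -1, so the matrix is the negative of z - (M₁ + tM₂); in odd dimension the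
  -- determinant changes sign, whence the factor -c.
  have h1 : ((∑ j, ![1, t, z] j • ![M₁, M₂, -1] j) : Matrix (Fin 3) (Fin 3) k) =
      -(z • 1 - (M₁ + t • M₂)) := by
    simp [Fin.sum_univ_three]
    abel
  rw [h1, Matrix.det_neg, Fintype.card_fin]
  have h2 : (Matrix.charpoly ((C : k →+* k[X]).mapMatrix M₁
      + (X : k[X]) • (C : k →+* k[X]).mapMatrix M₂)).map (evalRingHom t) =
      (M₁ + t • M₂).charpoly := by
    rw [← Matrix.charpoly_map]
    congr 1
    ext i j
    simp only [Matrix.map_apply, Matrix.add_apply, Matrix.smul_apply, RingHom.mapMatrix_apply,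
      smul_eq_mul, coe_evalRingHom, eval_add, eval_mul, eval_C, eval_X]
  have h3 : ∀ p : k[X][X], (p.eval (C z)).eval t = (p.map (evalRingHom t)).eval z :=
    fun p => (map_evalRingHom_eval t z p).symm
  rw [h3, h2, Matrix.eval_charpoly]
  simp [Matrix.smul_one_eq_diagonal, Matrix.scalar_apply]
  ring

end TernaryCubic

/-! ### Linear algebra in three dimensions by vector products -/

section CrossProduct
variable {k : Type*} [Field k]

lemma exists_eq_smul_crossProduct {a b v : Fin 3 → k} (hab : a ⨯₃ b ≠ 0) (ha : a ⬝ᵥ v = 0)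
    (hb : b ⬝ᵥ v = 0) : ∃ t : k, v = t • (a ⨯₃ b) := by
  have h : ¬ LinearIndependent k ![a ⨯₃ b, v] := by
    rw [← crossProduct_ne_zero_iff_linearIndependent, not_not, cross_cross_eq_smul_sub_smul, ha, hb]
    simp
  rw [LinearIndependent.pair_iff' hab] at h
  push Not at h
  obtain ⟨t, ht⟩ := h
  exact ⟨t, ht.symm⟩

/-- Cramer's rule for the coordinates of x in terms of a, b, m, with the denominator cleared so that
no independence is needed. -/
lemma dotProduct_crossProduct_smul (a b m x : Fin 3 → k) : (m ⬝ᵥ a ⨯₃ b) • x =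
    (x ⬝ᵥ b ⨯₃ m) • a + (x ⬝ᵥ m ⨯₃ a) • b + (x ⬝ᵥ a ⨯₃ b) • m := by
  ext i
  fin_cases i <;> simp [cross_apply, dotProduct, Fin.sum_univ_three] <;> ring

lemma exists_eq_smul_add_smul {a b x : Fin 3 → k} (hab : a ⨯₃ b ≠ 0) (hx : x ⬝ᵥ a ⨯₃ b = 0) :
    ∃ s t : k, x = s • a + t • b := by
  obtain ⟨m, hm⟩ := exists_dotProduct_eq hab 1
  rw [dotProduct_comm] at hm
  have := dotProduct_crossProduct_smul a b m x
  rw [hm, hx, one_smul, zero_smul, add_zero] at this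
  exact ⟨_, _, this⟩

/-- A line in the projective plane has a basis. -/
lemma exists_line_basis {L : Fin 3 → k} (hL : L ≠ 0) : ∃ p q : Fin 3 → k,
    LinearIndependent k ![p, q] ∧ L ⬝ᵥ p = 0 ∧ L ⬝ᵥ q = 0 := by
  have key : ∃ m n : Fin 3 → k, L ⬝ᵥ (m ⨯₃ n) ≠ 0 := by
    by_contra! h
    apply hL
    have h0 := h ![0, 1, 0] ![0, 0, 1]
    have h1 := h ![0, 0, 1] ![1, 0, 0]
    have h2 := h ![1, 0, 0] ![0, 1, 0]
    simp [cross_apply, dotProduct, Fin.sum_univ_three] at h0 h1 h2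
    ext i
    fin_cases i <;> assumption
  obtain ⟨m, n, hmn⟩ := key
  refine ⟨L ⨯₃ m, L ⨯₃ n, ?_, dot_self_cross _ _, dot_self_cross _ _⟩
  rw [← crossProduct_ne_zero_iff_linearIndependent]
  have : L ⨯₃ m ⨯₃ (L ⨯₃ n) = (L ⬝ᵥ m ⨯₃ n) • L := by
    ext i
    fin_cases i <;> simp [cross_apply, dotProduct, Fin.sum_univ_three] <;> ring
  rw [this]
  exact smul_ne_zero hmn hL

lemma exists_eq_of_dotProduct_eq_zero {L p q x : Fin 3 → k} (hL : L ≠ 0)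
    (hpq : LinearIndependent k ![p, q]) (hp : L ⬝ᵥ p = 0) (hq : L ⬝ᵥ q = 0) (hx : L ⬝ᵥ x = 0) :
    ∃ s t : k, x = s • p + t • q := by
  have hc := crossProduct_ne_zero_iff_linearIndependent.mpr hpq
  obtain ⟨t, rfl⟩ := exists_eq_smul_crossProduct hc ((dotProduct_comm _ _).trans hp)
    ((dotProduct_comm _ _).trans hq)
  refine exists_eq_smul_add_smul hc ?_
  rw [smul_dotProduct, smul_eq_zero] at hx
  rw [dotProduct_comm]
  exact hx.resolve_left (by rintro rfl; simp at hL)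

lemma LinearIndependent.exists_pair_of_ne_zero {L p q x : Fin 3 → k} (hL : L ≠ 0)
    (hp : L ⬝ᵥ p = 0) (hq : L ⬝ᵥ q = 0) (hpq : LinearIndependent k ![p, q]) (hx : L ⬝ᵥ x = 0)
    (hx0 : x ≠ 0) : ∃ y : Fin 3 → k, L ⬝ᵥ y = 0 ∧ LinearIndependent k ![x, y] := by
  obtain ⟨s, t, rfl⟩ := exists_eq_of_dotProduct_eq_zero hL hpq hp hq hx
  have hc := crossProduct_ne_zero_iff_linearIndependent.mpr hpq
  by_cases hs : s = 0
  · refine ⟨p, hp, ?_⟩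
    rw [← crossProduct_ne_zero_iff_linearIndependent]
    have ht : t ≠ 0 := by rintro rfl; simp [hs] at hx0
    rw [hs, zero_smul, zero_add, ← cross_anticomm, neg_ne_zero, map_smul]
    exact smul_ne_zero ht hc
  · refine ⟨q, hq, ?_⟩
    rw [← crossProduct_ne_zero_iff_linearIndependent]
    simpa [hs] using hc

/-- The vector products of the rows of a `3 × 3` matrix, that is, the columns of its adjugate. -/
def crossRows (A : Matrix (Fin 3) (Fin 3) k) (i : Fin 3) : Fin 3 → k := A (i + 1) ⨯₃ A (i + 2)

lemma mulVec_crossRows (A : Matrix (Fin 3) (Fin 3) k) (i : Fin 3) :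
    A *ᵥ crossRows A i = A.det • Pi.single i 1 := by
  ext j
  fin_cases i <;> fin_cases j <;>
    simp [crossRows, Matrix.det_fin_three, cross_apply, Matrix.mulVec, dotProduct,
      Fin.sum_univ_three] <;> ring

lemma sum_crossRows_mul (A : Matrix (Fin 3) (Fin 3) k) (l m : Fin 3) :
    ∑ i, crossRows A i m * A i l = if l = m then A.det else 0 := by
  fin_cases l <;> fin_cases m <;>
    simp [crossRows, Matrix.det_fin_three, cross_apply, Fin.sum_univ_three] <;> ring

lemma exists_eq_smul_crossRows {A : Matrix (Fin 3) (Fin 3) k} {v : Fin 3 → k} {i : Fin 3}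
    (hi : crossRows A i ≠ 0) (hv : A *ᵥ v = 0) : ∃ t : k, v = t • crossRows A i :=
  exists_eq_smul_crossProduct hi (congrFun hv (i + 1)) (congrFun hv (i + 2))

/-- The adjugate of a matrix of corank one is the product of a column and a row. -/
lemma exists_crossRows_eq_smul {A : Matrix (Fin 3) (Fin 3) k} {v : Fin 3 → k} (hv0 : v ≠ 0)
    (hv : A *ᵥ v = 0) (hA : ∃ i, crossRows A i ≠ 0) :
    ∃ κ : Fin 3 → k, κ ≠ 0 ∧ (∀ i, crossRows A i = κ i • v) ∧ κ ᵥ* A = 0 := by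
  obtain ⟨i, hi⟩ := hA
  have hdet : A.det = 0 := Matrix.exists_mulVec_eq_zero_iff.mp ⟨v, hv0, hv⟩
  obtain ⟨t, ht⟩ := exists_eq_smul_crossRows hi hv
  have ht0 : t ≠ 0 := by rintro rfl; simp at ht; exact hv0 ht
  have key : ∀ j, ∃ c : k, crossRows A j = c • v := by
    intro j
    obtain ⟨c, hc⟩ := exists_eq_smul_crossRows (v := crossRows A j) hi
      (by rw [mulVec_crossRows, hdet, zero_smul])
    exact ⟨c / t, by rw [hc, ht, smul_smul, div_mul_cancel₀ _ ht0]⟩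
  choose κ hκ using key
  refine ⟨κ, ?_, hκ, ?_⟩
  · rintro rfl
    apply hi
    rw [hκ]; simp
  -- The determinant is zero, so adj(A) A = 0; its row m, for a coordinate with v m ≠ 0, says that κ
  -- annihilates A from the left.
  · obtain ⟨m, hm⟩ := Function.ne_iff.mp hv0
    ext l
    have := sum_crossRows_mul A l m
    simp only [hκ, hdet, ite_self, Pi.smul_apply, smul_eq_mul] at this
    apply mul_left_cancel₀ (show v m ≠ 0 from hm)
    rw [Matrix.vecMul, dotProduct, Finset.mul_sum, Pi.zero_apply, mul_zero, ← this]
    exact Finset.sum_congr rfl fun i _ => by ring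

/-- If the rows of a matrix are pairwise parallel, its kernel contains a plane. -/
lemma exists_plane_of_crossRows_eq_zero {A : Matrix (Fin 3) (Fin 3) k}
    (hA : ∀ i, crossRows A i = 0) : ∃ p q : Fin 3 → k, LinearIndependent k ![p, q] ∧
      ∀ s t : k, A *ᵥ (s • p + t • q) = 0 := by
  obtain ⟨σ, hσ0, hσ⟩ : ∃ σ : Fin 3 → k, σ ≠ 0 ∧ ∀ i, ∃ c : k, A i = c • σ := by
    by_cases h : ∀ i, A i = 0
    · exact ⟨![1, 0, 0], fun h => one_ne_zero (congrFun h 0), fun i => ⟨0, by rw [h]; simp⟩⟩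
    · push Not at h
      obtain ⟨j, hj⟩ := h
      refine ⟨A j, hj, fun i => ?_⟩
      have hz : A j ⨯₃ A i = 0 := by
        have h0 := hA 0
        have h1 := hA 1
        have h2 := hA 2
        simp only [crossRows] at h0 h1 h2
        fin_cases i <;> fin_cases j <;>
          first
          | exact cross_self _
          | assumption
          | (rw [← cross_anticomm, neg_eq_zero]; assumption)
      have := (not_iff_not.mpr crossProduct_ne_zero_iff_linearIndependent).mp (not_not.mpr hz)
      rw [LinearIndependent.pair_iff' hj] at this
      push Not at this
      obtain ⟨c, hc⟩ := this
      exact ⟨c, hc.symm⟩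
  obtain ⟨p, q, hpq, hp, hq⟩ := exists_line_basis hσ0
  refine ⟨p, q, hpq, fun s t => ?_⟩
  ext i
  obtain ⟨c, hc⟩ := hσ i
  rw [Matrix.mulVec, hc, smul_dotProduct, dotProduct_add, dotProduct_smul, dotProduct_smul, hp, hq]
  simp

end CrossProduct

/-! ### Determinantal cubics: corank one, transversality, the second cubic -/

namespace TernaryCubic
variable {k : Type*} [Field k] {N : Fin 3 → Matrix (Fin 3) (Fin 3) k}

/-- The matrix `u₀ N₀ + u₁ N₁ + u₂ N₂` of a cube. -/
def pencil (N : Fin 3 → Matrix (Fin 3) (Fin 3) k) (u : Fin 3 → k) : Matrix (Fin 3) (Fin 3) k :=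
  ∑ j, u j • N j

/-- The cube with its two factors interchanged. -/
def swap (N : Fin 3 → Matrix (Fin 3) (Fin 3) k) (l : Fin 3) : Matrix (Fin 3) (Fin 3) k :=
  Matrix.of fun i j => N j i l

/-- The cube with transposed slices. -/
def transposed (N : Fin 3 → Matrix (Fin 3) (Fin 3) k) (j : Fin 3) : Matrix (Fin 3) (Fin 3) k :=
  (N j)ᵀ

lemma ev_ofSlices' (u : Fin 3 → k) : (ofSlices N).ev u = (pencil N u).det := ev_ofSlices N u

lemma pencil_swap_mulVec (u v : Fin 3 → k) : pencil (swap N) v *ᵥ u = pencil N u *ᵥ v := by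
  ext i
  simp [pencil, swap, Matrix.mulVec, dotProduct, Fin.sum_univ_three]
  ring

lemma pencil_add_smul (s t : k) (p q : Fin 3 → k) :
    pencil N (s • p + t • q) = s • pencil N p + t • pencil N q := by
  simp only [pencil, Finset.smul_sum, ← Finset.sum_add_distrib]
  exact Finset.sum_congr rfl fun i _ => by simp [add_smul, mul_smul]

lemma pencil_smul (s : k) (p : Fin 3 → k) : pencil N (s • p) = s • pencil N p := by
  simp only [pencil, Finset.smul_sum]
  exact Finset.sum_congr rfl fun i _ => by simp [mul_smul]

lemma form_eq (i : Fin 3) (u v : Fin 3 → k) :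
    PlaneCubic.form N i u v = (pencil N u *ᵥ v) i := by
  simp [PlaneCubic.form, pencil, Matrix.mulVec, dotProduct, Fin.sum_univ_three]
  ring

lemma slice₂_eq_slice₁ : PlaneCubic.slice₂ N = PlaneCubic.slice₁ (swap N) := rfl

lemma ofSlices_transposed [CharZero k] : ofSlices (transposed N) = ofSlices N :=
  ext_of_ev fun v => by
    rw [ev_ofSlices, ev_ofSlices, ← Matrix.det_transpose]
    simp [transposed, Matrix.transpose_sum]

lemma pencil_transposed (u : Fin 3 → k) : pencil (transposed N) u = (pencil N u)ᵀ := by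
  simp [pencil, transposed, Matrix.transpose_sum]

/-- Jacobi's formula: the derivative of the determinant in direction r is the trace of adj(N_u) N_r.
-/
lemma gradient_ofSlices (u r : Fin 3 → k) : (ofSlices N).gradient u ⬝ᵥ r =
    ∑ i, pencil N r i ⬝ᵥ crossRows (pencil N u) i := by
  simp [gradient, ofSlices, crossRows, pencil, cross_apply, dotProduct, Fin.sum_univ_three,
    Matrix.det_fin_three]
  ring

/-- With the adjugate of rank one, v κᵀ, the trace becomes κ N_r v. This links singular points of
the cubic with failure of transversality. -/
lemma gradient_ofSlices_of_eq_smul {u v κ : Fin 3 → k}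
    (h : ∀ i, crossRows (pencil N u) i = κ i • v) (r : Fin 3 → k) :
    (ofSlices N).gradient u ⬝ᵥ r = κ ⬝ᵥ pencil N r *ᵥ v := by
  rw [gradient_ofSlices, dotProduct]
  exact Finset.sum_congr rfl fun i _ => by rw [h, dotProduct_smul, smul_eq_mul]; rfl

lemma eq_zero_of_forall_dotProduct {v : Fin 3 → k} (h : ∀ r, v ⬝ᵥ r = 0) : v = 0 := by
  ext i
  simpa using h (Pi.single i 1)

/-- On a non-singular determinantal cubic the matrix has corank one. -/
lemma Nonsingular.exists_crossRows_ne_zero (hN : (ofSlices N).Nonsingular) {u : Fin 3 → k}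
    (hu : u ≠ 0) (h0 : (ofSlices N).ev u = 0) : ∃ i, crossRows (pencil N u) i ≠ 0 := by
  by_contra! h
  refine hu (hN u h0 (eq_zero_of_forall_dotProduct fun r => ?_))
  rw [gradient_ofSlices]
  simp [h]

lemma Nonsingular.exists_eq_smul (hN : (ofSlices N).Nonsingular) {u v v' : Fin 3 → k}
    (hu : u ≠ 0) (hv0 : v ≠ 0) (hv'0 : v' ≠ 0) (hv : pencil N u *ᵥ v = 0)
    (hv' : pencil N u *ᵥ v' = 0) : ∃ c : k, c ≠ 0 ∧ v' = c • v := by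
  have h0 : (ofSlices N).ev u = 0 := by
    rw [ev_ofSlices']; exact Matrix.exists_mulVec_eq_zero_iff.mp ⟨v, hv0, hv⟩
  obtain ⟨i, hi⟩ := hN.exists_crossRows_ne_zero hu h0
  obtain ⟨t, ht⟩ := exists_eq_smul_crossRows hi hv
  obtain ⟨t', ht'⟩ := exists_eq_smul_crossRows hi hv'
  have ht0 : t ≠ 0 := by rintro rfl; simp at ht; exact hv0 ht
  have ht'0 : t' ≠ 0 := by rintro rfl; simp at ht'; exact hv'0 ht'
  exact ⟨t' / t, div_ne_zero ht'0 ht0, by rw [ht', ht, smul_smul, div_mul_cancel₀ _ ht0]⟩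

/-- Transversality of the three bilinear forms of a cube. -/
lemma Nonsingular.exists_dotProduct_ne_zero [CharZero k] (hN : (ofSlices N).Nonsingular)
    {u v w : Fin 3 → k}
    (hu : u ≠ 0) (hv0 : v ≠ 0) (hv : pencil N u *ᵥ v = 0) (hw0 : w ≠ 0) (hw : w ᵥ* pencil N u = 0) :
    ∃ r, w ⬝ᵥ pencil N r *ᵥ v ≠ 0 := by
  by_contra! h
  have h0 : (ofSlices N).ev u = 0 := by
    rw [ev_ofSlices']; exact Matrix.exists_mulVec_eq_zero_iff.mp ⟨v, hv0, hv⟩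
  obtain ⟨κ, hκ0, hκ, hκ'⟩ :=
    exists_crossRows_eq_smul hv0 hv (hN.exists_crossRows_ne_zero hu h0)
  have hN' : (ofSlices (transposed N)).Nonsingular := by rwa [ofSlices_transposed]
  -- The transposed cube has the same determinant, so the left kernel is one-dimensional too, and κ
  -- is a multiple of w.
  obtain ⟨c, -, rfl⟩ := hN'.exists_eq_smul hu hw0 hκ0
    (by rwa [pencil_transposed, Matrix.mulVec_transpose])
    (by rwa [pencil_transposed, Matrix.mulVec_transpose])
  refine hu (hN u h0 (eq_zero_of_forall_dotProduct fun r => ?_))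
  rw [gradient_ofSlices_of_eq_smul hκ, smul_dotProduct, h, smul_zero]

/-- The second plane cubic of a cube is non-singular if the first one is. -/
lemma Nonsingular.swap [IsAlgClosed k] [CharZero k] (hN : (ofSlices N).Nonsingular) :
    (ofSlices (swap N)).Nonsingular := by
  intro v h0 hgrad
  by_contra hv0
  have hdet := h0
  rw [ev_ofSlices'] at hdet
  obtain ⟨u, hu0, hu⟩ := Matrix.exists_mulVec_eq_zero_iff.mpr hdet
  -- If the swapped matrix at v has corank at least two, the solutions u of N_u v = 0 contain a
  -- plane, and the first cubic contains a line.
  by_cases hc : ∀ i, crossRows (pencil (TernaryCubic.swap N) v) i = 0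
  · obtain ⟨p, q, hpq, hker⟩ := exists_plane_of_crossRows_eq_zero hc
    obtain ⟨s, t, hst⟩ := hN.exists_ev_line_ne_zero hpq
    apply hst
    have := hker s t
    rw [pencil_swap_mulVec] at this
    rw [ev_ofSlices']
    exact Matrix.exists_mulVec_eq_zero_iff.mp ⟨v, hv0, this⟩
  · push Not at hc
    obtain ⟨κ, hκ0, hκ, hκ'⟩ := exists_crossRows_eq_smul hu0 hu hc
    rw [pencil_swap_mulVec] at hu
    -- In corank one the vanishing gradient says κ N_u = 0, while κ N_r v = 0 for all r because κ is
    -- a left kernel vector of the swapped matrix. This contradicts transversality at (u, v).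
    obtain ⟨r, hr⟩ := hN.exists_dotProduct_ne_zero hu0 hv0 hu hκ0 (by
      refine eq_zero_of_forall_dotProduct fun r => ?_
      rw [← Matrix.dotProduct_mulVec, ← pencil_swap_mulVec, ← gradient_ofSlices_of_eq_smul hκ,
        hgrad, zero_dotProduct])
    apply hr
    rw [← pencil_swap_mulVec, Matrix.dotProduct_mulVec, hκ', zero_dotProduct]

end TernaryCubic

/-! ### Regular maps: the linear isomorphism, the two projections, the genus one curve -/

namespace TernaryCubic
open PlaneCubic
variable {k : Type*} [Field k]

/-- The linear forms given by the rows of a matrix. -/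
noncomputable def linearForms (g : Matrix (Fin 3) (Fin 3) k) (i : Fin 3) : MvPolynomial (Fin 3) k :=
  ∑ j, MvPolynomial.C (g i j) * MvPolynomial.X j

lemma evalTriple_linearForms (g : Matrix (Fin 3) (Fin 3) k) (q : Fin 3 → k) :
    evalTriple (linearForms g) q = g *ᵥ q := by
  ext i
  simp [evalTriple, linearForms, Matrix.mulVec, dotProduct]

lemma derivTriple_linearForms (g : Matrix (Fin 3) (Fin 3) k) (q v : Fin 3 → k) :
    derivTriple (linearForms g) q v = g *ᵥ v := by
  ext i
  simp [derivTriple, linearForms, Matrix.mulVec, dotProduct, MvPolynomial.pderiv_X, Pi.single_apply]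

lemma isHomogeneous_linearForms (g : Matrix (Fin 3) (Fin 3) k) (i : Fin 3) :
    (linearForms g i).IsHomogeneous 1 :=
  MvPolynomial.IsHomogeneous.sum _ _ _ fun j _ => by
    simpa using (MvPolynomial.isHomogeneous_C _ _).mul (MvPolynomial.isHomogeneous_X k j)

lemma mulVec_ne_zero {g : Matrix (Fin 3) (Fin 3) k} (hg : g.det ≠ 0) {v : Fin 3 → k} (hv : v ≠ 0) :
    g *ᵥ v ≠ 0 :=
  fun h => hv (Matrix.eq_zero_of_mulVec_eq_zero hg h)

lemma det_inv_ne_zero {g : Matrix (Fin 3) (Fin 3) k} (hg : g.det ≠ 0) : g⁻¹.det ≠ 0 := by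
  rw [Matrix.det_nonsing_inv, Ring.inverse_eq_inv']
  exact inv_ne_zero hg

lemma mulVec_inv_mulVec {g : Matrix (Fin 3) (Fin 3) k} (hg : g.det ≠ 0) (v : Fin 3 → k) :
    g *ᵥ g⁻¹ *ᵥ v = v := by
  rw [Matrix.mulVec_mulVec, Matrix.mul_nonsing_inv _ hg.isUnit, Matrix.one_mulVec]

lemma inv_mulVec_mulVec {g : Matrix (Fin 3) (Fin 3) k} (hg : g.det ≠ 0) (v : Fin 3 → k) :
    g⁻¹ *ᵥ g *ᵥ v = v := by
  rw [Matrix.mulVec_mulVec, Matrix.nonsing_inv_mul _ hg.isUnit, Matrix.one_mulVec]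

/-- The projective transformation given by an invertible matrix. -/
noncomputable def projMap (g : Matrix (Fin 3) (Fin 3) k) (hg : g.det ≠ 0) (Q : Plane k) : Plane k :=
  Projectivization.mk k (g *ᵥ Q.rep) (mulVec_ne_zero hg Q.rep_nonzero)

lemma exists_rep_mk (v : Fin 3 → k) (hv : v ≠ 0) :
    ∃ c : k, c ≠ 0 ∧ (Projectivization.mk k v hv).rep = c • v := by
  obtain ⟨c, hc⟩ := Projectivization.exists_smul_eq_mk_rep k v hv
  exact ⟨c, c.ne_zero, hc.symm⟩

lemma mk_eq_mk_of_eq_smul {v w : Fin 3 → k} {hv : v ≠ 0} {hw : w ≠ 0} {c : k} (h : v = c • w) :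
    Projectivization.mk k v hv = Projectivization.mk k w hw :=
  (Projectivization.mk_eq_mk_iff' k v w hv hw).mpr ⟨c, h.symm⟩

lemma eq_mk_of_rep_eq_smul {Q : Plane k} {w : Fin 3 → k} {hw : w ≠ 0} {c : k}
    (h : Q.rep = c • w) : Q = Projectivization.mk k w hw := by
  rw [← Q.mk_rep]
  exact mk_eq_mk_of_eq_smul h

lemma projMap_mk (g : Matrix (Fin 3) (Fin 3) k) (hg : g.det ≠ 0) (v : Fin 3 → k) (hv : v ≠ 0) :
    projMap g hg (Projectivization.mk k v hv) =
      Projectivization.mk k (g *ᵥ v) (mulVec_ne_zero hg hv) := by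
  obtain ⟨c, -, hc⟩ := exists_rep_mk v hv
  exact mk_eq_mk_of_eq_smul (c := c) (by rw [hc, Matrix.mulVec_smul])

lemma mem_curve {F : TernaryCubic k} {Q : Plane k} : Q ∈ curve F.poly ↔ F.ev Q.rep = 0 := by
  rw [← eval_poly]; rfl

lemma mk_mem_curve {F : TernaryCubic k} {v : Fin 3 → k} {hv : v ≠ 0} :
    Projectivization.mk k v hv ∈ curve F.poly ↔ F.ev v = 0 := by
  obtain ⟨c, hc0, hc⟩ := exists_rep_mk v hv
  simp [mem_curve, hc, ev_smul, hc0]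

lemma curve_scale (F : TernaryCubic k) {κ : k} (hκ : κ ≠ 0) :
    curve (F.scale κ).poly = curve F.poly := by
  ext Q
  simp [mem_curve, ev_scale, hκ]

lemma transpose_mulVec_crossProduct (g : Matrix (Fin 3) (Fin 3) k) (p q : Fin 3 → k) :
    gᵀ *ᵥ (g *ᵥ p) ⨯₃ (g *ᵥ q) = g.det • (p ⨯₃ q) := by
  ext i
  fin_cases i <;>
    simp [Matrix.det_fin_three, cross_apply, Matrix.mulVec, dotProduct, Fin.sum_univ_three] <;> ring

lemma isRegular_projMap (g : Matrix (Fin 3) (Fin 3) k) (hg : g.det ≠ 0) {S : Set (Plane k)}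
    {ψ : S → Plane k} (hψ : ∀ Q, ψ Q = projMap g hg Q) (Q : S) :
    Represents (linearForms g) ψ ∧ evalTriple (linearForms g) Q.1.rep ≠ 0 := by
  refine ⟨⟨⟨1, isHomogeneous_linearForms g⟩, fun R h => ?_⟩, ?_⟩
  · rw [hψ]
    exact mk_eq_mk_of_eq_smul (c := 1) (by rw [evalTriple_linearForms, one_smul])
  · rw [evalTriple_linearForms]
    exact mulVec_ne_zero hg Q.1.rep_nonzero

/-- A linear change of coordinates induces an isomorphism of plane cubics. -/
noncomputable def linearEquiv {F G : TernaryCubic k} {g : Matrix (Fin 3) (Fin 3) k}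
    (hg : g.det ≠ 0) (h : F.comp g = G.scale g.det) : curve F.poly ≃ curve G.poly where
  toFun Q := ⟨projMap g⁻¹ (det_inv_ne_zero hg) Q, mk_mem_curve.mpr (by
    apply (mul_eq_zero.mp _).resolve_left hg
    rw [← ev_scale, ← h, ev_comp, mulVec_inv_mulVec hg]
    exact mem_curve.mp Q.2)⟩
  invFun Q := ⟨projMap g hg Q, mk_mem_curve.mpr (by
    rw [← ev_comp, h, ev_scale, mem_curve.mp Q.2, mul_zero])⟩
  left_inv Q := by
    ext1
    conv_rhs => rw [← Q.1.mk_rep]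
    exact (projMap_mk _ hg _ _).trans
      (mk_eq_mk_of_eq_smul (c := 1) (by rw [mulVec_inv_mulVec hg, one_smul]))
  right_inv Q := by
    ext1
    conv_rhs => rw [← Q.1.mk_rep]
    exact (projMap_mk _ (det_inv_ne_zero hg) _ _).trans
      (mk_eq_mk_of_eq_smul (c := 1) (by rw [inv_mulVec_mulVec hg, one_smul]))

lemma exists_rep_linearEquiv {F G : TernaryCubic k} {g : Matrix (Fin 3) (Fin 3) k}
    (hg : g.det ≠ 0) (h : F.comp g = G.scale g.det) (Q : curve F.poly) :
    ∃ c : k, c ≠ 0 ∧ (linearEquiv hg h Q).1.rep = c • g⁻¹ *ᵥ Q.1.rep :=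
  exists_rep_mk (g⁻¹ *ᵥ Q.1.rep) (mulVec_ne_zero (det_inv_ne_zero hg) Q.1.rep_nonzero)

lemma exists_rep_linearEquiv_symm {F G : TernaryCubic k} {g : Matrix (Fin 3) (Fin 3) k}
    (hg : g.det ≠ 0) (h : F.comp g = G.scale g.det) (R : curve G.poly) :
    ∃ c : k, c ≠ 0 ∧ ((linearEquiv hg h).symm R).1.rep = c • g *ᵥ R.1.rep :=
  exists_rep_mk (g *ᵥ R.1.rep) (mulVec_ne_zero hg R.1.rep_nonzero)

/-- By the cofactor identity, gᵀ(q × v) is det(g) times the vector product of g⁻¹q and g⁻¹v; by the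
chain rule gᵀ∇F(q) is det(g) ∇G(g⁻¹q). The factors agree, so the scalar t is preserved. -/
lemma isNormalizedIso_linearEquiv {F G : TernaryCubic k} {g : Matrix (Fin 3) (Fin 3) k}
    (hg : g.det ≠ 0) (h : F.comp g = G.scale g.det) :
    IsNormalizedIso F.poly G.poly (linearEquiv hg h) where
  regular Q := by
    obtain ⟨h1, h2⟩ := isRegular_projMap g⁻¹ (det_inv_ne_zero hg)
      (ψ := fun R => (linearEquiv hg h R : Plane k)) (fun _ => rfl) Q
    refine ⟨_, h1, h2, fun v t hvt => ?_⟩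
    rw [evalTriple_linearForms, derivTriple_linearForms, grad_poly]
    rw [grad_poly] at hvt
    have key := transpose_mulVec_crossProduct g (g⁻¹ *ᵥ Q.1.rep) (g⁻¹ *ᵥ v)
    rw [mulVec_inv_mulVec hg, mulVec_inv_mulVec hg, hvt, Matrix.mulVec_smul] at key
    have hgr := gradient_comp (F := F) g (g⁻¹ *ᵥ Q.1.rep)
    rw [mulVec_inv_mulVec hg, h, gradient_scale] at hgr
    rw [← hgr, smul_comm] at key
    exact (smul_right_injective _ hg key).symm
  regular_symm Q := ⟨_, isRegular_projMap g hg (fun _ => rfl) Q⟩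

variable {N : Fin 3 → Matrix (Fin 3) (Fin 3) k}

lemma mem_cubeCurve {Q : Plane k × Plane k} :
    Q ∈ cubeCurve N ↔ pencil N Q.1.rep *ᵥ Q.2.rep = 0 := by
  simp only [cubeCurve, Set.mem_ofPred_eq, form_eq, funext_iff, Pi.zero_apply]

lemma pair_mem_cubeCurve {P Q : Plane k} :
    (P, Q) ∈ cubeCurve N ↔ pencil N P.rep *ᵥ Q.rep = 0 :=
  mem_cubeCurve

lemma mk_mem_cubeCurve {u v : Fin 3 → k} {hu : u ≠ 0} {hv : v ≠ 0} :
    (Projectivization.mk k u hu, Projectivization.mk k v hv) ∈ cubeCurve N ↔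
      pencil N u *ᵥ v = 0 := by
  obtain ⟨c, hc0, hc⟩ := exists_rep_mk u hu
  obtain ⟨d, hd0, hd⟩ := exists_rep_mk v hv
  simp [mem_cubeCurve, hc, hd, pencil_smul, Matrix.smul_mulVec, Matrix.mulVec_smul, hc0, hd0]

lemma mem_cubeCurve_swap {P Q : Plane k} :
    (Q, P) ∈ cubeCurve (TernaryCubic.swap N) ↔ (P, Q) ∈ cubeCurve N := by
  rw [pair_mem_cubeCurve, pair_mem_cubeCurve, pencil_swap_mulVec]

/-- The vector products of the rows of the matrix of linear forms of a cube. -/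
noncomputable def crossForms (N : Fin 3 → Matrix (Fin 3) (Fin 3) k) (i : Fin 3) :
    Fin 3 → MvPolynomial (Fin 3) k :=
  linearForms (swap (fun j => (N j)ᵀ) (i + 1)) ⨯₃ linearForms (swap (fun j => (N j)ᵀ) (i + 2))

lemma evalTriple_crossForms (i : Fin 3) (u : Fin 3 → k) :
    evalTriple (crossForms N i) u = crossRows (pencil N u) i := by
  ext l
  fin_cases l <;>
    simp [evalTriple, crossForms, crossRows, pencil, cross_apply, linearForms, swap,
      Fin.sum_univ_three] <;> ring

lemma isHomogeneous_crossForms (i l : Fin 3) : (crossForms N i l).IsHomogeneous 2 := by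
  have h (g h : Matrix (Fin 3) (Fin 3) k) (a b c d : Fin 3) :
      (linearForms g a * linearForms h b - linearForms g c * linearForms h d).IsHomogeneous 2 :=
    ((isHomogeneous_linearForms g a).mul (isHomogeneous_linearForms h b)).sub
      ((isHomogeneous_linearForms g c).mul (isHomogeneous_linearForms h d))
  fin_cases l <;> exact h ..

/-- The kernel of a matrix of linear forms of corank one is a regular function. -/
lemma isRegular_kernel {C : Set (Plane k)} {ψ : C → Plane k}
    (hψ : ∀ R : C, pencil N R.1.rep *ᵥ (ψ R).rep = 0)
    (hC : ∀ R : C, ∃ i, crossRows (pencil N R.1.rep) i ≠ 0) : IsRegular ψ := by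
  intro Q
  obtain ⟨i, hi⟩ := hC Q
  refine ⟨crossForms N i, ⟨⟨2, isHomogeneous_crossForms i⟩, fun R h => ?_⟩, ?_⟩
  · have h' := h
    rw [evalTriple_crossForms] at h'
    obtain ⟨t, ht⟩ := exists_eq_smul_crossRows h' (hψ R)
    exact eq_mk_of_rep_eq_smul (c := t) (by rw [ht, evalTriple_crossForms])
  · rwa [evalTriple_crossForms]

lemma Nonsingular.exists_crossRows_rep (hN : (ofSlices N).Nonsingular)
    (R : curve (ofSlices N).poly) : ∃ i, crossRows (pencil N R.1.rep) i ≠ 0 :=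
  hN.exists_crossRows_ne_zero R.1.rep_nonzero (mem_curve.mp R.2)

/-- The first projection of the curve of a cube is an isomorphism onto a plane cubic. -/
lemma Nonsingular.fstIsIso (hN : (ofSlices N).Nonsingular) :
    FstIsIso (cubeCurve N) (curve (ofSlices N).poly) := by
  have hex (R : curve (ofSlices N).poly) : ∃ P : Plane k, (R.1, P) ∈ cubeCurve N := by
    have h0 := mem_curve.mp R.2
    rw [ev_ofSlices'] at h0
    obtain ⟨v, hv0, hv⟩ := Matrix.exists_mulVec_eq_zero_iff.mpr h0
    refine ⟨Projectivization.mk k v hv0, ?_⟩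
    have := mk_mem_cubeCurve (N := N) (hu := R.1.rep_nonzero) (hv := hv0)
    rw [Projectivization.mk_rep] at this
    exact this.mpr hv
  refine ⟨⟨fun Q hQ => ?_, fun Q hQ Q' hQ' h => ?_, fun R hR => ?_⟩, ?_⟩
  · rw [mem_curve, ev_ofSlices']
    exact Matrix.exists_mulVec_eq_zero_iff.mp ⟨_, Q.2.rep_nonzero, mem_cubeCurve.mp hQ⟩
  · refine Prod.ext h ?_
    rw [mem_cubeCurve] at hQ hQ'
    rw [← h] at hQ'
    obtain ⟨c, -, hc⟩ := hN.exists_eq_smul Q.1.rep_nonzero Q'.2.rep_nonzero Q.2.rep_nonzero hQ' hQ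
    rw [← Q'.2.mk_rep]
    exact eq_mk_of_rep_eq_smul hc
  · obtain ⟨P, hP⟩ := hex ⟨R, hR⟩
    exact ⟨_, hP, rfl⟩
  · choose ψ hψ using hex
    exact ⟨ψ, isRegular_kernel (fun R => pair_mem_cubeCurve.mp (hψ R)) hN.exists_crossRows_rep, hψ⟩

/-- The second projection of the curve of a cube is an isomorphism onto a plane cubic. -/
lemma Nonsingular.sndIsIso (hN : (ofSlices (TernaryCubic.swap N)).Nonsingular) :
    SndIsIso (cubeCurve N) (curve (ofSlices (TernaryCubic.swap N)).poly) := by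
  obtain ⟨⟨h1, h2, h3⟩, ψ, hψ, hψ'⟩ := hN.fstIsIso
  refine ⟨⟨?_, ?_, ?_⟩, ψ, hψ, fun R => ?_⟩
  · rintro ⟨P, Q⟩ hQ
    have := h1 (mem_cubeCurve_swap.mpr hQ)
    dsimp only at this ⊢
    exact this
  · rintro ⟨P, Q⟩ hQ ⟨P', Q'⟩ hQ' h
    have := h2 (mem_cubeCurve_swap.mpr hQ) (mem_cubeCurve_swap.mpr hQ') h
    rw [Prod.mk.injEq] at this ⊢
    exact this.symm
  · intro R hR
    obtain ⟨⟨P, Q⟩, hQ, rfl⟩ := h3 hR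
    exact ⟨_, mem_cubeCurve_swap.mp hQ, rfl⟩
  · exact mem_cubeCurve_swap.mp (hψ' R)

lemma exists_vecMul_eq_zero {A : Matrix (Fin 3) (Fin 3) k} {v : Fin 3 → k} (hv0 : v ≠ 0)
    (hv : A *ᵥ v = 0) : ∃ w : Fin 3 → k, w ≠ 0 ∧ w ᵥ* A = 0 :=
  Matrix.exists_vecMul_eq_zero_iff.mpr (Matrix.exists_mulVec_eq_zero_iff.mp ⟨v, hv0, hv⟩)

lemma evalTriple_rename_inl (f : Fin 3 → MvPolynomial (Fin 3) k) (u v : Fin 3 → k) :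
    evalTriple (fun i => MvPolynomial.rename (Sum.inl : Fin 3 → Fin 3 ⊕ Fin 3) (f i))
      (Sum.elim u v) = evalTriple f u := by
  ext i
  simp [evalTriple, MvPolynomial.eval_rename]

lemma isWeightedHomogeneous_rename_inl {f : MvPolynomial (Fin 3) k} {n : ℕ}
    (hf : f.IsHomogeneous n) :
    (MvPolynomial.rename (Sum.inl : Fin 3 → Fin 3 ⊕ Fin 3) f).IsWeightedHomogeneous
      (Sum.elim (fun _ => 1) (fun _ => 0) : Fin 3 ⊕ Fin 3 → ℕ) n := by
  intro d hd
  obtain ⟨u, rfl, hu⟩ := MvPolynomial.coeff_rename_ne_zero _ _ _ hd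
  rw [← hf hu, Finsupp.weight_apply, Finsupp.weight_apply,
    Finsupp.sum_mapDomain_index (by simp) (by intros; simp [add_mul])]
  simp

lemma isWeightedHomogeneous_rename_inl' (f : MvPolynomial (Fin 3) k) :
    (MvPolynomial.rename (Sum.inl : Fin 3 → Fin 3 ⊕ Fin 3) f).IsWeightedHomogeneous
      (Sum.elim (fun _ => 0) (fun _ => 1) : Fin 3 ⊕ Fin 3 → ℕ) 0 := by
  intro d hd
  obtain ⟨u, rfl, hu⟩ := MvPolynomial.coeff_rename_ne_zero _ _ _ hd
  rw [Finsupp.weight_apply, Finsupp.sum_mapDomain_index (by simp) (by intros; simp [add_mul])]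
  simp

/-- The elliptic curve is the Jacobian of the first cubic, reached by the first projection followed
by the linear isomorphism. -/
lemma Nonsingular.definesGenusOneCurve [IsAlgClosed k] [CharZero k]
    (hN : (ofSlices N).Nonsingular) : DefinesGenusOneCurve N := by
  refine ⟨fun Q hQ w => ?_, ?_⟩
  · have hQ' := mem_cubeCurve.mp hQ
    let T : (Fin 3 → k) × (Fin 3 → k) →ₗ[k] Fin 3 → k :=
      LinearMap.coprod (Matrix.mulVecLin (pencil (TernaryCubic.swap N) Q.2.rep))
        (Matrix.mulVecLin (pencil N Q.1.rep))
    -- A covector y killing the image of the differential at (u, v) would satisfy y N_u = 0 and y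
    -- N_r v = 0 for all r, which transversality excludes.
    have hT : Function.Surjective T := by
      rw [← LinearMap.range_eq_top]
      by_contra hne
      obtain ⟨f, hf0, hf⟩ := Submodule.exists_le_ker_of_lt_top _ (lt_top_iff_ne_top.mpr hne)
      obtain ⟨y, rfl⟩ := (dotProductEquiv k (Fin 3)).surjective f
      have hy0 : y ≠ 0 := by rintro rfl; simp at hf0
      have hy (u v : Fin 3 → k) : y ⬝ᵥ T (u, v) = 0 := by
        simpa using hf (LinearMap.mem_range_self T (u, v))
      obtain ⟨r, hr⟩ := hN.exists_dotProduct_ne_zero Q.1.rep_nonzero Q.2.rep_nonzero hQ' hy0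
        (eq_zero_of_forall_dotProduct fun r => by
          rw [← Matrix.dotProduct_mulVec]
          simpa [T] using hy 0 r)
      exact hr (by rw [← pencil_swap_mulVec]; simpa [T] using hy r 0)
    obtain ⟨⟨u, v⟩, huv⟩ := hT w
    refine ⟨u, v, fun i => ?_⟩
    rw [form_eq, form_eq, ← pencil_swap_mulVec, ← Pi.add_apply, ← huv]
    rfl
  · obtain ⟨g, hg, h⟩ := hN.exists_comp_eq_jacobian
    refine ⟨(ofSlices N).jacobian, Nonsingular.isElliptic ?_, ?_⟩
    · intro v hv hv'
      have := hN.comp hg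
      rw [h] at this
      exact this v (by rw [ev_scale, hv, mul_zero]) (by rw [gradient_scale, hv', smul_zero])
    rw [← poly_ofWeierstrass]
    let e₁ := hN.fstIsIso.1.equiv
    have he₁ (R) : (e₁.symm R).1.1 = R.1 := congrArg Subtype.val (e₁.apply_symm_apply R)
    refine ⟨e₁.trans (linearEquiv hg h), fun Q => ?_, fun Q => ?_, ?_⟩
    · refine ⟨fun i => MvPolynomial.rename Sum.inl (linearForms g⁻¹ i), ⟨1, 0, fun i => ⟨?_, ?_⟩⟩,
        fun R hR => ?_, ?_⟩
      · exact isWeightedHomogeneous_rename_inl (isHomogeneous_linearForms g⁻¹ i)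
      · exact isWeightedHomogeneous_rename_inl' _
      · refine mk_eq_mk_of_eq_smul (c := 1) ?_
        rw [one_smul, evalTriple_rename_inl, evalTriple_linearForms]
        rfl
      · rw [evalTriple_rename_inl, evalTriple_linearForms]
        exact mulVec_ne_zero (det_inv_ne_zero hg) Q.1.1.rep_nonzero
    · have he₂ (R) : (e₁.symm ((linearEquiv hg h).symm R)).1.1 = projMap g hg R.1 := he₁ _
      exact ⟨_, isRegular_projMap g hg he₂ Q⟩
    -- The second coordinate of the inverse at u is the kernel of N at gu. Absorbing g into the cube
    -- N' exhibits it as a kernel map of linear forms in u.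
    · let N' : Fin 3 → Matrix (Fin 3) (Fin 3) k := fun j => pencil N (g.col j)
      have hN' (u : Fin 3 → k) : pencil N' u = pencil N (g *ᵥ u) := by
        simp only [pencil, N', Matrix.mulVec, dotProduct, Matrix.col, Finset.smul_sum, smul_smul,
          Finset.sum_smul]
        rw [Finset.sum_comm]
        exact Finset.sum_congr rfl fun _ _ => Finset.sum_congr rfl fun _ _ => by rw [mul_comm]; rfl
      refine isRegular_kernel (N := N') (fun R => ?_) (fun R => ?_)
      · obtain ⟨c, hc0, hc⟩ := exists_rep_linearEquiv_symm hg h R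
        have h1 := mem_cubeCurve.mp (e₁.symm ((linearEquiv hg h).symm R)).2
        rw [he₁, hc, pencil_smul, Matrix.smul_mulVec] at h1
        rw [hN']
        exact (smul_eq_zero.mp h1).resolve_left hc0
      · rw [hN']
        exact hN.exists_crossRows_ne_zero (mulVec_ne_zero hg R.1.rep_nonzero) (by
          rw [← ev_comp, h, ev_scale, mem_curve.mp R.2, mul_zero])

end TernaryCubic

/-! ### Line sections of plane cubics as divisors -/

namespace TernaryCubic
open PlaneCubic
variable {k : Type*} [Field k]

/-- The points `P 0, P 1, P 2` are the intersection, with multiplicities, of a plane cubic with the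
line `L`. -/
def IsLineSection (G : TernaryCubic k) (L : Fin 3 → k) (P : Fin 3 → Fin 3 → k) : Prop :=
  ∃ (p q a b : Fin 3 → k) (κ : k), LinearIndependent k ![p, q] ∧ L ⬝ᵥ p = 0 ∧ L ⬝ᵥ q = 0 ∧ κ ≠ 0 ∧
    (∀ i, P i ≠ 0 ∧ ∃ c : k, c ≠ 0 ∧ a i • p + b i • q = c • P i) ∧
    ∀ s t : k, G.ev (s • p + t • q) =
      κ * ((s * b 0 - t * a 0) * (s * b 1 - t * a 1) * (s * b 2 - t * a 2))

variable {G : TernaryCubic k} {L : Fin 3 → k} {P : Fin 3 → Fin 3 → k}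

lemma IsLineSection.ev_eq_zero (h : IsLineSection G L P) (i : Fin 3) : G.ev (P i) = 0 := by
  obtain ⟨p, q, a, b, κ, -, -, -, -, hP, hG⟩ := h
  obtain ⟨-, c, hc, hi⟩ := hP i
  have : G.ev (c • P i) = 0 := by
    rw [← hi, hG]
    fin_cases i <;> simp <;> ring_nf <;> simp
  rw [ev_smul] at this
  exact (mul_eq_zero.mp this).resolve_left (pow_ne_zero _ hc)

lemma eval_aeval_poly (F : TernaryCubic k) (p r : Fin 3 → k) (t : k) :
    (MvPolynomial.aeval (fun i => Polynomial.C (p i) + Polynomial.X * Polynomial.C (r i)) F.poly :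
      Polynomial k).eval t = F.ev (p + t • r) := by
  simp [poly, ev, mul_comm t]

open Classical in
lemma rootMultiplicity_zero_linear (e f : k) (h : e ≠ 0 ∨ f ≠ 0) :
    (Polynomial.C e + Polynomial.X * Polynomial.C f).rootMultiplicity 0 =
      if e = 0 then 1 else 0 := by
  split_ifs with he
  · subst he
    have hf := h.resolve_left (fun h => h rfl)
    rw [map_zero, zero_add, mul_comm, Polynomial.rootMultiplicity_mul, Polynomial.rootMultiplicity_C,
      zero_add]
    · simpa using Polynomial.rootMultiplicity_X_sub_C_self (x := (0 : k))
    · simpa using hf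
  · exact Polynomial.rootMultiplicity_eq_zero (by simpa [Polynomial.IsRoot] using he)

lemma linear_ne_zero (e f : k) (h : e ≠ 0 ∨ f ≠ 0) :
    (Polynomial.C e + Polynomial.X * Polynomial.C f) ≠ 0 := by
  intro h0
  have h1 := congrArg (Polynomial.coeff · 0) h0
  have h2 := congrArg (Polynomial.coeff · 1) h0
  simp [Polynomial.coeff_C] at h1 h2
  rcases h with h | h
  exacts [h h1, h h2]

lemma IsLineSection.dotProduct_eq_zero (h : IsLineSection G L P) (i : Fin 3) : L ⬝ᵥ P i = 0 := by
  obtain ⟨p, q, a, b, κ, -, hp, hq, -, hP, -⟩ := h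
  obtain ⟨-, c, hc, hi⟩ := hP i
  have := congrArg (L ⬝ᵥ ·) hi
  simp only [dotProduct_add, dotProduct_smul, hp, hq, smul_zero, add_zero] at this
  exact (smul_eq_zero.mp this.symm).resolve_left hc

open Classical in
-- On the line the cubic is a product of three linear forms, and the i-th form vanishes at Q exactly
-- when Q is the i-th point.
lemma IsLineSection.lineMult_eq [Infinite k] (hL : L ≠ 0) (h : IsLineSection G L P)
    (X : Fin 3 → Plane k) (hX : ∀ i, ∃ c : k, (X i).rep = c • P i) (Q : Plane k) :
    lineMult G.poly L Q = ∑ i, if X i = Q then 1 else 0 := by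
  by_cases hQ : L ⬝ᵥ Q.rep = 0
  swap
  · have : ∀ i, X i ≠ Q := by
      rintro i rfl
      obtain ⟨c, hc⟩ := hX i
      rw [hc, dotProduct_smul, h.dotProduct_eq_zero, smul_zero] at hQ
      exact hQ rfl
    simp [lineMult, hQ, this]
  obtain ⟨p, q, a, b, κ, hpq, hp, hq, hκ, hP, hG⟩ := h
  have key (r : Fin 3 → k) (hr : L ⬝ᵥ r = 0) (hQr : LinearIndependent k ![Q.rep, r]) :
      (MvPolynomial.aeval (fun i => Polynomial.C (Q.rep i) + Polynomial.X * Polynomial.C (r i))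
        G.poly : Polynomial k).rootMultiplicity 0 = ∑ i, if X i = Q then 1 else 0 := by
    obtain ⟨s₀, t₀, h₀⟩ := exists_eq_of_dotProduct_eq_zero hL hpq hp hq hQ
    obtain ⟨s₁, t₁, h₁⟩ := exists_eq_of_dotProduct_eq_zero hL hpq hp hq hr
    have hdet : s₀ * t₁ - t₀ * s₁ ≠ 0 := by
      intro hd
      apply crossProduct_ne_zero_iff_linearIndependent.mpr hQr
      have : Q.rep ⨯₃ r = (s₀ * t₁ - t₀ * s₁) • (p ⨯₃ q) := by
        rw [h₀, h₁]
        ext i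
        fin_cases i <;> simp [cross_apply] <;> ring
      rw [this, hd, zero_smul]
    have hab (i) : a i ≠ 0 ∨ b i ≠ 0 := by
      by_contra! h
      obtain ⟨hPi, c, hc, hi⟩ := hP i
      rw [h.1, h.2, zero_smul, zero_smul, add_zero] at hi
      exact smul_ne_zero hc hPi hi.symm
    have hne (i) : s₀ * b i - t₀ * a i ≠ 0 ∨ s₁ * b i - t₁ * a i ≠ 0 := by
      by_contra! h
      rcases hab i with h' | h'
      · apply mul_ne_zero hdet h'
        linear_combination -s₀ * h.2 + s₁ * h.1
      · apply mul_ne_zero hdet h'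
        linear_combination t₁ * h.1 - t₀ * h.2
    have hfac : (MvPolynomial.aeval (fun i => Polynomial.C (Q.rep i) +
        Polynomial.X * Polynomial.C (r i)) G.poly : Polynomial k) = Polynomial.C κ *
        ((Polynomial.C (s₀ * b 0 - t₀ * a 0) + Polynomial.X * Polynomial.C (s₁ * b 0 - t₁ * a 0)) *
        (Polynomial.C (s₀ * b 1 - t₀ * a 1) + Polynomial.X * Polynomial.C (s₁ * b 1 - t₁ * a 1)) *
        (Polynomial.C (s₀ * b 2 - t₀ * a 2) + Polynomial.X * Polynomial.C (s₁ * b 2 - t₁ * a 2))) := by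
      refine Polynomial.funext fun t => ?_
      rw [eval_aeval_poly, h₀, h₁]
      have : s₀ • p + t₀ • q + t • (s₁ • p + t₁ • q) =
          (s₀ + t * s₁) • p + (t₀ + t * t₁) • q := by module
      rw [this, hG]
      simp only [Polynomial.eval_mul, Polynomial.eval_add, Polynomial.eval_C, Polynomial.eval_X]
      ring
    have hiff (i) : s₀ * b i - t₀ * a i = 0 ↔ X i = Q := by
      obtain ⟨hPi, c, hc, hi⟩ := hP i
      obtain ⟨d, hd⟩ := hX i
      have hd0 : d ≠ 0 := by
        rintro rfl
        exact (X i).rep_nonzero (by rw [hd, zero_smul])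
      have hcross : Q.rep ⨯₃ P i = (c⁻¹ * (s₀ * b i - t₀ * a i)) • (p ⨯₃ q) := by
        have : P i = c⁻¹ • (a i • p + b i • q) := by rw [hi, smul_smul, inv_mul_cancel₀ hc, one_smul]
        rw [h₀, this]
        ext i
        fin_cases i <;> simp [cross_apply] <;> ring
      constructor
      · intro h
        rw [h, mul_zero, zero_smul] at hcross
        have hdep := (not_iff_not.mpr crossProduct_ne_zero_iff_linearIndependent).mp
          (not_not.mpr hcross)
        rw [LinearIndependent.pair_iff' Q.rep_nonzero] at hdep
        push Not at hdep
        obtain ⟨e, he⟩ := hdep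
        rw [← Q.mk_rep]
        exact eq_mk_of_rep_eq_smul (c := d * e) (by rw [hd, ← he, smul_smul])
      · rintro rfl
        have : (X i).rep ⨯₃ P i = 0 := by rw [hd, map_smul, LinearMap.smul_apply, cross_self, smul_zero]
        rw [this] at hcross
        have := (smul_eq_zero.mp hcross.symm).resolve_right
          (crossProduct_ne_zero_iff_linearIndependent.mpr hpq)
        exact (mul_eq_zero.mp this).resolve_left (inv_ne_zero hc)
    rw [hfac]
    have hn (i) := linear_ne_zero _ _ (hne i)
    have hC : Polynomial.C κ ≠ 0 := Polynomial.C_ne_zero.mpr hκ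
    rw [Polynomial.rootMultiplicity_mul (mul_ne_zero hC (mul_ne_zero (mul_ne_zero (hn 0) (hn 1)) (hn 2))),
      Polynomial.rootMultiplicity_mul (mul_ne_zero (mul_ne_zero (hn 0) (hn 1)) (hn 2)),
      Polynomial.rootMultiplicity_mul (mul_ne_zero (hn 0) (hn 1)), Polynomial.rootMultiplicity_C,
      rootMultiplicity_zero_linear _ _ (hne 0), rootMultiplicity_zero_linear _ _ (hne 1),
      rootMultiplicity_zero_linear _ _ (hne 2), Fin.sum_univ_three, zero_add]
    simp only [hiff]
  obtain ⟨r, hr, hQr⟩ := LinearIndependent.exists_pair_of_ne_zero hL hp hq hpq hQ Q.rep_nonzero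
  -- All admissible r give the same multiplicity, so the infimum is over a singleton. That some r
  -- exists matters: the infimum of the empty set of naturals is 0.
  refine (congrArg sInf ?_).trans (csInf_singleton (∑ i, if X i = Q then 1 else 0))
  ext n
  constructor
  · rintro ⟨-, r, hr, hQr, rfl⟩
    exact key r hr hQr
  · rintro rfl
    exact ⟨hQ, r, hr, hQr, (key r hr hQr).symm⟩

section Divisor
variable {S : Type*} {π : S → Plane k} {Q : Fin 3 → S}

lemma IsLineSection.hyperplaneSection_eq [Infinite k] (hL : L ≠ 0) (h : IsLineSection G L P)
    (hπ : Function.Injective π) (hQ : ∀ i, ∃ c : k, (π (Q i)).rep = c • P i) :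
    hyperplaneSection π G.poly L = ∑ i, Finsupp.single (Q i) 1 := by
  classical
  have key (R : S) : (lineMult G.poly L (π R) : ℤ) = (∑ i, Finsupp.single (Q i) (1 : ℤ)) R := by
    rw [h.lineMult_eq hL (fun i => π (Q i)) hQ]
    simp [Finsupp.finsetSum_apply, Finsupp.single_apply, hπ.eq_iff]
  -- Finiteness of the support excludes the default value 0 of `hyperplaneSection`.
  have hfin : (Function.support fun R => (lineMult G.poly L (π R) : ℤ)).Finite := by
    rw [funext key]
    exact (∑ i, Finsupp.single (Q i) (1 : ℤ)).hasFiniteSupport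
  rw [hyperplaneSection, dif_pos hfin]
  ext R
  rw [← key]
  rfl

variable [DecidableEq k] {W : WeierstrassCurve k} (φ : S → W.toAffine.Point)

lemma divisorSum_sub (D E : S →₀ ℤ) : divisorSum φ (D - E) = divisorSum φ D - divisorSum φ E :=
  Finsupp.sum_sub_index fun _ _ _ => sub_smul _ _ _

lemma divisorSum_sum_single : divisorSum φ (∑ i, Finsupp.single (Q i) 1) = ∑ i, φ (Q i) := by
  rw [divisorSum, ← Finsupp.sum_finsetSum_index (by simp) (by intros; rw [add_smul])]
  simp

lemma degree_sum_single : (∑ i, Finsupp.single (Q i) (1 : ℤ)).degree = 3 := by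
  simp [map_sum]

end Divisor

/-- A line meets a plane cubic in three points. -/
lemma Nonsingular.exists_isLineSection [IsAlgClosed k] [CharZero k] (hG : G.Nonsingular)
    (hL : L ≠ 0) : ∃ P, IsLineSection G L P := by
  obtain ⟨x, hx0, hx, hLx⟩ := MvPolynomial.exists_common_zero G.poly
    (∑ j, MvPolynomial.C (L j) * MvPolynomial.X j) (by rw [eval_poly]; simp [ev])
    (by simp)
  rw [eval_poly] at hx
  replace hLx : L ⬝ᵥ x = 0 := by simpa [dotProduct] using hLx
  obtain ⟨p, q, hpq, hp, hq⟩ := exists_line_basis hL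
  obtain ⟨y, hy, hxy⟩ := LinearIndependent.exists_pair_of_ne_zero hL hp hq hpq hLx hx0
  set α := G.gradient x ⬝ᵥ y
  set β := G.gradient y ⬝ᵥ x
  have hline (s t : k) : G.ev (s • x + t • y) = t * (s^2 * α + s * t * β + t^2 * G.ev y) := by
    rw [ev_line, hx]
    ring
  obtain ⟨s₁, t₁, hne, h₁⟩ := exists_binary_quadratic_zero α β (G.ev y)
  -- The known zero x accounts for the factor t; the remaining binary quadratic form splits as soon
  -- as one zero is known.
  obtain ⟨e, f, hef⟩ : ∃ e f : k, ∀ s t : k, s^2 * α + s * t * β + t^2 * G.ev y =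
      (s * t₁ - t * s₁) * (s * e - t * f) := by
    by_cases ht : t₁ = 0
    · have hs : s₁ ≠ 0 := hne.resolve_right (fun h => h ht)
      have hα : α = 0 := by simpa [ht, hs] using h₁
      refine ⟨- β / s₁, G.ev y / s₁, fun s t => ?_⟩
      rw [ht, hα]
      field_simp
      ring
    · refine ⟨α / t₁, -(β + s₁ * (α / t₁)) / t₁, fun s t => ?_⟩
      field_simp
      linear_combination t^2 * h₁
  have hef0 : f • x + e • y ≠ 0 := by
    intro h0
    have := LinearIndependent.pair_iff.mp hxy _ _ h0
    obtain ⟨s, t, hst⟩ := hG.exists_ev_line_ne_zero hxy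
    apply hst
    rw [hline, hef, this.1, this.2]
    ring
  have h10 : s₁ • x + t₁ • y ≠ 0 := by
    intro h0
    have := LinearIndependent.pair_iff.mp hxy _ _ h0
    tauto
  -- The constant -1 comes from writing the factor t of the point x as -(s · 0 - t · 1).
  refine ⟨![x, s₁ • x + t₁ • y, f • x + e • y], x, y, ![1, s₁, f], ![0, t₁, e], -1, hxy, hLx, hy,
    by simp, fun i => ?_, fun s t => ?_⟩
  · refine ⟨?_, 1, one_ne_zero, ?_⟩
    · fin_cases i
      exacts [hx0, h10, hef0]
    · fin_cases i <;> simp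
  · rw [hline, hef]
    simp [mul_assoc]

end TernaryCubic

/-! ### Vectors in a common plane -/

section CrossProduct
variable {k : Type*} [Field k]

lemma crossRows_transpose (A : Matrix (Fin 3) (Fin 3) k) (i l : Fin 3) :
    crossRows Aᵀ i l = crossRows A l i := by
  fin_cases i <;> fin_cases l <;> simp [crossRows, cross_apply] <;> ring

lemma mulVec_crossProduct_dotProduct (A : Matrix (Fin 3) (Fin 3) k) (x y z : Fin 3 → k) :
    ((A *ᵥ x) ⨯₃ (A *ᵥ y)) ⬝ᵥ A *ᵥ z = A.det * ((x ⨯₃ y) ⬝ᵥ z) := by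
  simp [Matrix.det_fin_three, cross_apply, Matrix.mulVec, dotProduct, Fin.sum_univ_three]
  ring

/-- x and y lie in the plane orthogonal to w, so their vector product is a multiple of w; pairing
with h reads off the factor. -/
lemma crossProduct_eq_smul {w h x y : Fin 3 → k} (hwh : w ⬝ᵥ h = 1) (hx : w ⬝ᵥ x = 0)
    (hy : w ⬝ᵥ y = 0) : x ⨯₃ y = (h ⬝ᵥ x ⨯₃ y) • w := by
  have h0 : ∀ i, (x ⨯₃ y) i * (w ⬝ᵥ h) - (h ⬝ᵥ x ⨯₃ y) * w i =
      (w ⬝ᵥ y) * (x ⨯₃ h) i - (w ⬝ᵥ x) * (y ⨯₃ h) i := by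
    intro i
    fin_cases i <;> simp [cross_apply, dotProduct, Fin.sum_univ_three] <;> ring
  ext i
  have := h0 i
  rw [hwh, hx, hy] at this
  simp only [Pi.smul_apply, smul_eq_mul]
  linear_combination this

/-- Three vectors in a plane satisfy a linear relation whose coefficients are their two-by-two
minors. -/
lemma smul_sub_smul_add_smul {w h b c d : Fin 3 → k} (hwh : w ⬝ᵥ h = 1) (hb : w ⬝ᵥ b = 0)
    (hc : w ⬝ᵥ c = 0) (hd : w ⬝ᵥ d = 0) :
    (h ⬝ᵥ c ⨯₃ d) • b - (h ⬝ᵥ b ⨯₃ d) • c + (h ⬝ᵥ b ⨯₃ c) • d = 0 := by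
  have h1 := dotProduct_crossProduct_smul c d h b
  have h2 : b ⬝ᵥ c ⨯₃ d = 0 := by
    rw [crossProduct_eq_smul hwh hc hd, dotProduct_smul, dotProduct_comm b, hb, smul_zero]
  have h3 : b ⬝ᵥ d ⨯₃ h = h ⬝ᵥ b ⨯₃ d := (triple_product_permutation h b d).symm
  have h4 : b ⬝ᵥ h ⨯₃ c = - (h ⬝ᵥ b ⨯₃ c) := by
    rw [triple_product_permutation h b c, ← cross_anticomm c h, dotProduct_neg]
  rw [h2, h3, h4] at h1
  rw [h1]
  module

lemma exists_eq_zero_of_det_eq_zero {a b c d : k} (h : a * d - b * c = 0) :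
    ∃ x y : k, (x ≠ 0 ∨ y ≠ 0) ∧ x * a + y * b = 0 ∧ x * c + y * d = 0 := by
  by_cases h1 : a = 0 ∧ b = 0
  · by_cases h2 : c = 0 ∧ d = 0
    · exact ⟨1, 0, by simp, by simp [h1.1], by simp [h2.1]⟩
    · refine ⟨d, -c, by simp only [neg_ne_zero]; tauto, by simp [h1.1, h1.2], by ring⟩
  · exact ⟨b, -a, by simp only [neg_ne_zero]; tauto, by ring, by linear_combination -h⟩

/-- Coordinates `(x, y)` on which a non-zero linear form vanishes. -/
lemma exists_eq_mul_of_mul_add_mul_eq_zero {x y e f : k} (hxy : x ≠ 0 ∨ y ≠ 0) (hef : e ≠ 0 ∨ f ≠ 0)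
    (h : x * e + y * f = 0) : ∃ c : k, c ≠ 0 ∧ -f = c * x ∧ e = c * y := by
  by_cases hx : x = 0
  · have hy := hxy.resolve_left (fun h => h hx)
    have hf : f = 0 := by simpa [hx, hy] using h
    have he := hef.resolve_right (fun h => h hf)
    exact ⟨e / y, div_ne_zero he hy, by simp [hx, hf], by field_simp⟩
  · have hf : f ≠ 0 := by
      rintro rfl
      have : e = 0 := by simpa [hx] using h
      tauto
    refine ⟨-f / x, div_ne_zero (neg_ne_zero.mpr hf) hx, by field_simp, ?_⟩
    field_simp
    linear_combination h

lemma LinearIndependent.ne_zero_or_ne_zero {p q x : Fin 3 → k} {s t : k} (hx : x ≠ 0)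
    (h : x = s • p + t • q) : s ≠ 0 ∨ t ≠ 0 := by
  by_contra! h0
  exact hx (by rw [h, h0.1, h0.2]; simp)

lemma exists_dotProduct_eq_zero (p q : Fin 3 → k) :
    ∃ L : Fin 3 → k, L ≠ 0 ∧ L ⬝ᵥ p = 0 ∧ L ⬝ᵥ q = 0 := by
  have h : (Matrix.of ![p, q, q]).det = 0 := Matrix.det_zero_of_row_eq (i := 1) (j := 2) (by simp) rfl
  obtain ⟨L, hL, h0⟩ := Matrix.exists_mulVec_eq_zero_iff.mpr h
  exact ⟨L, hL, (dotProduct_comm _ _).trans (congrFun h0 0),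
    (dotProduct_comm _ _).trans (congrFun h0 1)⟩

end CrossProduct

/-! ### Line sections of the second cubic and the residual points on the first -/

namespace TernaryCubic
open PlaneCubic
variable {k : Type*} [Field k] {N : Fin 3 → Matrix (Fin 3) (Fin 3) k}

/-- Evaluating the determinant on the images of a basis adapted to the kernels will factor the cubic
along a line. -/
lemma ev_ofSlices_mul (N : Fin 3 → Matrix (Fin 3) (Fin 3) k) (u x y z : Fin 3 → k) :
    (ofSlices N).ev u * ((x ⨯₃ y) ⬝ᵥ z) =
      ((pencil N u *ᵥ x) ⨯₃ (pencil N u *ᵥ y)) ⬝ᵥ pencil N u *ᵥ z := by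
  rw [mulVec_crossProduct_dotProduct, ev_ofSlices']

/-- A pencil of maps between planes has a singular member. -/
lemma exists_pencil_mulVec_eq_zero [IsAlgClosed k] {T Z p q w : Fin 3 → k} (hw : w ≠ 0)
    (h : ∀ s t x y : k, w ⬝ᵥ pencil N (s • T + t • Z) *ᵥ (x • p + y • q) = 0) :
    ∃ s t x y : k, (s ≠ 0 ∨ t ≠ 0) ∧ (x ≠ 0 ∨ y ≠ 0) ∧
      pencil N (s • T + t • Z) *ᵥ (x • p + y • q) = 0 := by
  obtain ⟨f, g, hfg⟩ : ∃ f g : Fin 3 → k, w ⬝ᵥ f ⨯₃ g ≠ 0 := by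
    by_contra! h
    apply hw
    have h0 := h ![0, 1, 0] ![0, 0, 1]
    have h1 := h ![0, 0, 1] ![1, 0, 0]
    have h2 := h ![1, 0, 0] ![0, 1, 0]
    simp [cross_apply, dotProduct, Fin.sum_univ_three] at h0 h1 h2
    ext i
    fin_cases i <;> assumption
  have hinj {x : Fin 3 → k} (h1 : f ⬝ᵥ x = 0) (h2 : g ⬝ᵥ x = 0) (h3 : w ⬝ᵥ x = 0) : x = 0 := by
    have hfg' : f ⨯₃ g ≠ 0 := by rintro h; simp [h] at hfg
    obtain ⟨t, rfl⟩ := exists_eq_smul_crossProduct hfg' h1 h2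
    rw [dotProduct_smul, smul_eq_zero] at h3
    rw [h3.resolve_right hfg, zero_smul]
  -- f, g and w are coordinates of the target, and w vanishes on all images. A member is singular
  -- when the 2 × 2 determinant of the f- and g-coordinates vanishes, a binary quadratic condition
  -- on (s, t).
  obtain ⟨s, t, hst, h0⟩ := exists_binary_quadratic_zero
    ((f ⬝ᵥ pencil N T *ᵥ p) * (g ⬝ᵥ pencil N T *ᵥ q) - (f ⬝ᵥ pencil N T *ᵥ q) * (g ⬝ᵥ pencil N T *ᵥ p))
    ((f ⬝ᵥ pencil N T *ᵥ p) * (g ⬝ᵥ pencil N Z *ᵥ q) - (f ⬝ᵥ pencil N T *ᵥ q) * (g ⬝ᵥ pencil N Z *ᵥ p)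
      + (f ⬝ᵥ pencil N Z *ᵥ p) * (g ⬝ᵥ pencil N T *ᵥ q)
      - (f ⬝ᵥ pencil N Z *ᵥ q) * (g ⬝ᵥ pencil N T *ᵥ p))
    ((f ⬝ᵥ pencil N Z *ᵥ p) * (g ⬝ᵥ pencil N Z *ᵥ q) - (f ⬝ᵥ pencil N Z *ᵥ q) * (g ⬝ᵥ pencil N Z *ᵥ p))
  obtain ⟨x, y, hxy, h1, h2⟩ := exists_eq_zero_of_det_eq_zero
    (a := f ⬝ᵥ pencil N (s • T + t • Z) *ᵥ p) (b := f ⬝ᵥ pencil N (s • T + t • Z) *ᵥ q)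
    (c := g ⬝ᵥ pencil N (s • T + t • Z) *ᵥ p) (d := g ⬝ᵥ pencil N (s • T + t • Z) *ᵥ q) (by
      simp only [pencil_add_smul, Matrix.add_mulVec, Matrix.smul_mulVec, dotProduct_add,
        dotProduct_smul, smul_eq_mul]
      linear_combination h0)
  refine ⟨s, t, x, y, hst, hxy, hinj ?_ ?_ (h s t x y)⟩
  · simpa only [Matrix.mulVec_add, Matrix.mulVec_smul, dotProduct_add, dotProduct_smul, smul_eq_mul]
  · simpa only [Matrix.mulVec_add, Matrix.mulVec_smul, dotProduct_add, dotProduct_smul, smul_eq_mul]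

/-- u ↦ w N_u takes values in the plane orthogonal to v. If its rank were at most one, its kernel
would give a line on the cubic; so it is onto that plane, which contains L. -/
lemma Nonsingular.exists_vecMul_pencil_eq [IsAlgClosed k] [CharZero k]
    (hN : (ofSlices N).Nonsingular) {L v w : Fin 3 → k} (hv : v ≠ 0) (hLv : L ⬝ᵥ v = 0) (hw : w ≠ 0)
    (hwv : ∀ u, w ⬝ᵥ pencil N u *ᵥ v = 0) : ∃ Z, w ᵥ* pencil N Z = L := by
  let B : Matrix (Fin 3) (Fin 3) k := Matrix.of fun j => w ᵥ* N j
  have hB (u : Fin 3 → k) : w ᵥ* pencil N u = u ᵥ* B := by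
    ext i
    simp [B, pencil, Matrix.vecMul, dotProduct, Fin.sum_univ_three]
    ring
  have hBv : B *ᵥ v = 0 := eq_zero_of_forall_dotProduct fun u => by
    rw [dotProduct_comm, Matrix.dotProduct_mulVec, ← hB, ← Matrix.dotProduct_mulVec, hwv]
  have hcr : ∃ i, crossRows B i ≠ 0 := by
    by_contra! h
    have h' (i) : crossRows Bᵀ i = 0 := funext fun l => by rw [crossRows_transpose, h]; rfl
    obtain ⟨p, q, hpq, h0⟩ := exists_plane_of_crossRows_eq_zero h'
    obtain ⟨s, t, hst⟩ := hN.exists_ev_line_ne_zero hpq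
    apply hst
    rw [ev_ofSlices']
    refine Matrix.exists_vecMul_eq_zero_iff.mp ⟨w, hw, ?_⟩
    rw [hB, ← Matrix.mulVec_transpose, h0]
  obtain ⟨i, hi⟩ := hcr
  obtain ⟨t, rfl⟩ := exists_eq_smul_crossRows hi hBv
  obtain ⟨a, b, hab⟩ := exists_eq_smul_add_smul (x := L) hi (by
    rw [dotProduct_smul] at hLv
    exact (smul_eq_zero.mp hLv).resolve_left (by rintro rfl; simp at hv))
  refine ⟨a • Pi.single (i + 1) 1 + b • Pi.single (i + 2) 1, ?_⟩
  rw [hB, hab, Matrix.add_vecMul, Matrix.smul_vecMul, Matrix.smul_vecMul, Matrix.single_one_vecMul,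
    Matrix.single_one_vecMul]
  rfl

/-- The hyperplane sections of the second kind through a given point, in terms of the line sections
of the first plane cubic. -/
lemma Nonsingular.exists_isLineSection_swap [IsAlgClosed k] [CharZero k]
    (hN : (ofSlices N).Nonsingular) {L v w T : Fin 3 → k} (hL : L ≠ 0) (hv : v ≠ 0)
    (hLv : L ⬝ᵥ v = 0) (hw : w ≠ 0) (hwv : ∀ u, w ⬝ᵥ pencil N u *ᵥ v = 0) (hT : T ≠ 0)
    (hwT : w ᵥ* pencil N T = 0) : ∃ M u₁ u₂ v₁ v₂ : Fin 3 → k, M ≠ 0 ∧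
      pencil N u₁ *ᵥ v₁ = 0 ∧ pencil N u₂ *ᵥ v₂ = 0 ∧
      IsLineSection (ofSlices N) M ![T, u₁, u₂] ∧
      IsLineSection (ofSlices (TernaryCubic.swap N)) L ![v, v₁, v₂] := by
  -- Since w N_Z = L and w N_T = 0, each N_u with u in the span of T and Z maps the plane L · y = 0
  -- into the plane w · y = 0. The singular members of this pencil of maps between planes give u₁
  -- and u₂; T is the third zero of the determinant on this line.
  obtain ⟨Z, hZ⟩ := hN.exists_vecMul_pencil_eq hv hLv hw hwv
  have hTZ : LinearIndependent k ![T, Z] := by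
    rw [LinearIndependent.pair_iff]
    intro s t h
    have h1 := congrArg (fun u => w ᵥ* pencil N u) h
    simp only [pencil_add_smul, Matrix.vecMul_add, Matrix.vecMul_smul, hwT, hZ, smul_zero,
      zero_add] at h1
    have ht : t = 0 := by
      refine (smul_eq_zero.mp (h1.trans ?_)).resolve_right hL
      simp [pencil]
    rw [ht, zero_smul, add_zero] at h
    exact ⟨(smul_eq_zero.mp h).resolve_right hT, ht⟩
  obtain ⟨p, q, hpq, hp, hq⟩ := exists_line_basis hL
  have hw0 (s t : k) (y : Fin 3 → k) : w ⬝ᵥ pencil N (s • T + t • Z) *ᵥ y = t * (L ⬝ᵥ y) := by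
    rw [Matrix.dotProduct_mulVec, pencil_add_smul, Matrix.vecMul_add, Matrix.vecMul_smul,
      Matrix.vecMul_smul, hwT, hZ, smul_zero, zero_add, smul_dotProduct, smul_eq_mul]
  obtain ⟨s₁, t₁, x₁, y₁, hst, hxy, h₁⟩ := exists_pencil_mulVec_eq_zero (N := N) (T := T) (Z := Z)
    (p := p) (q := q) hw (fun s t x y => by
      rw [hw0, dotProduct_add, dotProduct_smul, dotProduct_smul, hp, hq]; simp)
  have hM := crossProduct_ne_zero_iff_linearIndependent.mpr hTZ
  have hMT : (T ⨯₃ Z) ⬝ᵥ T = 0 := by rw [dotProduct_comm, dot_self_cross]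
  have hMZ : (T ⨯₃ Z) ⬝ᵥ Z = 0 := by rw [dotProduct_comm, dot_cross_self]
  obtain ⟨u₁, hu₁⟩ : ∃ u, u = s₁ • T + t₁ • Z := ⟨_, rfl⟩
  obtain ⟨v₁, hv₁⟩ : ∃ v, v = x₁ • p + y₁ • q := ⟨_, rfl⟩
  rw [← hu₁, ← hv₁] at h₁
  have hu₁0 : u₁ ≠ 0 := by
    intro h
    have := LinearIndependent.pair_iff.mp hTZ _ _ (hu₁ ▸ h)
    tauto
  have hv₁0 : v₁ ≠ 0 := by
    intro h
    have := LinearIndependent.pair_iff.mp hpq _ _ (hv₁ ▸ h)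
    tauto
  have hMu₁ : (T ⨯₃ Z) ⬝ᵥ u₁ = 0 := by
    rw [hu₁, dotProduct_add, dotProduct_smul, dotProduct_smul, hMT, hMZ]; simp
  have hLv₁ : L ⬝ᵥ v₁ = 0 := by
    rw [hv₁, dotProduct_add, dotProduct_smul, dotProduct_smul, hp, hq]; simp
  obtain ⟨u', hMu', huu⟩ := LinearIndependent.exists_pair_of_ne_zero hM hMT hMZ hTZ hMu₁ hu₁0
  obtain ⟨v', hLv', hvv⟩ := LinearIndependent.exists_pair_of_ne_zero hL hp hq hpq hLv₁ hv₁0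
  have hker (u y : Fin 3 → k) (hu : (T ⨯₃ Z) ⬝ᵥ u = 0) (hy : L ⬝ᵥ y = 0) :
      w ⬝ᵥ pencil N u *ᵥ y = 0 := by
    obtain ⟨s, t, rfl⟩ := exists_eq_of_dotProduct_eq_zero hM hTZ hMT hMZ hu
    rw [hw0, hy, mul_zero]
  obtain ⟨h, hwh⟩ := exists_dotProduct_eq hw 1
  obtain ⟨e, he⟩ := exists_dotProduct_eq (crossProduct_ne_zero_iff_linearIndependent.mpr hvv) 1
  obtain ⟨U, hU⟩ := exists_dotProduct_eq (crossProduct_ne_zero_iff_linearIndependent.mpr huu) 1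
  -- As N_{u₁} v₁ = 0, the vectors b, c, d describe the pencil in the bases u₁, u' and v₁, v'. Their
  -- minors β, γ, δ yield the second singular member u₂ = γu₁ + βu' with kernel vector v₂ = δv₁ -
  -- βv'.
  obtain ⟨b, hb⟩ : ∃ b, b = pencil N u₁ *ᵥ v' := ⟨_, rfl⟩
  obtain ⟨c, hc⟩ : ∃ c, c = pencil N u' *ᵥ v₁ := ⟨_, rfl⟩
  obtain ⟨d, hd⟩ : ∃ d, d = pencil N u' *ᵥ v' := ⟨_, rfl⟩
  have hwb : w ⬝ᵥ b = 0 := hb ▸ hker _ _ hMu₁ hLv'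
  have hwc : w ⬝ᵥ c = 0 := hc ▸ hker _ _ hMu' hLv₁
  have hwd : w ⬝ᵥ d = 0 := hd ▸ hker _ _ hMu' hLv'
  have hpl := smul_sub_smul_add_smul hwh hwb hwc hwd
  have hbc := crossProduct_eq_smul hwh hwb hwc
  have hcd := crossProduct_eq_smul hwh hwc hwd
  have hbd := crossProduct_eq_smul hwh hwb hwd
  generalize h ⬝ᵥ b ⨯₃ c = β at hpl hbc
  generalize h ⬝ᵥ c ⨯₃ d = γ at hpl hcd
  generalize h ⬝ᵥ b ⨯₃ d = δ at hpl hbd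
  -- The first factor is the w-coordinate of N_u e, which vanishes at T; the others belong to u₁ and
  -- u₂.
  have hS (s t : k) : (ofSlices N).ev (s • u₁ + t • u') = 1 *
      ((s * (w ⬝ᵥ pencil N u₁ *ᵥ e) - t * -(w ⬝ᵥ pencil N u' *ᵥ e)) * (s * 0 - t * 1) *
        (s * β - t * γ)) := by
    have h1 := ev_ofSlices_mul N (s • u₁ + t • u') v₁ v' e
    rw [he] at h1
    simp only [pencil_add_smul, Matrix.add_mulVec, Matrix.smul_mulVec, h₁, ← hb, ← hc, ← hd,
      smul_zero, zero_add, map_add, map_smul, LinearMap.smul_apply, hcd,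
      ← cross_anticomm b c, hbc] at h1
    simp only [add_dotProduct, smul_dotProduct, dotProduct_add, dotProduct_smul, neg_dotProduct,
      smul_eq_mul] at h1
    linear_combination h1
  have hS' (s t : k) : (ofSlices (TernaryCubic.swap N)).ev (s • v₁ + t • v') = 1 *
      ((s * (w ⬝ᵥ pencil N U *ᵥ v₁) - t * -(w ⬝ᵥ pencil N U *ᵥ v')) * (s * 0 - t * 1) *
        (s * -β - t * δ)) := by
    have h1 := ev_ofSlices_mul (TernaryCubic.swap N) (s • v₁ + t • v') u₁ u' U
    rw [hU] at h1
    simp only [pencil_swap_mulVec, Matrix.mulVec_add, Matrix.mulVec_smul, h₁, ← hb, ← hc, ← hd,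
      smul_zero, zero_add, map_add, map_smul, LinearMap.smul_apply, hbd, hbc] at h1
    simp only [add_dotProduct, smul_dotProduct, dotProduct_add, dotProduct_smul,
      smul_eq_mul] at h1
    linear_combination h1
  obtain ⟨s₂, t₂, hne⟩ := hN.exists_ev_line_ne_zero huu
  obtain ⟨s₃, t₃, hne'⟩ := hN.swap.exists_ev_line_ne_zero hvv
  obtain ⟨τ₁, τ₂, hτ⟩ := exists_eq_of_dotProduct_eq_zero hM huu hMu₁ hMu' hMT
  obtain ⟨ν₁, ν₂, hν⟩ := exists_eq_of_dotProduct_eq_zero hL hvv hLv₁ hLv' hLv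
  have hτ0 : τ₁ * (w ⬝ᵥ pencil N u₁ *ᵥ e) + τ₂ * (w ⬝ᵥ pencil N u' *ᵥ e) = 0 := by
    have h1 : w ⬝ᵥ pencil N T *ᵥ e = 0 := by rw [Matrix.dotProduct_mulVec, hwT, zero_dotProduct]
    rw [hτ] at h1
    simpa only [pencil_add_smul, Matrix.add_mulVec, Matrix.smul_mulVec, dotProduct_add,
      dotProduct_smul, smul_eq_mul] using h1
  have hν0 : ν₁ * (w ⬝ᵥ pencil N U *ᵥ v₁) + ν₂ * (w ⬝ᵥ pencil N U *ᵥ v') = 0 := by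
    have h1 := hwv U
    rw [hν] at h1
    simpa only [Matrix.mulVec_add, Matrix.mulVec_smul, dotProduct_add,
      dotProduct_smul, smul_eq_mul] using h1
  obtain ⟨c₁, hc₁, h11, h12⟩ := exists_eq_mul_of_mul_add_mul_eq_zero
    (LinearIndependent.ne_zero_or_ne_zero hT hτ) (by
      by_contra! h; rw [hS, h.1, h.2] at hne; simp at hne) hτ0
  obtain ⟨c₂, hc₂, h21, h22⟩ := exists_eq_mul_of_mul_add_mul_eq_zero
    (LinearIndependent.ne_zero_or_ne_zero hv hν) (by
      by_contra! h; rw [hS', h.1, h.2] at hne'; simp at hne') hν0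
  have hu₂ : γ • u₁ + β • u' ≠ 0 := by
    intro h
    have := LinearIndependent.pair_iff.mp huu _ _ h
    rw [hS, this.1, this.2] at hne; simp at hne
  have hv₂ : δ • v₁ + (-β) • v' ≠ 0 := by
    intro h
    have := LinearIndependent.pair_iff.mp hvv _ _ h
    rw [hS', this.1, this.2] at hne'; simp at hne'
  refine ⟨T ⨯₃ Z, u₁, γ • u₁ + β • u', v₁, δ • v₁ + (-β) • v', hM, h₁, ?_,
    ⟨u₁, u', ![-(w ⬝ᵥ pencil N u' *ᵥ e), 1, γ], ![w ⬝ᵥ pencil N u₁ *ᵥ e, 0, β], 1, huu, hMu₁, hMu',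
      one_ne_zero, fun i => ?_, hS⟩,
    ⟨v₁, v', ![-(w ⬝ᵥ pencil N U *ᵥ v'), 1, δ], ![w ⬝ᵥ pencil N U *ᵥ v₁, 0, -β], 1, hvv, hLv₁, hLv',
      one_ne_zero, fun i => ?_, hS'⟩⟩
  · simp only [pencil_add_smul, Matrix.add_mulVec, Matrix.smul_mulVec, Matrix.mulVec_add,
      Matrix.mulVec_smul, h₁, ← hb, ← hc, ← hd]
    -- N_{u₂} v₂ is -β times the linear relation between b, c and d.
    linear_combination (norm := module) (-β) • hpl
  · fin_cases i
    · refine ⟨hT, c₁, hc₁, ?_⟩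
      simp only [Matrix.cons_val_zero, Fin.zero_eta]
      rw [h11, h12, hτ]
      module
    · exact ⟨hu₁0, 1, one_ne_zero, by simp⟩
    · exact ⟨hu₂, 1, one_ne_zero, by simp⟩
  · fin_cases i
    · refine ⟨hv, c₂, hc₂, ?_⟩
      simp only [Matrix.cons_val_zero, Fin.zero_eta]
      rw [h21, h22, hν]
      module
    · exact ⟨hv₁0, 1, one_ne_zero, by simp⟩
    · exact ⟨hv₂, 1, one_ne_zero, by simp⟩

end TernaryCubic

/-! ### Evaluation of ξ and η in the normal form -/

lemma Matrix.vecMul_fin_three {R : Type*} [CommRing R] (x y z a b c d e f g h i : R) :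
    ![x, y, z] ᵥ* !![a, b, c; d, e, f; g, h, i] =
      ![x * a + y * d + z * g, x * b + y * e + z * h, x * c + y * f + z * i] := by
  ext j
  fin_cases j <;> simp [Matrix.vecMul, dotProduct, Fin.sum_univ_three]

namespace TernaryCubic
variable {k : Type*} [Field k]

/-- Pushing a row vector through ξ avoids products of full matrices; where ξ is scalar, one entry of
one row determines it. -/
lemma vecMul_xi (F : TernaryCubic k) (M₁ M₂ : Matrix (Fin 3) (Fin 3) k) (w : Fin 3 → k) :
    w ᵥ* F.xi M₁ M₂ = F.c^2 • w ᵥ* M₁ ᵥ* M₂ ᵥ* M₁ ᵥ* M₂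
      - (F.c • (F.c • w ᵥ* M₂ ᵥ* M₂ + F.c2 • w ᵥ* M₂ + F.b3 • w) ᵥ* M₁ ᵥ* M₁
        + F.c1 • (F.c • w ᵥ* M₂ ᵥ* M₂ + F.c2 • w ᵥ* M₂ + F.b3 • w) ᵥ* M₁
        + F.a3 • (F.c • w ᵥ* M₂ ᵥ* M₂ + F.c2 • w ᵥ* M₂ + F.b3 • w))
      + (F.c * F.m - F.c1 * F.c2) • w ᵥ* M₁ ᵥ* M₂ + (F.a3 * F.b3) • w := by
  simp only [xi, Algebra.algebraMap_eq_smul_one, Matrix.vecMul_add, Matrix.vecMul_sub,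
    Matrix.vecMul_smul, Matrix.vecMul_one, pow_two (M₁ * M₂), pow_two M₁, pow_two M₂,
    ← Matrix.vecMul_vecMul, Matrix.add_vecMul, Matrix.smul_vecMul, smul_add, smul_smul]

/-- R, S, T are right multiplications by r, s, t, so their order is reversed: w times rst is T (S (R
w)). -/
lemma vecMul_eta (F : TernaryCubic k) (M₁ M₂ : Matrix (Fin 3) (Fin 3) k) (w : Fin 3 → k) :
    ∃ R S T : (Fin 3 → k) → Fin 3 → k,
      (∀ v, R v = F.c • v ᵥ* M₂ ᵥ* M₁ ᵥ* M₁ + F.c1 • v ᵥ* M₂ ᵥ* M₁ + F.a3 • v ᵥ* M₂) ∧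
      (∀ v, S v = -(F.c • v ᵥ* M₂ ᵥ* M₂ + F.c2 • v ᵥ* M₂ + F.b3 • v)) ∧
      (∀ v, T v = F.c • v ᵥ* M₁) ∧
      w ᵥ* F.eta M₁ M₂ = T (S (R w)) + R (T (S w)) + S (R (T w))
        + F.a2 • (T (S w) + S (T w)) + F.b3 • (R (T w) + T (R w))
        + F.c1 • (S (R w) + R (S w)) + (F.b3 * F.c1 - F.b1 * F.c) • R w
        + (F.c1 * F.a2 - F.c2 * F.a) • S w + (F.a2 * F.b3 - F.a3 * F.b) • T w
        + (-6 * F.a * F.b * F.c + F.a2 * F.b3 * F.c1) • w := by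
  refine ⟨_, _, _, fun v => rfl, fun v => rfl, fun v => rfl, ?_⟩
  simp only [eta, Algebra.algebraMap_eq_smul_one, Matrix.vecMul_add, Matrix.vecMul_neg,
    Matrix.vecMul_smul, Matrix.vecMul_one, pow_two,
    ← Matrix.vecMul_vecMul, Matrix.add_vecMul, Matrix.smul_vecMul, Matrix.neg_vecMul]

-- Here w = (0, 0, 1) and v = (1, 0, 0); solving w N_T = 0 and N_R v = 0 gives T = (1, 0, l₃) and R
-- = (m₂, -n, m₂l₁ - nm₁). With C = (0, 0, 1) the determinant of T, R, C is -n, and x is the last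
-- diagonal entry of ξ.
set_option maxHeartbeats 4000000 in
lemma diffX_subst_normalForm {F : TernaryCubic k} {l₁ s g n l₂ h l₃ m₁ p m₂ q r x : k}
    (hF : F = ⟨l₃ * (l₁ * l₂ - s * n), -(m₁ * q - p * m₂), -1,
      l₃ * (m₁ * l₂ - s * m₂) + r * (l₁ * l₂ - s * n) - (l₁ * h - g * n),
      -(l₃ * (l₁ + l₂)) - (l₁ * l₂ - s * n),
      r * (m₁ * l₂ - s * m₂) - (l₁ * q + m₁ * h - g * m₂ - p * n),
      q - r * m₁, l₃ + (l₁ + l₂), r + m₁,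
      h - l₃ * m₁ - r * (l₁ + l₂) - (m₁ * l₂ - s * m₂)⟩)
    (hx : F.xi !![l₁, s, g; n, l₂, h; 0, 0, l₃] !![m₁, 0, p; m₂, 0, q; 0, 1, r] =
      algebraMap _ _ x) :
    (-n) ^ 2 * (12 * x + F.jacobian.b₂) =
      (F.subst ![1, 0, l₃] ![m₂, -n, m₂ * l₁ - n * m₁] ![0, 0, 1]).diffX := by
  have key := congrFun (congrArg (fun M => ![0, 0, 1] ᵥ* M) hx) 2
  simp only [Algebra.algebraMap_eq_smul_one, Matrix.vecMul_smul, Matrix.vecMul_one, vecMul_xi,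
    Matrix.vecMul_fin_three, Matrix.smul_cons, Matrix.smul_empty, smul_eq_mul, Matrix.add_cons,
    Matrix.head_cons, Matrix.tail_cons, Matrix.empty_add_empty, Pi.smul_apply, Matrix.cons_val,
    mul_zero, zero_mul, mul_one, one_mul, add_zero, zero_add, Matrix.sub_cons, Matrix.zero_empty,
    sub_self, Pi.add_apply] at key
  rw [← key]
  subst hF
  simp only [diffX, jacobian, WeierstrassCurve.b₂, subst, ev, gradient, hessian, Matrix.cons_val,
    Matrix.of_apply, Matrix.cons_val_zero, Matrix.cons_val_one, Matrix.mulVec, dotProduct,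
    Fin.sum_univ_three]
  ring

set_option maxHeartbeats 4000000 in
lemma diffY_subst_normalForm {F : TernaryCubic k} {l₁ s g n l₂ h l₃ m₁ p m₂ q r x y : k}
    (hF : F = ⟨l₃ * (l₁ * l₂ - s * n), -(m₁ * q - p * m₂), -1,
      l₃ * (m₁ * l₂ - s * m₂) + r * (l₁ * l₂ - s * n) - (l₁ * h - g * n),
      -(l₃ * (l₁ + l₂)) - (l₁ * l₂ - s * n),
      r * (m₁ * l₂ - s * m₂) - (l₁ * q + m₁ * h - g * m₂ - p * n),
      q - r * m₁, l₃ + (l₁ + l₂), r + m₁,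
      h - l₃ * m₁ - r * (l₁ + l₂) - (m₁ * l₂ - s * m₂)⟩)
    (hx : F.xi !![l₁, s, g; n, l₂, h; 0, 0, l₃] !![m₁, 0, p; m₂, 0, q; 0, 1, r] =
      algebraMap _ _ x)
    (hy : F.eta !![l₁, s, g; n, l₂, h; 0, 0, l₃] !![m₁, 0, p; m₂, 0, q; 0, 1, r] =
      algebraMap _ _ y) :
    (-n) ^ 3 * (2 * y + F.jacobian.a₁ * x + F.jacobian.a₃) =
      (F.subst ![1, 0, l₃] ![m₂, -n, m₂ * l₁ - n * m₁] ![0, 0, 1]).diffY := by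
  have key := congrFun (congrArg (fun M => ![0, 0, 1] ᵥ* M) hx) 2
  have key' := congrFun (congrArg (fun M => ![0, 0, 1] ᵥ* M) hy) 2
  obtain ⟨R, S, T, hR, hS, hT, hη⟩ := vecMul_eta F !![l₁, s, g; n, l₂, h; 0, 0, l₃]
    !![m₁, 0, p; m₂, 0, q; 0, 1, r] ![0, 0, 1]
  rw [hη] at key'
  simp only [Algebra.algebraMap_eq_smul_one, Matrix.vecMul_smul, Matrix.vecMul_one, vecMul_xi,
    hR, hS, hT,
    Matrix.vecMul_fin_three, Matrix.smul_cons, Matrix.smul_empty, smul_eq_mul, Matrix.add_cons,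
    Matrix.head_cons, Matrix.tail_cons, Matrix.empty_add_empty, Pi.smul_apply, Matrix.cons_val,
    mul_zero, zero_mul, mul_one, one_mul, add_zero, zero_add, Matrix.sub_cons, Matrix.zero_empty,
    Matrix.neg_cons, Matrix.neg_empty, sub_self, Pi.add_apply] at key key'
  rw [← key, ← key']
  subst hF
  simp only [diffY, jacobian, subst, ev, gradient, hessian, Matrix.cons_val,
    Matrix.of_apply, Matrix.cons_val_zero, Matrix.cons_val_one, Matrix.mulVec, dotProduct,
    Fin.sum_univ_three]
  ring

-- The alternative C = (0, 1, 0) serves when n = 0, that is, when (0, 0, 1) is collinear with T and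
-- R.
set_option maxHeartbeats 4000000 in
lemma diffX_subst_normalForm' {F : TernaryCubic k} {l₁ s g n l₂ h l₃ m₁ p m₂ q r x : k}
    (hF : F = ⟨l₃ * (l₁ * l₂ - s * n), -(m₁ * q - p * m₂), -1,
      l₃ * (m₁ * l₂ - s * m₂) + r * (l₁ * l₂ - s * n) - (l₁ * h - g * n),
      -(l₃ * (l₁ + l₂)) - (l₁ * l₂ - s * n),
      r * (m₁ * l₂ - s * m₂) - (l₁ * q + m₁ * h - g * m₂ - p * n),
      q - r * m₁, l₃ + (l₁ + l₂), r + m₁,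
      h - l₃ * m₁ - r * (l₁ + l₂) - (m₁ * l₂ - s * m₂)⟩)
    (hx : F.xi !![l₁, s, g; n, l₂, h; 0, 0, l₃] !![m₁, 0, p; m₂, 0, q; 0, 1, r] =
      algebraMap _ _ x) :
    (m₂ * (l₃ - l₁) + n * m₁) ^ 2 * (12 * x + F.jacobian.b₂) =
      (F.subst ![1, 0, l₃] ![m₂, -n, m₂ * l₁ - n * m₁] ![0, 1, 0]).diffX := by
  have key := congrFun (congrArg (fun M => ![0, 0, 1] ᵥ* M) hx) 2
  simp only [Algebra.algebraMap_eq_smul_one, Matrix.vecMul_smul, Matrix.vecMul_one, vecMul_xi,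
    Matrix.vecMul_fin_three, Matrix.smul_cons, Matrix.smul_empty, smul_eq_mul, Matrix.add_cons,
    Matrix.head_cons, Matrix.tail_cons, Matrix.empty_add_empty, Pi.smul_apply, Matrix.cons_val,
    mul_zero, zero_mul, mul_one, one_mul, add_zero, zero_add, Matrix.sub_cons, Matrix.zero_empty,
    sub_self, Pi.add_apply] at key
  rw [← key]
  subst hF
  simp only [diffX, jacobian, WeierstrassCurve.b₂, subst, ev, gradient, hessian, Matrix.cons_val,
    Matrix.of_apply, Matrix.cons_val_zero, Matrix.cons_val_one, Matrix.mulVec, dotProduct,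
    Fin.sum_univ_three]
  ring

set_option maxHeartbeats 4000000 in
lemma diffY_subst_normalForm' {F : TernaryCubic k} {l₁ s g n l₂ h l₃ m₁ p m₂ q r x y : k}
    (hF : F = ⟨l₃ * (l₁ * l₂ - s * n), -(m₁ * q - p * m₂), -1,
      l₃ * (m₁ * l₂ - s * m₂) + r * (l₁ * l₂ - s * n) - (l₁ * h - g * n),
      -(l₃ * (l₁ + l₂)) - (l₁ * l₂ - s * n),
      r * (m₁ * l₂ - s * m₂) - (l₁ * q + m₁ * h - g * m₂ - p * n),
      q - r * m₁, l₃ + (l₁ + l₂), r + m₁,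
      h - l₃ * m₁ - r * (l₁ + l₂) - (m₁ * l₂ - s * m₂)⟩)
    (hx : F.xi !![l₁, s, g; n, l₂, h; 0, 0, l₃] !![m₁, 0, p; m₂, 0, q; 0, 1, r] =
      algebraMap _ _ x)
    (hy : F.eta !![l₁, s, g; n, l₂, h; 0, 0, l₃] !![m₁, 0, p; m₂, 0, q; 0, 1, r] =
      algebraMap _ _ y) :
    (m₂ * (l₃ - l₁) + n * m₁) ^ 3 * (2 * y + F.jacobian.a₁ * x + F.jacobian.a₃) =
      (F.subst ![1, 0, l₃] ![m₂, -n, m₂ * l₁ - n * m₁] ![0, 1, 0]).diffY := by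
  have key := congrFun (congrArg (fun M => ![0, 0, 1] ᵥ* M) hx) 2
  have key' := congrFun (congrArg (fun M => ![0, 0, 1] ᵥ* M) hy) 2
  obtain ⟨R, S, T, hR, hS, hT, hη⟩ := vecMul_eta F !![l₁, s, g; n, l₂, h; 0, 0, l₃]
    !![m₁, 0, p; m₂, 0, q; 0, 1, r] ![0, 0, 1]
  rw [hη] at key'
  simp only [Algebra.algebraMap_eq_smul_one, Matrix.vecMul_smul, Matrix.vecMul_one, vecMul_xi,
    hR, hS, hT,
    Matrix.vecMul_fin_three, Matrix.smul_cons, Matrix.smul_empty, smul_eq_mul, Matrix.add_cons,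
    Matrix.head_cons, Matrix.tail_cons, Matrix.empty_add_empty, Pi.smul_apply, Matrix.cons_val,
    mul_zero, zero_mul, mul_one, one_mul, add_zero, zero_add, Matrix.sub_cons, Matrix.zero_empty,
    Matrix.neg_cons, Matrix.neg_empty, sub_self, Pi.add_apply] at key key'
  rw [← key, ← key']
  subst hF
  simp only [diffY, jacobian, subst, ev, gradient, hessian, Matrix.cons_val,
    Matrix.of_apply, Matrix.cons_val_zero, Matrix.cons_val_one, Matrix.mulVec, dotProduct,
    Fin.sum_univ_three]
  ring

lemma ofSlices_normalForm (l₁ s g n l₂ h l₃ m₁ p m₂ q r : k) :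
    ofSlices ![!![l₁, s, g; n, l₂, h; 0, 0, l₃], !![m₁, 0, p; m₂, 0, q; 0, 1, r], -1] =
      ⟨l₃ * (l₁ * l₂ - s * n), -(m₁ * q - p * m₂), -1,
      l₃ * (m₁ * l₂ - s * m₂) + r * (l₁ * l₂ - s * n) - (l₁ * h - g * n),
      -(l₃ * (l₁ + l₂)) - (l₁ * l₂ - s * n),
      r * (m₁ * l₂ - s * m₂) - (l₁ * q + m₁ * h - g * m₂ - p * n),
      q - r * m₁, l₃ + (l₁ + l₂), r + m₁,
      h - l₃ * m₁ - r * (l₁ + l₂) - (m₁ * l₂ - s * m₂)⟩ := by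
  have h1 : (-1 : Matrix (Fin 3) (Fin 3) k) = !![-1, 0, 0; 0, -1, 0; 0, 0, -1] := by
    rw [Matrix.one_fin_three]
    simp only [Matrix.neg_of, Matrix.neg_cons, Matrix.neg_empty, neg_zero]
  rw [h1]
  simp only [ofSlices, mk.injEq, Matrix.det_fin_three, Matrix.of_apply, Matrix.cons_val]
  refine ⟨?_, ?_, ?_, ?_, ?_, ?_, ?_, ?_, ?_, ?_⟩ <;> ring

end TernaryCubic

/-! ### Change of scalars, and the normal form of a pair of matrices -/

namespace TernaryCubic

section Map
variable {K k A B : Type*} [Field K] [Field k] [Ring A] [Algebra K A] [Ring B] [Algebra k B]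
  (F : TernaryCubic K) {σ : K →+* k} {φ : A →+* B}

/-- This and the next two lemmas apply to extension of scalars from K to k and, with σ the identity,
to quotient maps and to conjugation. -/
lemma map_relator (hφ : ∀ c, φ (algebraMap K A c) = algebraMap k B (σ c)) (x y : A) (i : Fin 4) :
    φ (F.relator x y i) = (F.map σ).relator (φ x) (φ y) i := by
  fin_cases i <;> simp [relator, map, Algebra.smul_def, hφ]

lemma map_xi (hφ : ∀ c, φ (algebraMap K A c) = algebraMap k B (σ c)) (x y : A) :
    φ (F.xi x y) = (F.map σ).xi (φ x) (φ y) := by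
  simp [xi, map, Algebra.smul_def, hφ]

lemma map_eta (hφ : ∀ c, φ (algebraMap K A c) = algebraMap k B (σ c)) (x y : A) :
    φ (F.eta x y) = (F.map σ).eta (φ x) (φ y) := by
  simp [eta, map, Algebra.smul_def, hφ, map_ofNat σ 6]

/-- ξ has degree 2 and η degree 3 in the coefficients of F, matching the weights of the coordinates
on the Jacobian. -/
lemma xi_scale (κ : K) (x y : A) : (F.scale κ).xi x y = κ ^ 2 • F.xi x y := by
  simp only [xi, scale, Algebra.algebraMap_eq_smul_one, mul_add, add_mul, smul_mul_assoc,
    mul_smul_comm, mul_one, one_mul]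
  module

lemma eta_scale (κ : K) (x y : A) : (F.scale κ).eta x y = κ ^ 3 • F.eta x y := by
  simp only [eta, scale, Algebra.algebraMap_eq_smul_one, mul_add, add_mul, smul_mul_assoc,
    mul_smul_comm, mul_one, one_mul, smul_smul, mul_neg, neg_mul]
  module

end Map

variable {k : Type*} [Field k]

/-- Conjugation of matrices. -/
def conj (P Q : Matrix (Fin 3) (Fin 3) k) (h : P * Q = 1) (h' : Q * P = 1) :
    Matrix (Fin 3) (Fin 3) k →+* Matrix (Fin 3) (Fin 3) k where
  toFun A := Q * A * P
  map_one' := by rw [mul_one, h']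
  map_mul' A B := by
    simp only [mul_assoc]
    rw [← mul_assoc P Q, h, one_mul]
  map_zero' := by simp
  map_add' A B := by rw [mul_add, add_mul]

lemma neg_one_fin_three :
    (-1 : Matrix (Fin 3) (Fin 3) k) = !![-1, 0, 0; 0, -1, 0; 0, 0, -1] := by
  rw [Matrix.one_fin_three]
  simp only [Matrix.neg_of, Matrix.neg_cons, Matrix.neg_empty, neg_zero]

lemma pencil_neg_one (X Y : Matrix (Fin 3) (Fin 3) k) (u : Fin 3 → k) :
    pencil ![X, Y, -1] u = u 0 • X + u 1 • Y - u 2 • 1 := by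
  simp only [pencil, Fin.sum_univ_three, Matrix.cons_val, smul_neg, sub_eq_add_neg]

/-- w is a left eigenvector of X, and v is orthogonal to w and wY, so w N_u v = 0 for all u. With w
· e = 0 and wY · e = 1, the basis v, e, Ye produces the zeros and ones. -/
lemma exists_normalForm [IsAlgClosed k] [CharZero k] {X Y : Matrix (Fin 3) (Fin 3) k}
    (hN : (ofSlices ![X, Y, -1]).Nonsingular) :
    ∃ (P Q : Matrix (Fin 3) (Fin 3) k) (l₁ s g n l₂ h l₃ m₁ p m₂ q r : k), P * Q = 1 ∧ Q * P = 1 ∧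
      Q * X * P = !![l₁, s, g; n, l₂, h; 0, 0, l₃] ∧
      Q * Y * P = !![m₁, 0, p; m₂, 0, q; 0, 1, r] := by
  obtain ⟨l₃, hl⟩ := Module.End.exists_eigenvalue (Matrix.toLin' Xᵀ)
  obtain ⟨w, hw⟩ := hl.exists_hasEigenvector
  have hwX : w ᵥ* X = l₃ • w := by
    rw [← Matrix.mulVec_transpose, ← Matrix.toLin'_apply]
    exact hw.apply_eq_smul
  have hw0 : w ≠ 0 := hw.2
  -- If wY were a multiple of w, then w N_u = 0 would hold for all u on a line, which would lie on
  -- the cubic.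
  have hli : LinearIndependent k ![w, w ᵥ* Y] := by
    by_contra hcon
    rw [LinearIndependent.pair_iff' hw0] at hcon
    push Not at hcon
    obtain ⟨μ, hμ⟩ := hcon
    have hpq : LinearIndependent k ![![1, 0, l₃], ![0, 1, μ]] := by
      rw [LinearIndependent.pair_iff]
      intro s t h
      have h0 := congrFun h 0
      have h1 := congrFun h 1
      simpa using And.intro h0 h1
    obtain ⟨s, t, hst⟩ := hN.exists_ev_line_ne_zero hpq
    apply hst
    rw [ev_ofSlices']
    refine Matrix.exists_vecMul_eq_zero_iff.mp ⟨w, hw0, ?_⟩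
    rw [pencil_neg_one, Matrix.vecMul_sub, Matrix.vecMul_add, Matrix.vecMul_smul,
      Matrix.vecMul_smul, Matrix.vecMul_smul, Matrix.vecMul_one, hwX, ← hμ]
    simp
    module
  have hcr := crossProduct_ne_zero_iff_linearIndependent.mpr hli
  obtain ⟨f, hf⟩ := exists_dotProduct_eq hcr 1
  obtain ⟨v, hv⟩ : ∃ v, v = w ⨯₃ (w ᵥ* Y) := ⟨_, rfl⟩
  obtain ⟨e, he⟩ : ∃ e, e = f ⨯₃ w := ⟨_, rfl⟩
  have hwv : w ⬝ᵥ v = 0 := by rw [hv, dot_self_cross]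
  have hYv : w ᵥ* Y ⬝ᵥ v = 0 := by rw [hv, dot_cross_self]
  have hwe : w ⬝ᵥ e = 0 := by rw [he, dot_cross_self]
  have hYe : w ᵥ* Y ⬝ᵥ e = 1 := by
    rw [he, triple_product_permutation, dotProduct_comm, hf]
  have hwYe : w ⬝ᵥ Y *ᵥ e = 1 := by rw [Matrix.dotProduct_mulVec, hYe]
  let P : Matrix (Fin 3) (Fin 3) k := (Matrix.of ![v, e, Y *ᵥ e])ᵀ
  have hPm (x : Fin 3 → k) : P *ᵥ x = x 0 • v + x 1 • e + x 2 • Y *ᵥ e := by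
    rw [Matrix.mulVec_transpose]
    ext i
    simp [Matrix.vecMul, dotProduct, Fin.sum_univ_three]
  have hPv (x : Fin 3 → k) : x ᵥ* P = ![x ⬝ᵥ v, x ⬝ᵥ e, x ⬝ᵥ Y *ᵥ e] := by
    rw [Matrix.vecMul_transpose]
    ext i
    fin_cases i <;> exact dotProduct_comm _ _
  have hdet : P.det ≠ 0 := by
    intro h0
    obtain ⟨c, hc0, hc⟩ := Matrix.exists_mulVec_eq_zero_iff.mpr h0
    have h1 : w ᵥ* P ⬝ᵥ c = 0 := by rw [← Matrix.dotProduct_mulVec, hc, dotProduct_zero]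
    have h2 : w ᵥ* Y ᵥ* P ⬝ᵥ c = 0 := by rw [← Matrix.dotProduct_mulVec, hc, dotProduct_zero]
    rw [hPv, hwv, hwe, hwYe] at h1
    rw [hPv, hYv, hYe] at h2
    simp [dotProduct, Fin.sum_univ_three] at h1 h2
    rw [h1] at h2
    simp at h2
    rw [hPm, h1, h2] at hc
    simp at hc
    rcases hc with hc | hc
    · apply hc0
      ext i
      fin_cases i <;> assumption
    · exact hcr (hv ▸ hc)
  have hPQ : P * P⁻¹ = 1 := Matrix.mul_nonsing_inv _ hdet.isUnit
  have hQP : P⁻¹ * P = 1 := Matrix.nonsing_inv_mul _ hdet.isUnit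
  have hwQ : ![0, 0, 1] ᵥ* P⁻¹ = w := by
    rw [← hwYe]
    nth_rw 1 [← hwv]
    rw [← hwe, ← hPv, Matrix.vecMul_vecMul, hPQ, Matrix.vecMul_one]
  have hr1 : ![0, 0, 1] ᵥ* (P⁻¹ * X * P) = ![0, 0, l₃] := by
    rw [← Matrix.vecMul_vecMul, ← Matrix.vecMul_vecMul, hwQ, hwX, Matrix.smul_vecMul, hPv, hwv, hwe,
      hwYe]
    simp
  have hr2 : ![0, 0, 1] ᵥ* (P⁻¹ * Y * P) = ![0, 1, w ᵥ* Y ⬝ᵥ Y *ᵥ e] := by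
    rw [← Matrix.vecMul_vecMul, ← Matrix.vecMul_vecMul, hwQ, hPv, hYv, hYe]
  have hr3 : (P⁻¹ * Y * P) *ᵥ ![0, 1, 0] = ![0, 0, 1] := by
    have h1 : P *ᵥ ![0, 1, 0] = e := by rw [hPm]; simp
    have h2 : P *ᵥ ![0, 0, 1] = Y *ᵥ e := by rw [hPm]; simp
    rw [← Matrix.mulVec_mulVec, ← Matrix.mulVec_mulVec, h1, ← h2, Matrix.mulVec_mulVec, hQP,
      Matrix.one_mulVec]
  obtain ⟨M, hM⟩ : ∃ M, M = P⁻¹ * X * P := ⟨_, rfl⟩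
  obtain ⟨M', hM'⟩ : ∃ M', M' = P⁻¹ * Y * P := ⟨_, rfl⟩
  rw [← hM] at hr1
  rw [← hM'] at hr2 hr3
  have r1 (j) := congrFun hr1 j
  have r2 (j) := congrFun hr2 j
  have r3 (j) := congrFun hr3 j
  simp [Matrix.vecMul, Matrix.mulVec, dotProduct, Fin.sum_univ_three] at r1 r2 r3
  refine ⟨P, P⁻¹, M 0 0, M 0 1, M 0 2, M 1 0, M 1 1, M 1 2, l₃, M' 0 0, M' 0 2, M' 1 0, M' 1 2, M' 2 2,
    hPQ, hQP, ?_, ?_⟩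
  · rw [← hM]
    ext i j
    fin_cases i <;> fin_cases j <;> first | rfl | exact r1 _
  · rw [← hM']
    ext i j
    fin_cases i <;> fin_cases j <;> first | rfl | exact r3 _ | exact r2 _

lemma pencil_normalForm (l₁ s g n l₂ h l₃ m₁ p m₂ q r : k) (u : Fin 3 → k) :
    pencil ![!![l₁, s, g; n, l₂, h; 0, 0, l₃], !![m₁, 0, p; m₂, 0, q; 0, 1, r], -1] u =
      !![u 0 * l₁ + u 1 * m₁ - u 2, u 0 * s, u 0 * g + u 1 * p;
        u 0 * n + u 1 * m₂, u 0 * l₂ - u 2, u 0 * h + u 1 * q; 0, u 1, u 0 * l₃ + u 1 * r - u 2] := by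
  rw [neg_one_fin_three]
  ext i j
  fin_cases i <;> fin_cases j <;> simp [pencil, Fin.sum_univ_three, sub_eq_add_neg]

/-- The points `T` and `R` of the plane cubic of a cube attached to a point of its curve, and
the values of `ξ` and `η` at the cube. -/
theorem Nonsingular.exists_isDiff [IsAlgClosed k] [CharZero k] {X Y : Matrix (Fin 3) (Fin 3) k}
    (hN : (ofSlices ![X, Y, -1]).Nonsingular) {x y : k}
    (hx : (ofSlices ![X, Y, -1]).xi X Y = algebraMap _ _ x)
    (hy : (ofSlices ![X, Y, -1]).eta X Y = algebraMap _ _ y) :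
    ∃ v w T R C : Fin 3 → k, v ≠ 0 ∧ w ≠ 0 ∧ (∀ u, w ⬝ᵥ pencil ![X, Y, -1] u *ᵥ v = 0) ∧
      w ᵥ* pencil ![X, Y, -1] T = 0 ∧ pencil ![X, Y, -1] R *ᵥ v = 0 ∧ T ⬝ᵥ R ⨯₃ C ≠ 0 ∧
      (T ⬝ᵥ R ⨯₃ C) ^ 2 * (12 * x + (ofSlices ![X, Y, -1]).jacobian.b₂) =
        ((ofSlices ![X, Y, -1]).subst T R C).diffX ∧
      (T ⬝ᵥ R ⨯₃ C) ^ 3 * (2 * y + (ofSlices ![X, Y, -1]).jacobian.a₁ * x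
        + (ofSlices ![X, Y, -1]).jacobian.a₃) = ((ofSlices ![X, Y, -1]).subst T R C).diffY := by
  obtain ⟨P, Q, l₁, s, g, n, l₂, h, l₃, m₁, p, m₂, q, r, hPQ, hQP, hX, hY⟩ := exists_normalForm hN
  have hpen (u : Fin 3 → k) : pencil ![Q * X * P, Q * Y * P, -1] u =
      Q * pencil ![X, Y, -1] u * P := by
    rw [pencil_neg_one, pencil_neg_one, mul_sub, sub_mul, mul_add, add_mul]
    simp only [mul_smul_comm, smul_mul_assoc, mul_one, hQP]
  have hpen' (u : Fin 3 → k) : pencil ![X, Y, -1] u =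
      P * pencil ![Q * X * P, Q * Y * P, -1] u * Q := by
    rw [hpen]
    simp only [mul_assoc, hPQ, mul_one]
    rw [← mul_assoc, hPQ, one_mul]
  have hS : ofSlices ![X, Y, -1] = ofSlices ![Q * X * P, Q * Y * P, -1] := ext_of_ev fun u => by
    have := congrArg Matrix.det hPQ
    rw [Matrix.det_mul, Matrix.det_one] at this
    rw [ev_ofSlices', ev_ofSlices', hpen, Matrix.det_mul, Matrix.det_mul]
    linear_combination -(pencil ![X, Y, -1] u).det * this
  have hφ (c : k) : conj P Q hPQ hQP (algebraMap k _ c) = algebraMap k _ (RingHom.id k c) := by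
    simp [conj, Algebra.algebraMap_eq_smul_one, hQP]
  have hx' := congrArg (conj P Q hPQ hQP) hx
  have hy' := congrArg (conj P Q hPQ hQP) hy
  rw [map_xi _ hφ, hφ, hS] at hx'
  rw [map_eta _ hφ, hφ, hS] at hy'
  change (ofSlices ![Q * X * P, Q * Y * P, -1]).xi (Q * X * P) (Q * Y * P) = algebraMap _ _ x at hx'
  change (ofSlices ![Q * X * P, Q * Y * P, -1]).eta (Q * X * P) (Q * Y * P) = algebraMap _ _ y at hy'
  rw [hS] at hN ⊢
  rw [hX, hY] at hN hS hx' hy' hpen' ⊢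
  have h001 : (![0, 0, 1] : Fin 3 → k) ≠ 0 := fun h => by simpa using congrFun h 2
  have h100 : (![1, 0, 0] : Fin 3 → k) ≠ 0 := fun h => by simpa using congrFun h 0
  have hT : ![0, 0, 1] ᵥ* pencil ![!![l₁, s, g; n, l₂, h; 0, 0, l₃], !![m₁, 0, p; m₂, 0, q; 0, 1, r], -1]
      ![1, 0, l₃] = 0 := by
    rw [pencil_normalForm, Matrix.vecMul_fin_three]
    simp
  have hR : pencil ![!![l₁, s, g; n, l₂, h; 0, 0, l₃], !![m₁, 0, p; m₂, 0, q; 0, 1, r], -1]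
      ![m₂, -n, m₂ * l₁ - n * m₁] *ᵥ ![1, 0, 0] = 0 := by
    rw [pencil_normalForm]
    ext i
    fin_cases i <;> simp [Matrix.mulVec, dotProduct, Fin.sum_univ_three]
    ring
  have h0 (u : Fin 3 → k) : ![0, 0, 1] ⬝ᵥ pencil ![!![l₁, s, g; n, l₂, h; 0, 0, l₃],
      !![m₁, 0, p; m₂, 0, q; 0, 1, r], -1] u *ᵥ ![1, 0, 0] = 0 := by
    rw [Matrix.dotProduct_mulVec, pencil_normalForm, Matrix.vecMul_fin_three]
    simp [dotProduct, Fin.sum_univ_three]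
  -- T and R are distinct points. If both determinants vanish, then n = 0. With m₂ = 0 the vector v
  -- is a common eigenvector and the cubic contains a line; with l₃ = l₁ both w N_T = 0 and N_T v =
  -- 0, against transversality.
  have hne : -n ≠ 0 ∨ m₂ * (l₃ - l₁) + n * m₁ ≠ 0 := by
    by_contra! hcon
    obtain ⟨hn, hm⟩ := hcon
    rw [neg_eq_zero] at hn
    rw [hn, zero_mul, add_zero] at hm
    rcases mul_eq_zero.mp hm with hm | hm
    · have hpq : LinearIndependent k ![![1, 0, l₁], ![0, 1, m₁]] := by
        rw [LinearIndependent.pair_iff]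
        intro s t h
        have h0 := congrFun h 0
        have h1 := congrFun h 1
        simpa using And.intro h0 h1
      obtain ⟨σ, τ, hστ⟩ := hN.exists_ev_line_ne_zero hpq
      apply hστ
      rw [ev_ofSlices']
      refine Matrix.exists_mulVec_eq_zero_iff.mp ⟨![1, 0, 0], h100, ?_⟩
      rw [pencil_normalForm]
      ext i
      fin_cases i <;> simp [Matrix.mulVec, dotProduct, Fin.sum_univ_three, hn, hm]
    · obtain ⟨u, hu⟩ := hN.exists_dotProduct_ne_zero (u := ![1, 0, l₃]) (v := ![1, 0, 0])
        (w := ![0, 0, 1]) (fun h => by simpa using congrFun h 0) h100 (by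
          rw [pencil_normalForm]
          ext i
          fin_cases i <;> simp [Matrix.mulVec, dotProduct, Fin.sum_univ_three, hn]
          linear_combination -hm) h001 hT
      exact hu (h0 u)
  have main : ∃ C : Fin 3 → k, ![1, 0, l₃] ⬝ᵥ ![m₂, -n, m₂ * l₁ - n * m₁] ⨯₃ C ≠ 0 ∧
      (![1, 0, l₃] ⬝ᵥ ![m₂, -n, m₂ * l₁ - n * m₁] ⨯₃ C) ^ 2 * (12 * x +
        (ofSlices ![!![l₁, s, g; n, l₂, h; 0, 0, l₃], !![m₁, 0, p; m₂, 0, q; 0, 1, r], -1]).jacobian.b₂) =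
        ((ofSlices ![!![l₁, s, g; n, l₂, h; 0, 0, l₃], !![m₁, 0, p; m₂, 0, q; 0, 1, r], -1]).subst
          ![1, 0, l₃] ![m₂, -n, m₂ * l₁ - n * m₁] C).diffX ∧
      (![1, 0, l₃] ⬝ᵥ ![m₂, -n, m₂ * l₁ - n * m₁] ⨯₃ C) ^ 3 * (2 * y +
        (ofSlices ![!![l₁, s, g; n, l₂, h; 0, 0, l₃], !![m₁, 0, p; m₂, 0, q; 0, 1, r], -1]).jacobian.a₁ * x +
        (ofSlices ![!![l₁, s, g; n, l₂, h; 0, 0, l₃], !![m₁, 0, p; m₂, 0, q; 0, 1, r], -1]).jacobian.a₃) =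
        ((ofSlices ![!![l₁, s, g; n, l₂, h; 0, 0, l₃], !![m₁, 0, p; m₂, 0, q; 0, 1, r], -1]).subst
          ![1, 0, l₃] ![m₂, -n, m₂ * l₁ - n * m₁] C).diffY := by
    have d1 : ![1, 0, l₃] ⬝ᵥ ![m₂, -n, m₂ * l₁ - n * m₁] ⨯₃ ![0, 0, 1] = -n := by
      simp [cross_apply, dotProduct, Fin.sum_univ_three]
    have d2 : ![1, 0, l₃] ⬝ᵥ ![m₂, -n, m₂ * l₁ - n * m₁] ⨯₃ ![0, 1, 0] =
        m₂ * (l₃ - l₁) + n * m₁ := by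
      simp [cross_apply, dotProduct, Fin.sum_univ_three]
      ring
    have hnf := ofSlices_normalForm l₁ s g n l₂ h l₃ m₁ p m₂ q r
    rcases hne with hne | hne
    · refine ⟨![0, 0, 1], ?_⟩
      rw [d1]
      exact ⟨hne, diffX_subst_normalForm hnf hx', diffY_subst_normalForm hnf hx' hy'⟩
    · refine ⟨![0, 1, 0], ?_⟩
      rw [d2]
      exact ⟨hne, diffX_subst_normalForm' hnf hx', diffY_subst_normalForm' hnf hx' hy'⟩
  obtain ⟨C, hC⟩ := main
  refine ⟨P *ᵥ ![1, 0, 0], ![0, 0, 1] ᵥ* Q, ![1, 0, l₃], ![m₂, -n, m₂ * l₁ - n * m₁], C, ?_, ?_,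
    fun u => ?_, ?_, ?_, hC⟩
  · intro h
    apply h100
    rw [← Matrix.one_mulVec ![1, 0, 0], ← hQP, ← Matrix.mulVec_mulVec, h, Matrix.mulVec_zero]
  · intro h
    apply h001
    rw [← Matrix.vecMul_one ![0, 0, 1], ← hQP, ← Matrix.vecMul_vecMul, h, Matrix.zero_vecMul]
  · rw [hpen', Matrix.mulVec_mulVec, mul_assoc, hQP, mul_one, ← Matrix.dotProduct_mulVec,
      Matrix.mulVec_mulVec, ← mul_assoc, hQP, one_mul, h0]
  · rw [hpen', Matrix.vecMul_vecMul, mul_assoc, ← mul_assoc, hQP, one_mul, ← Matrix.vecMul_vecMul,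
      hT, Matrix.zero_vecMul]
  · rw [hpen', Matrix.mulVec_mulVec, mul_assoc, hQP, mul_one, ← Matrix.mulVec_mulVec, hR,
      Matrix.mulVec_zero]

end TernaryCubic

/-! ### Transport to the Jacobian and the sums of the hyperplane sections -/

namespace TernaryCubic
open PlaneCubic

section LineSum
variable {k : Type*} [Field k] {G : TernaryCubic k} {L : Fin 3 → k} {P : Fin 3 → Fin 3 → k}

lemma IsLineSection.scale {κ : k} (hκ : κ ≠ 0) (h : IsLineSection G L P) :
    IsLineSection (G.scale κ) L P := by
  obtain ⟨p, q, a, b, e, hpq, hp, hq, he, hP, hG⟩ := h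
  refine ⟨p, q, a, b, κ * e, hpq, hp, hq, mul_ne_zero hκ he, hP, fun s t => ?_⟩
  rw [ev_scale, hG]
  ring

lemma linearIndependent_mulVec {g : Matrix (Fin 3) (Fin 3) k} (hg : g.det ≠ 0) {p q : Fin 3 → k}
    (h : LinearIndependent k ![p, q]) : LinearIndependent k ![g *ᵥ p, g *ᵥ q] := by
  rw [LinearIndependent.pair_iff] at h ⊢
  intro s t hst
  rw [← Matrix.mulVec_smul, ← Matrix.mulVec_smul, ← Matrix.mulVec_add] at hst
  exact h s t (Matrix.eq_zero_of_mulVec_eq_zero hg hst)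

/-- Collinear points of a plane cubic have sum zero on the Jacobian. -/
lemma IsLineSection.sum_ofVec_eq_zero [CharZero k] [DecidableEq k] {W : WeierstrassCurve k}
    [W.IsElliptic] {g : Matrix (Fin 3) (Fin 3) k} (hg : g.det ≠ 0)
    (hG : G.comp g = (ofWeierstrass W).scale g.det) (h : IsLineSection G L P) :
    W.ofVec (g⁻¹ *ᵥ P 0) + W.ofVec (g⁻¹ *ᵥ P 1) + W.ofVec (g⁻¹ *ᵥ P 2) = 0 := by
  obtain ⟨p, q, a, b, e, hpq, hp, hq, he, hP, hev⟩ := h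
  have hg' := det_inv_ne_zero hg
  have hab (i) : a i • g⁻¹ *ᵥ p + b i • g⁻¹ *ᵥ q = g⁻¹ *ᵥ (a i • p + b i • q) := by
    rw [Matrix.mulVec_add, Matrix.mulVec_smul, Matrix.mulVec_smul]
  have hof (i) : W.ofVec (a i • g⁻¹ *ᵥ p + b i • g⁻¹ *ᵥ q) = W.ofVec (g⁻¹ *ᵥ P i) := by
    obtain ⟨-, c, hc, hi⟩ := hP i
    rw [hab, hi, Matrix.mulVec_smul, WeierstrassCurve.ofVec_smul W _ hc]
  rw [← hof, ← hof, ← hof]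
  refine WeierstrassCurve.ofVec_add_ofVec_add_ofVec (linearIndependent_mulVec hg' hpq)
    (κ := g.det⁻¹ * e) (mul_ne_zero (inv_ne_zero hg) he) (fun i => ?_) (fun s t => ?_)
  · obtain ⟨hPi, c, hc, hi⟩ := hP i
    rw [hab, hi]
    exact mulVec_ne_zero hg' (smul_ne_zero hc hPi)
  · have h1 : g.det * (ofWeierstrass W).ev (s • g⁻¹ *ᵥ p + t • g⁻¹ *ᵥ q) =
        G.ev (s • p + t • q) := by
      rw [← ev_scale, ← hG, ev_comp, Matrix.mulVec_add, Matrix.mulVec_smul, Matrix.mulVec_smul,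
        mulVec_inv_mulVec hg, mulVec_inv_mulVec hg]
    rw [mul_assoc, ← hev, ← h1, inv_mul_cancel_left₀ hg]

end LineSum

section Difference
variable {k : Type*} [Field k]

lemma mulVec_dotProduct_crossProduct (A : Matrix (Fin 3) (Fin 3) k) (x y z : Fin 3 → k) :
    A *ᵥ x ⬝ᵥ (A *ᵥ y) ⨯₃ (A *ᵥ z) = A.det * (x ⬝ᵥ y ⨯₃ z) := by
  simp [Matrix.det_fin_three, cross_apply, Matrix.mulVec, dotProduct, Fin.sum_univ_three]
  ring

lemma b₂_jacobian_scale (F : TernaryCubic k) (κ : k) :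
    (F.scale κ).jacobian.b₂ = κ ^ 2 * F.jacobian.b₂ := by
  simp only [jacobian, scale, WeierstrassCurve.b₂]; ring

lemma a₁_jacobian_scale (F : TernaryCubic k) (κ : k) :
    (F.scale κ).jacobian.a₁ = κ * F.jacobian.a₁ := rfl

lemma a₃_jacobian_scale (F : TernaryCubic k) (κ : k) :
    (F.scale κ).jacobian.a₃ = κ ^ 3 * F.jacobian.a₃ := by
  simp only [jacobian, scale]; ring

lemma subst_scale [CharZero k] (F : TernaryCubic k) (κ : k) (p q r : Fin 3 → k) :
    (F.scale κ).subst p q r = (F.subst p q r).scale κ :=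
  ext_of_ev fun v => by rw [ev_subst, ev_scale, ev_scale, ev_subst]

lemma subst_comp [CharZero k] (F : TernaryCubic k) (g : Matrix (Fin 3) (Fin 3) k)
    (p q r : Fin 3 → k) : (F.comp g).subst p q r = F.subst (g *ᵥ p) (g *ᵥ q) (g *ᵥ r) :=
  ext_of_ev fun v => by
    rw [ev_subst, ev_comp, ev_subst]
    simp only [Matrix.mulVec_add, Matrix.mulVec_smul]

/-- A difference formula for two points on a plane cubic gives their difference on the
Jacobian. -/
lemma ofVec_sub_ofVec_of_diff [CharZero k] [DecidableEq k] {S F : TernaryCubic k} {κ : k}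
    (hF : F = S.scale κ) {g : Matrix (Fin 3) (Fin 3) k} (hg : g.det ≠ 0)
    (hG : F.comp g = (ofWeierstrass F.jacobian).scale g.det) [F.jacobian.IsElliptic]
    {T R C : Fin 3 → k} (hT : S.ev T = 0) (hR : S.ev R = 0) (hd : T ⬝ᵥ R ⨯₃ C ≠ 0) {x y x₀ y₀ : k}
    (hx : x = κ ^ 2 * x₀) (hy : y = κ ^ 3 * y₀)
    (h₁ : (T ⬝ᵥ R ⨯₃ C) ^ 2 * (12 * x₀ + S.jacobian.b₂) = (S.subst T R C).diffX)
    (h₂ : (T ⬝ᵥ R ⨯₃ C) ^ 3 * (2 * y₀ + S.jacobian.a₁ * x₀ + S.jacobian.a₃) =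
      (S.subst T R C).diffY) (hxy : F.jacobian.toAffine.Nonsingular x y) :
    F.jacobian.ofVec (g⁻¹ *ᵥ T) - F.jacobian.ofVec (g⁻¹ *ᵥ R) = .some x y hxy := by
  have hev (u) (hu : S.ev u = 0) : (ofWeierstrass F.jacobian).ev (g⁻¹ *ᵥ u) = 0 := by
    have h1 : g.det * (ofWeierstrass F.jacobian).ev (g⁻¹ *ᵥ u) = κ * S.ev u := by
      rw [← ev_scale, ← hG, ev_comp, mulVec_inv_mulVec hg, ← ev_scale, ← hF]
    rw [hu, mul_zero] at h1
    exact (mul_eq_zero.mp h1).resolve_left hg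
  -- Both sides express F in terms of T, R, C. Taking `diffX` and `diffY` moves the formula to the
  -- Weierstrass cubic, where the powers of det(g) cancel.
  have hsub : (S.subst T R C).scale κ =
      ((ofWeierstrass F.jacobian).subst (g⁻¹ *ᵥ T) (g⁻¹ *ᵥ R) (g⁻¹ *ᵥ C)).scale g.det := by
    rw [← subst_scale, ← subst_scale, ← hF, ← hG, subst_comp]
    simp only [mulVec_inv_mulVec hg]
  have hdet : T ⬝ᵥ R ⨯₃ C = g.det * ((g⁻¹ *ᵥ T) ⬝ᵥ (g⁻¹ *ᵥ R) ⨯₃ (g⁻¹ *ᵥ C)) := by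
    rw [← mulVec_dotProduct_crossProduct]
    simp only [mulVec_inv_mulVec hg]
  have hX := congrArg diffX hsub
  have hY := congrArg diffY hsub
  rw [diffX_scale, diffX_scale, ← h₁, hdet] at hX
  rw [diffY_scale, diffY_scale, ← h₂, hdet] at hY
  rw [hdet] at hd
  refine WeierstrassCurve.IsDiff.ofVec_sub_ofVec (hev T hT) (hev R hR) (right_ne_zero_of_mul hd)
    ⟨mul_left_cancel₀ (pow_ne_zero 2 hg) ?_, mul_left_cancel₀ (pow_ne_zero 3 hg) ?_⟩ hxy
  · rw [← hX]
    have hb : F.jacobian.b₂ = κ ^ 2 * S.jacobian.b₂ := by rw [hF, b₂_jacobian_scale]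
    rw [hb, hx]
    ring
  · rw [← hY]
    have ha : F.jacobian.a₁ = κ * S.jacobian.a₁ := by rw [hF, a₁_jacobian_scale]
    have hb : F.jacobian.a₃ = κ ^ 3 * S.jacobian.a₃ := by rw [hF, a₃_jacobian_scale]
    rw [ha, hb, hx, hy]
    ring

end Difference

section HyperplaneSections
variable {k : Type*} [Field k] {N : Fin 3 → Matrix (Fin 3) (Fin 3) k}

/-- The linear map u ↦ w N_u has its image in the plane orthogonal to v, so it is not injective. -/
lemma exists_vecMul_pencil_eq_zero {v w : Fin 3 → k} (hv : v ≠ 0)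
    (hwv : ∀ u, w ⬝ᵥ pencil N u *ᵥ v = 0) : ∃ T : Fin 3 → k, T ≠ 0 ∧ w ᵥ* pencil N T = 0 := by
  let B : Matrix (Fin 3) (Fin 3) k := Matrix.of fun j => w ᵥ* N j
  have hB (u : Fin 3 → k) : w ᵥ* pencil N u = u ᵥ* B := by
    ext i
    simp [B, pencil, Matrix.vecMul, dotProduct, Fin.sum_univ_three]
    ring
  have hBv : B *ᵥ v = 0 := eq_zero_of_forall_dotProduct fun u => by
    rw [dotProduct_comm, Matrix.dotProduct_mulVec, ← hB, ← Matrix.dotProduct_mulVec, hwv]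
  obtain ⟨T, hT, hTB⟩ := exists_vecMul_eq_zero hv hBv
  exact ⟨T, hT, by rw [hB, hTB]⟩

/-- The two points of the first plane cubic attached to a point of the second one. -/
lemma exists_left_right {v : Fin 3 → k} (hv : v ≠ 0)
    (h : (ofSlices (TernaryCubic.swap N)).ev v = 0) : ∃ w T R : Fin 3 → k, w ≠ 0 ∧ T ≠ 0 ∧ R ≠ 0 ∧
      (∀ u, w ⬝ᵥ pencil N u *ᵥ v = 0) ∧ w ᵥ* pencil N T = 0 ∧ pencil N R *ᵥ v = 0 := by
  rw [ev_ofSlices'] at h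
  obtain ⟨R, hR, hR0⟩ := Matrix.exists_mulVec_eq_zero_iff.mpr h
  obtain ⟨w, hw, hw0⟩ := Matrix.exists_vecMul_eq_zero_iff.mpr h
  have hwv (u) : w ⬝ᵥ pencil N u *ᵥ v = 0 := by
    rw [← pencil_swap_mulVec, Matrix.dotProduct_mulVec, hw0, zero_dotProduct]
  obtain ⟨T, hT, hT0⟩ := exists_vecMul_pencil_eq_zero hv hwv
  exact ⟨w, T, R, hw, hT, hR, hwv, hT0, by rwa [← pencil_swap_mulVec]⟩

variable [IsAlgClosed k] [CharZero k] [DecidableEq k] {W : WeierstrassCurve k}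
  {ψ : (Fin 3 → k) → W.toAffine.Point}

/-- The hyperplane section of the first kind has degree three and sum zero. -/
lemma Nonsingular.divisorSum_fst (hN : (ofSlices N).Nonsingular)
    (hψ : ∀ (c : k) (u), c ≠ 0 → ψ (c • u) = ψ u)
    (hadd : ∀ L P, IsLineSection (ofSlices N) L P → ψ (P 0) + ψ (P 1) + ψ (P 2) = 0)
    {κ : k} (hκ : κ ≠ 0) {L : Fin 3 → k} (hL : L ≠ 0) :
    (hyperplaneSection (fun Q : cubeCurve N => Q.1.1) ((ofSlices N).scale κ).poly L).degree = 3 ∧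
    divisorSum (fun Q : cubeCurve N => ψ Q.1.1.rep)
      (hyperplaneSection (fun Q => Q.1.1) ((ofSlices N).scale κ).poly L) = 0 := by
  obtain ⟨P, hP⟩ := hN.exists_isLineSection hL
  have hP0 (i) : P i ≠ 0 := by
    obtain ⟨_, _, _, _, _, _, _, _, _, h, _⟩ := hP
    exact (h i).1
  have hex (i) : ∃ Q : cubeCurve N, Q.1.1 = Projectivization.mk k (P i) (hP0 i) := by
    obtain ⟨Q, hQ, h⟩ := hN.fstIsIso.1.surjOn (mk_mem_curve.mpr (hP.ev_eq_zero i) :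
      Projectivization.mk k (P i) (hP0 i) ∈ curve (ofSlices N).poly)
    exact ⟨⟨Q, hQ⟩, h⟩
  choose Q hQ using hex
  have hrep (i) : ∃ c : k, c ≠ 0 ∧ (Q i).1.1.rep = c • P i := by
    rw [hQ]
    exact exists_rep_mk _ _
  have hinj : Function.Injective (fun Q : cubeCurve N => Q.1.1) := fun A B h =>
    Subtype.ext (hN.fstIsIso.1.injOn A.2 B.2 h)
  rw [(hP.scale hκ).hyperplaneSection_eq hL hinj fun i => (hrep i).imp fun _ h => h.2]
  refine ⟨degree_sum_single, ?_⟩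
  rw [divisorSum_sum_single, Fin.sum_univ_three, ← hadd L P hP]
  have h (i) : ψ (Q i).1.1.rep = ψ (P i) := by
    obtain ⟨c, hc, h⟩ := hrep i
    rw [h, hψ _ _ hc]
  rw [h, h, h]

/-- A line through v cuts out the point (R, v) and two points lying over u₁ and u₂, where T, u₁, u₂
form a line section. So ψ(u₁) + ψ(u₂) = -ψ(T). -/
lemma Nonsingular.divisorSum_snd_aux (hN : (ofSlices N).Nonsingular)
    (hψ : ∀ (c : k) (u), c ≠ 0 → ψ (c • u) = ψ u)
    (hadd : ∀ L P, IsLineSection (ofSlices N) L P → ψ (P 0) + ψ (P 1) + ψ (P 2) = 0)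
    {L v w T R : Fin 3 → k} (hL : L ≠ 0) (hLv : L ⬝ᵥ v = 0) (hv : v ≠ 0) (hw : w ≠ 0) (hT : T ≠ 0)
    (hR : R ≠ 0) (hwv : ∀ u, w ⬝ᵥ pencil N u *ᵥ v = 0) (hwT : w ᵥ* pencil N T = 0)
    (hRv : pencil N R *ᵥ v = 0) :
    (hyperplaneSection (fun Q : cubeCurve N => Q.1.2)
      (ofSlices (TernaryCubic.swap N)).poly L).degree = 3 ∧
    divisorSum (fun Q : cubeCurve N => ψ Q.1.1.rep)
      (hyperplaneSection (fun Q => Q.1.2) (ofSlices (TernaryCubic.swap N)).poly L) =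
      ψ R - ψ T := by
  obtain ⟨M, u₁, u₂, v₁, v₂, -, h₁, h₂, hM, hP⟩ :=
    hN.exists_isLineSection_swap hL hv hLv hw hwv hT hwT
  have hu (i) : ![T, u₁, u₂] i ≠ 0 := by
    obtain ⟨_, _, _, _, _, _, _, _, _, h, _⟩ := hM
    exact (h i).1
  have hv' (i) : ![v, v₁, v₂] i ≠ 0 := by
    obtain ⟨_, _, _, _, _, _, _, _, _, h, _⟩ := hP
    exact (h i).1
  have hu₁ : u₁ ≠ 0 := hu 1
  have hu₂ : u₂ ≠ 0 := hu 2
  have hv₁ : v₁ ≠ 0 := hv' 1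
  have hv₂ : v₂ ≠ 0 := hv' 2
  let Q : Fin 3 → cubeCurve N := ![⟨(.mk k R hR, .mk k v hv), mk_mem_cubeCurve.mpr hRv⟩,
    ⟨(.mk k u₁ hu₁, .mk k v₁ hv₁), mk_mem_cubeCurve.mpr h₁⟩,
    ⟨(.mk k u₂ hu₂, .mk k v₂ hv₂), mk_mem_cubeCurve.mpr h₂⟩]
  have hinj : Function.Injective (fun Q : cubeCurve N => Q.1.2) := fun A B h =>
    Subtype.ext (hN.swap.sndIsIso.1.injOn A.2 B.2 h)
  have hmk (x : Fin 3 → k) (hx : x ≠ 0) : ψ (Projectivization.mk k x hx).rep = ψ x := by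
    obtain ⟨c, hc, h⟩ := exists_rep_mk x hx
    rw [h, hψ _ _ hc]
  have hsec := hP.hyperplaneSection_eq (Q := Q) hL hinj (fun i => by
    fin_cases i
    exacts [(exists_rep_mk v hv).imp fun _ h => h.2, (exists_rep_mk v₁ hv₁).imp fun _ h => h.2,
      (exists_rep_mk v₂ hv₂).imp fun _ h => h.2])
  rw [hsec]
  refine ⟨degree_sum_single, ?_⟩
  rw [divisorSum_sum_single, Fin.sum_univ_three]
  have e₀ : ψ (Q 0).1.1.rep = ψ R := hmk R hR
  have e₁ : ψ (Q 1).1.1.rep = ψ u₁ := hmk u₁ hu₁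
  have e₂ : ψ (Q 2).1.1.rep = ψ u₂ := hmk u₂ hu₂
  have hsum : ψ T + ψ u₁ + ψ u₂ = 0 := hadd _ _ hM
  rw [e₀, e₁, e₂, add_assoc, sub_eq_add_neg, eq_neg_of_add_eq_zero_right ((add_assoc _ _ _).symm.trans hsum)]

/-- All hyperplane sections of the second kind have degree three and the same sum. -/
lemma Nonsingular.divisorSum_snd (hN : (ofSlices N).Nonsingular)
    (hψ : ∀ (c : k) (u), c ≠ 0 → ψ (c • u) = ψ u)
    (hadd : ∀ L P, IsLineSection (ofSlices N) L P → ψ (P 0) + ψ (P 1) + ψ (P 2) = 0)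
    {L v w T R : Fin 3 → k} (hL : L ≠ 0) (hv : v ≠ 0) (hw : w ≠ 0) (hT : T ≠ 0)
    (hR : R ≠ 0) (hwv : ∀ u, w ⬝ᵥ pencil N u *ᵥ v = 0) (hwT : w ᵥ* pencil N T = 0)
    (hRv : pencil N R *ᵥ v = 0) :
    (hyperplaneSection (fun Q : cubeCurve N => Q.1.2)
      (ofSlices (TernaryCubic.swap N)).poly L).degree = 3 ∧
    divisorSum (fun Q : cubeCurve N => ψ Q.1.1.rep)
      (hyperplaneSection (fun Q => Q.1.2) (ofSlices (TernaryCubic.swap N)).poly L) =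
      ψ R - ψ T := by
  obtain ⟨P, hP⟩ := hN.swap.exists_isLineSection hL
  have hP0 : P 0 ≠ 0 := by
    obtain ⟨_, _, _, _, _, _, _, _, _, h, _⟩ := hP
    exact (h 0).1
  obtain ⟨w', T', R', hw', hT', hR', hwv', hwT', hRv'⟩ := exists_left_right hP0 (hP.ev_eq_zero 0)
  -- The line M passes through v and through a point P 0 of L. Viewed from P 0, the sections by L
  -- and M have equal sums; viewed from v, the sum for M is ψ(R) - ψ(T).
  obtain ⟨M, hM, hM1, hM2⟩ := exists_dotProduct_eq_zero v (P 0)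
  have h₁ := hN.divisorSum_snd_aux hψ hadd hL (hP.dotProduct_eq_zero 0) hP0 hw' hT' hR' hwv' hwT'
    hRv'
  have h₂ := hN.divisorSum_snd_aux hψ hadd hM hM2 hP0 hw' hT' hR' hwv' hwT' hRv'
  have h₃ := hN.divisorSum_snd_aux hψ hadd hM hM1 hv hw hT hR hwv hwT hRv
  exact ⟨h₁.1, h₁.2.trans (h₂.2.symm.trans h₃.2)⟩

end HyperplaneSections

end TernaryCubic

/-! ### Assembly over k and descent to K -/

namespace TernaryCubic
open PlaneCubic

lemma Nonsingular.of_scale {k : Type*} [Field k] {F : TernaryCubic k} {κ : k}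
    (hF : (F.scale κ).Nonsingular) : F.Nonsingular :=
  fun v hv hv' => hF v (by rw [ev_scale, hv, mul_zero]) (by rw [gradient_scale, hv', smul_zero])

section Closed
variable {k : Type*} [Field k] [IsAlgClosed k] [CharZero k] {F : TernaryCubic k}

lemma Nonsingular.isElliptic_jacobian (hF : F.Nonsingular) : F.jacobian.IsElliptic := by
  obtain ⟨g, hg, h⟩ := hF.exists_comp_eq_jacobian
  refine Nonsingular.isElliptic fun v hv hv' => hF.comp hg v ?_ ?_
  · rw [h, ev_scale, hv, mul_zero]
  · rw [h, gradient_scale, hv', smul_zero]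

/-- For matrices satisfying the relations of `A_{F,P}`, the sum of the difference of the two
hyperplane sections is `P`. -/
theorem Nonsingular.divisorSum_sub_eq [DecidableEq k] {X Y : Matrix (Fin 3) (Fin 3) k} {κ : k}
    (hF : F.Nonsingular) (hS : F = (ofSlices ![X, Y, -1]).scale κ) (hκ : κ ≠ 0) {x y : k}
    (hx : F.xi X Y = algebraMap _ _ x) (hy : F.eta X Y = algebraMap _ _ y)
    [F.jacobian.IsElliptic] {g : Matrix (Fin 3) (Fin 3) k} (hg : g.det ≠ 0)
    (h : F.comp g = (ofWeierstrass F.jacobian).scale g.det)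
    (hxy : F.jacobian.toAffine.Nonsingular x y) {L L' : Fin 3 → k} (hL : L ≠ 0) (hL' : L' ≠ 0) :
    let N := ![X, Y, -1]
    let H : cubeCurve N →₀ ℤ := hyperplaneSection (fun Q => Q.1.1) F.poly L
    let H' : cubeCurve N →₀ ℤ :=
      hyperplaneSection (fun Q => Q.1.2) (ofSlices (TernaryCubic.swap N)).poly L'
    H.degree = 3 ∧ H'.degree = 3 ∧
      divisorSum (fun Q => F.jacobian.ofVec (g⁻¹ *ᵥ Q.1.1.rep)) (H - H') = .some x y hxy := by
  intro N H H'
  have hN : (ofSlices N).Nonsingular := Nonsingular.of_scale (κ := κ) (hS ▸ hF)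
  have hx' : (ofSlices N).xi X Y = algebraMap _ _ (x / κ ^ 2) := by
    rw [hS, xi_scale, Algebra.algebraMap_eq_smul_one] at hx
    rw [Algebra.algebraMap_eq_smul_one, div_eq_inv_mul, mul_smul, ← hx,
      inv_smul_smul₀ (pow_ne_zero _ hκ)]
  have hy' : (ofSlices N).eta X Y = algebraMap _ _ (y / κ ^ 3) := by
    rw [hS, eta_scale, Algebra.algebraMap_eq_smul_one] at hy
    rw [Algebra.algebraMap_eq_smul_one, div_eq_inv_mul, mul_smul, ← hy,
      inv_smul_smul₀ (pow_ne_zero _ hκ)]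
  obtain ⟨v, w, T, R, C, hv, hw, hwv, hwT, hRv, hd, h₁, h₂⟩ := hN.exists_isDiff hx' hy'
  have hT : T ≠ 0 := by rintro rfl; simp at hd
  have hR : R ≠ 0 := by rintro rfl; simp at hd
  have hST : (ofSlices N).ev T = 0 := by
    rw [ev_ofSlices']
    exact Matrix.exists_vecMul_eq_zero_iff.mp ⟨w, hw, hwT⟩
  have hSR : (ofSlices N).ev R = 0 := by
    rw [ev_ofSlices']
    exact Matrix.exists_mulVec_eq_zero_iff.mp ⟨v, hv, hRv⟩
  let ψ (u : Fin 3 → k) := F.jacobian.ofVec (g⁻¹ *ᵥ u)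
  have hψ (c : k) (u : Fin 3 → k) (hc : c ≠ 0) : ψ (c • u) = ψ u := by
    simp only [ψ]
    rw [Matrix.mulVec_smul, WeierstrassCurve.ofVec_smul _ _ hc]
  have hadd (L : Fin 3 → k) (P : Fin 3 → Fin 3 → k) (hP : IsLineSection (ofSlices N) L P) :
      ψ (P 0) + ψ (P 1) + ψ (P 2) = 0 := by
    have hP' : IsLineSection F L P := hS ▸ hP.scale hκ
    exact hP'.sum_ofVec_eq_zero hg h
  have hdiff : ψ T - ψ R = .some x y hxy := ofVec_sub_ofVec_of_diff hS hg h hST hSR hd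
    (mul_div_cancel₀ _ (pow_ne_zero _ hκ)).symm (mul_div_cancel₀ _ (pow_ne_zero _ hκ)).symm
    h₁ h₂ hxy
  obtain ⟨d₁, s₁⟩ := hN.divisorSum_fst hψ hadd hκ hL
  obtain ⟨d₂, s₂⟩ := hN.divisorSum_snd hψ hadd hL' hv hw hT hR hwv hwT hRv
  rw [← hS] at d₁ s₁
  refine ⟨d₁, d₂, ?_⟩
  rw [divisorSum_sub]
  refine (congrArg₂ _ s₁ s₂).trans ?_
  rw [zero_sub, neg_sub, hdiff]

/-- The curve in `ℙ² × ℙ²` given by matrices that satisfy the relations of `A_{F,P}`. -/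
theorem Nonsingular.cubeCurve_of_relations [DecidableEq k] {X Y : Matrix (Fin 3) (Fin 3) k} {κ : k}
    (hF : F.Nonsingular) (hS : F = (ofSlices ![X, Y, -1]).scale κ) (hκ : κ ≠ 0) {x y : k}
    (hx : F.xi X Y = algebraMap _ _ x) (hy : F.eta X Y = algebraMap _ _ y)
    {g : Matrix (Fin 3) (Fin 3) k} (hg : g.det ≠ 0)
    (h : F.comp g = (ofWeierstrass F.jacobian).scale g.det)
    (hxy : F.jacobian.toAffine.Nonsingular x y) {N : Fin 3 → Matrix (Fin 3) (Fin 3) k}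
    (hN : N = ![X, Y, -1]) :
    DefinesGenusOneCurve N ∧ FstIsIso (cubeCurve N) (curve F.poly) ∧
      IsNonsingularCubic (slice₂ N) ∧ SndIsIso (cubeCurve N) (curve (slice₂ N)) ∧
      ∃ π : cubeCurve N → curve F.poly, (∀ Q, (π Q : Plane k) = Q.1.1) ∧
        ∀ L L' : Fin 3 → k, L ≠ 0 → L' ≠ 0 →
          let H : cubeCurve N →₀ ℤ := hyperplaneSection (fun Q => Q.1.1) F.poly L
          let H' : cubeCurve N →₀ ℤ := hyperplaneSection (fun Q => Q.1.2) (slice₂ N) L'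
          H.degree = 3 ∧ H'.degree = 3 ∧
            divisorSum (fun Q => toPoint F.jacobian (linearEquiv hg h (π Q))) (H - H')
              = .some x y hxy := by
  have hE := hF.isElliptic_jacobian
  subst hN
  have hSN : (ofSlices ![X, Y, -1]).Nonsingular := Nonsingular.of_scale (κ := κ) (hS ▸ hF)
  have hcurve : curve F.poly = curve (ofSlices ![X, Y, -1]).poly := by
    rw [hS]
    exact curve_scale _ hκ
  have hfst : FstIsIso (cubeCurve ![X, Y, -1]) (curve F.poly) := by
    rw [hcurve]
    exact hSN.fstIsIso
  have h₂ : slice₂ ![X, Y, -1] = (ofSlices (TernaryCubic.swap ![X, Y, -1])).poly := by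
    rw [slice₂_eq_slice₁, slice₁_eq_poly]
  rw [h₂, isNonsingularCubic_poly]
  refine ⟨hSN.definesGenusOneCurve, hfst, hSN.swap, hSN.swap.sndIsIso,
    fun Q => ⟨Q.1.1, hfst.1.mapsTo Q.2⟩, fun _ => rfl, fun L L' hL hL' => ?_⟩
  obtain ⟨d₁, d₂, hsum⟩ := hF.divisorSum_sub_eq hS hκ hx hy hg h hxy hL hL'
  refine ⟨d₁, d₂, ?_⟩
  rw [← hsum]
  congr 1
  funext Q
  obtain ⟨c, hc, hrep⟩ := exists_rep_linearEquiv hg h ⟨Q.1.1, hfst.1.mapsTo Q.2⟩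
  refine Eq.trans ?_ (WeierstrassCurve.ofVec_smul _ _ hc)
  rw [← hrep]
  rfl

end Closed

section Descent
variable {K k : Type*} [Field K] [Field k] (f : K →+* k)

lemma map_injective : Function.Injective (fun F : TernaryCubic K => F.map f) := by
  rintro ⟨⟩ ⟨⟩ h
  simpa [map, f.injective.eq_iff] using h

lemma map_scale (F : TernaryCubic K) (κ : K) : (F.scale κ).map f = (F.map f).scale (f κ) := by
  simp [map, scale]

lemma map_ofSlices (N : Fin 3 → Matrix (Fin 3) (Fin 3) K) :
    (ofSlices N).map f = ofSlices (fun j => (N j).map f) := by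
  simp [map, ofSlices, Matrix.det_fin_three]

end Descent

section Specialization
variable {K k : Type*} [Field K] [Field k] [Algebra K k] (F : TernaryCubic K) {xP yP : K}
  (θ : F.SpecAlg xP yP ≃ₐ[K] Matrix (Fin 3) (Fin 3) K)

/-- The homomorphism from `A_F` to the matrices over an extension field. -/
noncomputable def algHomOfSpec : F.Alg →+* Matrix (Fin 3) (Fin 3) k :=
  ((algebraMap K k).mapMatrix.comp θ.toRingEquiv.toRingHom).comp
    (RingQuot.mkAlgHom K (F.SpecRel xP yP)).toRingHom

lemma algHomOfSpec_algebraMap (c : K) :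
    F.algHomOfSpec (k := k) θ (algebraMap K F.Alg c) = algebraMap k _ (algebraMap K k c) := by
  have h : F.algHomOfSpec (k := k) θ (algebraMap K F.Alg c) =
      (algebraMap K k).mapMatrix (θ (RingQuot.mkAlgHom K (F.SpecRel xP yP) (algebraMap K _ c))) := rfl
  rw [h, AlgHom.commutes, AlgEquiv.commutes]
  ext i j
  simp [Matrix.algebraMap_matrix_apply, apply_ite (algebraMap K k)]

lemma relator_algHomOfSpec (i : Fin 4) : (F.map (algebraMap K k)).relator
    (F.algHomOfSpec (k := k) θ F.genX) (F.algHomOfSpec (k := k) θ F.genY) i = 0 := by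
  have h₁ : F.relator F.genX F.genY i = 0 := by
    have h := RingQuot.mkAlgHom_rel K (Rel.mk (F := F) i)
    rw [map_zero] at h
    rw [← h]
    exact (map_relator F (σ := RingHom.id K) (φ := (RingQuot.mkAlgHom K F.Rel).toRingHom)
      (fun c => AlgHom.commutes _ c) _ _ i).symm
  rw [← map_relator F (F.algHomOfSpec_algebraMap θ), h₁, map_zero]

lemma xi_algHomOfSpec : (F.map (algebraMap K k)).xi
    (F.algHomOfSpec (k := k) θ F.genX) (F.algHomOfSpec (k := k) θ F.genY) =
      algebraMap k _ (algebraMap K k xP) := by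
  rw [← map_xi F (F.algHomOfSpec_algebraMap θ), ← F.algHomOfSpec_algebraMap θ]
  exact congrArg (fun a => (algebraMap K k).mapMatrix (θ a)) (RingQuot.mkAlgHom_rel K SpecRel.xi)

lemma eta_algHomOfSpec : (F.map (algebraMap K k)).eta
    (F.algHomOfSpec (k := k) θ F.genX) (F.algHomOfSpec (k := k) θ F.genY) =
      algebraMap k _ (algebraMap K k yP) := by
  rw [← map_eta F (F.algHomOfSpec_algebraMap θ), ← F.algHomOfSpec_algebraMap θ]
  exact congrArg (fun a => (algebraMap K k).mapMatrix (θ a)) (RingQuot.mkAlgHom_rel K SpecRel.eta)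

lemma map_cube : (fun j => (F.cube θ j).map (algebraMap K k)) =
    ![F.algHomOfSpec θ F.genX, F.algHomOfSpec θ F.genY, -1] := by
  funext j
  fin_cases j
  · rfl
  · rfl
  · exact (map_neg (algebraMap K k).mapMatrix 1).trans (congrArg _ (map_one _))

end Specialization

end TernaryCubic

open PlaneCubic in
theorem mainTheorem9 {K : Type*} [Field K] [CharZero K]
    {k : Type*} [Field k] [IsAlgClosed k] [DecidableEq k] [Algebra K k]
    (F : TernaryCubic K)
    (hF : IsNonsingularCubic (F.poly.map (algebraMap K k))) (hc : F.c ≠ 0) :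
    F.jacobian.IsElliptic ∧
    -- a normalised isomorphism from `{F = 0}` to its Jacobian, which induces `sum`
    ∃ φ : curve (F.poly.map (algebraMap K k)) ≃
        curve (F.jacobian.map (algebraMap K k)).toProjective.polynomial,
      IsNormalizedIso _ _ φ ∧
      ∀ (xP yP : K) (_ : F.jacobian.toAffine.Equation xP yP)
        (θ : F.SpecAlg xP yP ≃ₐ[K] Matrix (Fin 3) (Fin 3) K),
        let N : Fin 3 → Matrix (Fin 3) (Fin 3) k := fun j => (F.cube θ j).map (algebraMap K k)
        -- the cube solves the determinantal problem for `F`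
        (∃ c : K, c ≠ 0 ∧ F.poly = c • slice₁ (F.cube θ)) ∧
        -- the cube defines a genus one curve, and its projections are plane cubics
        DefinesGenusOneCurve N ∧
        FstIsIso (cubeCurve N) (curve (F.poly.map (algebraMap K k))) ∧
        IsNonsingularCubic (slice₂ N) ∧
        SndIsIso (cubeCurve N) (curve (slice₂ N)) ∧
        -- the hyperplane sections `H`, `H'` have degree three and `sum (H - H') = P`
        ∃ π : cubeCurve N → curve (F.poly.map (algebraMap K k)),
          (∀ Q, (π Q : Plane k) = Q.1.1) ∧
          ∀ L L' : Fin 3 → k, L ≠ 0 → L' ≠ 0 →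
            let H : cubeCurve N →₀ ℤ :=
              hyperplaneSection (fun Q => Q.1.1) (F.poly.map (algebraMap K k)) L
            let H' : cubeCurve N →₀ ℤ := hyperplaneSection (fun Q => Q.1.2) (slice₂ N) L'
            H.degree = 3 ∧ H'.degree = 3 ∧
            ∃ hP : (F.jacobian.map (algebraMap K k)).toAffine.Nonsingular
                (algebraMap K k xP) (algebraMap K k yP),
              divisorSum (fun Q => toPoint (F.jacobian.map (algebraMap K k)) (φ (π Q))) (H - H')
                = .some _ _ hP := by
  have : CharZero k := charZero_of_injective_algebraMap (algebraMap K k).injective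
  rw [TernaryCubic.poly_map, TernaryCubic.isNonsingularCubic_poly] at hF
  have hE := hF.isElliptic_jacobian
  obtain ⟨g, hg, h⟩ := hF.exists_comp_eq_jacobian
  have hEK : F.jacobian.IsElliptic := by
    rw [WeierstrassCurve.isElliptic_iff, isUnit_iff_ne_zero]
    intro h0
    rw [WeierstrassCurve.isElliptic_iff, ← TernaryCubic.jacobian_map, WeierstrassCurve.map_Δ, h0,
      map_zero, isUnit_iff_ne_zero] at hE
    exact hE rfl
  refine ⟨hEK, ?_⟩
  rw [TernaryCubic.poly_map, TernaryCubic.jacobian_map, ← TernaryCubic.poly_ofWeierstrass]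
  refine ⟨TernaryCubic.linearEquiv hg h, TernaryCubic.isNormalizedIso_linearEquiv hg h,
    fun xP yP hP θ => ?_⟩
  intro N
  obtain ⟨X, hX⟩ : ∃ X, X = F.algHomOfSpec (k := k) θ F.genX := ⟨_, rfl⟩
  obtain ⟨Y, hY⟩ : ∃ Y, Y = F.algHomOfSpec (k := k) θ F.genY := ⟨_, rfl⟩
  have hN : N = ![X, Y, -1] := hX ▸ hY ▸ F.map_cube θ
  have hc' : (F.map (algebraMap K k)).c ≠ 0 := (map_ne_zero _).mpr hc
  have hS := hF.eq_scale_ofSlices hc' (F.relator_algHomOfSpec θ)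
  have hx := F.xi_algHomOfSpec (k := k) θ
  have hy := F.eta_algHomOfSpec (k := k) θ
  rw [← hX, ← hY] at hS hx hy
  -- The determinantal identity is obtained over k, where the chart is known to be irreducible; its
  -- coefficients come from K, and K → k is injective.
  have hFK : F = (TernaryCubic.ofSlices (F.cube θ)).scale (-F.c) := by
    apply TernaryCubic.map_injective (algebraMap K k)
    dsimp only
    rw [TernaryCubic.map_scale, TernaryCubic.map_ofSlices, map_neg]
    exact hS.trans (by rw [← hN]; rfl)
  have hPk : (F.map (algebraMap K k)).jacobian.toAffine.Nonsingular
      (algebraMap K k xP) (algebraMap K k yP) := by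
    rw [← WeierstrassCurve.Affine.equation_iff_nonsingular, ← TernaryCubic.jacobian_map]
    exact WeierstrassCurve.Affine.Equation.map _ hP
  obtain ⟨h₁, h₂, h₃, h₄, π, hπ, h₅⟩ :=
    hF.cubeCurve_of_relations hS (neg_ne_zero.mpr hc') hx hy hg h hPk hN
  refine ⟨⟨-F.c, neg_ne_zero.mpr hc, ?_⟩, h₁, h₂, h₃, h₄, π, hπ, fun L L' hL hL' => ?_⟩
  · rw [TernaryCubic.slice₁_eq_poly, ← TernaryCubic.poly_scale, ← hFK]
  · obtain ⟨d₁, d₂, hsum⟩ := h₅ L L' hL hL'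
    exact ⟨d₁, d₂, hPk, hsum⟩
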